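/- Let $\mu$ be a symmetric probability distribution on $\mathbb R$ with variance $\sigma^2$, $\sigma>0$, satisfying a Poincaré inequality: there is $C>0$ such that $\int |f-\int f\,d\mu|^2\,d\mu\le C\int|f'|^2\,d\mu$ for every $\mathcal C^1$ function $f:\mathbb R\to\mathbb C$ with $f,f'\in L^2(\mu)$. For each $N$ let $W_N$ be a random $N\times N$ matrix, all of them defined on one probability space (with no assumption on the joint law for different $N$), such that either (complex case) every $W_N$ is Hermitian and the $N^2$ random variables $(W_N)_{ii}$, $\sqrt2\,\Re (W_N)_{ij}$, $\sqrt2\,\Im (W_N)_{ij}$ ($i<j$) are i.i.d. with law $\mu$, or (real case) every $W_N$ is real symmetric and the $N(N+1)/2$ random variables $\frac1{\sqrt2}(W_N)_{ii}$, $(W_N)_{ij}$ ($i<j$) are i.i.d. with law $\mu$. Let $\theta_1>\cdots>\theta_J$ be fixed real numbers with $\theta_{j_o}=0$ for some $j_o$, let $k_j\ge1$ ($j\ne j_o$) be fixed integers, and put $r=\sum_{j\neq j_o}k_j$. For $N\ge r$ let $A_N$ be a deterministic $N\times N$ Hermitian (in the real case: real symmetric) matrix, similar to the diagonal matrix in which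 each $\theta_j$, $j\ne j_o$, is repeated $k_j$ times and $0$ is repeated $N-r$ times. Let $M_N=\frac1{\sqrt N}W_N+A_N$, let $\rho_\theta=\theta+\sigma^2/\theta$ for $|\theta|>\sigma$, and let $$K_\sigma(\theta_1,\dots,\theta_J)=[-2\sigma,2\sigma]\cup\{\rho_{\theta_j}: |\theta_j|>\sigma\}.$$ Then, in both cases, for every $\varepsilon>0$, almost surely, for all sufficiently large $N$, every eigenvalue of $M_N$ belongs to $K_\sigma(\theta_1,\dots,\theta_J)+[-\varepsilon,\varepsilon]$. -/

import Mathlib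

open MeasureTheory ProbabilityTheory Filter
open scoped Pointwise

noncomputable section

/-- The Poincaré inequality for a measure `μ` on `ℝ`: for some constant `C > 0`, the variance of `f`
is at most `C ∫ |f'|² dμ` for every complex-valued `C¹` function `f` with `f, f' ∈ L²(μ)`. -/
def SatisfiesPoincare (μ : Measure ℝ) : Prop :=
  ∃ C : ℝ, 0 < C ∧ ∀ f : ℝ → ℂ, ContDiff ℝ 1 f → MemLp f 2 μ → MemLp (deriv f) 2 μ →
    ∫ x, ‖f x - ∫ y, f y ∂μ‖ ^ 2 ∂μ ≤ C * ∫ x, ‖deriv f x‖ ^ 2 ∂μ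

/-- `μ` is a symmetric probability distribution on `ℝ` with variance `σ²` that satisfies a
Poincaré inequality. -/
structure IsEntryLaw (μ : Measure ℝ) (σ : ℝ) : Prop where
  isProbabilityMeasure : IsProbabilityMeasure μ
  symmetric : μ.map (fun x => -x) = μ
  memLp_two : MemLp (fun x : ℝ => x) 2 μ
  variance_eq : variance (fun x : ℝ => x) μ = σ ^ 2
  poincare : SatisfiesPoincare μ

/-- The `N²` real coordinates of a complex Hermitian matrix: the diagonal entries at the positions
`(i, i)`, `√2 Re W_{ij}` at the positions `(i, j)` and `√2 Im W_{ij}` at the positions `(j, i)`,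
for `i < j`. -/
def hermitianCoord {N : ℕ} (W : Matrix (Fin N) (Fin N) ℂ) (p : Fin N × Fin N) : ℝ :=
  if p.1 = p.2 then (W p.1 p.1).re
  else if p.1 < p.2 then Real.sqrt 2 * (W p.1 p.2).re
  else Real.sqrt 2 * (W p.2 p.1).im

/-- The `N(N+1)/2` coordinates of a real symmetric matrix: `W_{ii} / √2`, and `W_{ij}`
for `i < j`. -/
def symmetricCoord {N : ℕ} (W : Matrix (Fin N) (Fin N) ℝ)
    (p : {p : Fin N × Fin N // p.1 ≤ p.2}) : ℝ :=
  if p.1.1 = p.1.2 then W p.1.1 p.1.1 / Real.sqrt 2 else W p.1.1 p.1.2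

variable {Ω : Type*} [MeasurableSpace Ω]

/-- `W` is a random Hermitian matrix whose `N²` real coordinates are i.i.d. with law `μ`. -/
structure IsComplexWigner (P : Measure Ω) (μ : Measure ℝ) {N : ℕ}
    (W : Ω → Matrix (Fin N) (Fin N) ℂ) : Prop where
  isHermitian : ∀ ω, (W ω).IsHermitian
  hasLaw : ∀ p, HasLaw (fun ω => hermitianCoord (W ω) p) μ P
  indep : iIndepFun (fun p ω => hermitianCoord (W ω) p) P

/-- `W` is a random real symmetric matrix whose `N(N+1)/2` coordinates are i.i.d.
with law `μ`. -/
structure IsRealWigner (P : Measure Ω) (μ : Measure ℝ) {N : ℕ}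
    (W : Ω → Matrix (Fin N) (Fin N) ℝ) : Prop where
  isSymm : ∀ ω, (W ω).IsSymm
  hasLaw : ∀ p, HasLaw (fun ω => symmetricCoord (W ω) p) μ P
  indep : iIndepFun (fun p ω => symmetricCoord (W ω) p) P

/-- The rank `r = ∑_{j ≠ jo} k_j` of the deformation. -/
def deformationRank {J : ℕ} (jo : Fin J) (k : Fin J → ℕ) : ℕ :=
  ∑ j ∈ Finset.univ.erase jo, k j

/-- `d` lists in decreasing order each `θ_j`, `j ≠ jo`, exactly `k_j` times, and `0` exactly
`N - r` times (for strictly decreasing `θ` with `θ_{jo} = 0`). -/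
structure IsSpikeList {J : ℕ} (θ : Fin J → ℝ) (jo : Fin J) (k : Fin J → ℕ) {N : ℕ}
    (d : Fin N → ℝ) : Prop where
  antitone : Antitone d
  card_spike : ∀ j, j ≠ jo → Nat.card {i : Fin N // d i = θ j} = k j
  card_zero : Nat.card {i : Fin N // d i = 0} + deformationRank jo k = N

/-- `A` is Hermitian (symmetric if `𝕜 = ℝ`) and similar to the diagonal matrix with diagonal
`(θ_1, …, θ_1, …, 0, …, 0, …, θ_J, …, θ_J)`, where `θ_j` is repeated `k_j` times for `j ≠ jo`. -/
structure IsDeformation {𝕜 : Type*} [RCLike 𝕜] {J : ℕ} (θ : Fin J → ℝ) (jo : Fin J)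
    (k : Fin J → ℕ) {N : ℕ} (A : Matrix (Fin N) (Fin N) 𝕜) : Prop where
  isHermitian : A.IsHermitian
  similar : ∃ d : Fin N → ℝ, IsSpikeList θ jo k d ∧
    ∃ S : (Matrix (Fin N) (Fin N) 𝕜)ˣ,
      A = S.val * Matrix.diagonal (fun i => (d i : 𝕜)) * S.inv

/-- The deformed Wigner matrix `M_N = W_N / √N + A_N`. -/
def deformedWigner {𝕜 : Type*} [RCLike 𝕜] {N : ℕ} (W A : Matrix (Fin N) (Fin N) 𝕜) :
    Matrix (Fin N) (Fin N) 𝕜 :=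
  (1 / Real.sqrt N) • W + A

/-- `ρ_θ = θ + σ² / θ`; only used for `|θ| > σ > 0`. -/
def outlierLocation (σ θ : ℝ) : ℝ := θ + σ ^ 2 / θ

/-- `K_σ(θ_1, …, θ_J) = [-2σ, 2σ] ∪ {ρ_{θ_j} : |θ_j| > σ}`. -/
def limitSupport (σ : ℝ) {J : ℕ} (θ : Fin J → ℝ) : Set ℝ :=
  Set.Icc (-2 * σ) (2 * σ) ∪ {x | ∃ j, σ < |θ j| ∧ x = outlierLocation σ (θ j)}

end

/-! Put X = W_N/√N. The proof isolates two properties of X, shows that they fail with summable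
probability, and concludes by a deterministic argument and Borel–Cantelli, which needs nothing about
the joint law for different N. With t_a, u_a the nonzero eigenvalues of A and orthonormal
eigenvectors, and m_k the moments of the semicircle law of variance σ², the properties are: (i) ‖X‖
≤ 2σ + ε/2; (ii) u_a* X^k u_b is close to m_k δ_ab for finitely many k.

Deterministic part (`exists_outlier_criterion`). If (X + A)ψ = xψ with |x| ≥ 2σ + ε, iterate ψ =
x⁻¹(Xψ + Aψ) finitely often and pair with the u_a for which |u_a*ψ| is largest. Dividing by u_a*ψ
gives 1 - t_a g ≈ 0, where g = Σ m_k x^(-k-1). Since g = x⁻¹(1 + σ²g²) and |g| ≤ 1/σ, h = 1/g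
satisfies x = h + σ²/h and |h| ≥ σ. So t_a ≈ h, which forces |t_a| > σ and x ≈ t_a + σ²/t_a
(`exists_outlier_tolerance`).

Property (i) (`IsEntryLaw.norm_tail`) is the moment method at order 2p with p ~ log N. The Poincaré
inequality bounds the 2n-th entry moment by σ²β^(n-1) for 1 ≤ n ≤ p, with β = C p² + σ². These
bounds are the moments of a law on three points, so E tr X^(2p) is dominated, coefficient by
coefficient, by the same trace for a nonnegative combination of matrices with three-point
coordinates. Integration by parts, with a remainder involving third derivatives, gives a perturbed
Catalan recursion for the latter, hence the bound N (4r)^p with r → σ², because p⁷/N → 0.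

Property (ii) (`IsEntryLaw.exists_moment_tail_le`) has two halves. The Poincaré inequality
tensorizes and controls variances and fourth central moments of u* X^k w by its gradient, which is
O(N^(-1/2)) up to powers of ‖X‖. The mean of (X^k)_ij vanishes for i ≠ j by sign symmetry, and for i
= j the same integration by parts reproduces the semicircle recursion up to O(N^(-1/2)). -/

/-! ### Symmetric laws and their moments. -/

/-- A symmetric probability measure on `ℝ` all of whose moments are finite. -/
structure IsSymmLaw (μ : Measure ℝ) : Prop where
  prob : IsProbabilityMeasure μ
  symm : μ.map (fun x => -x) = μ
  integrable_pow : ∀ n : ℕ, Integrable (fun x : ℝ => x ^ n) μ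

/-- The `n`-th moment of a measure on `ℝ`. -/
noncomputable def rawMoment (μ : Measure ℝ) (n : ℕ) : ℝ := ∫ x, x ^ n ∂μ

theorem integral_neg_of_symm {μ : Measure ℝ} (h : μ.map (fun x => -x) = μ) (f : ℝ → ℝ) :
    ∫ x, f (-x) ∂μ = ∫ x, f x ∂μ := by
  conv_rhs => rw [← h]
  exact ((Homeomorph.neg ℝ).measurableEmbedding.integral_map f).symm

theorem rawMoment_odd {μ : Measure ℝ} (h : μ.map (fun x => -x) = μ) {n : ℕ} (hn : Odd n) :
    rawMoment μ n = 0 := by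
  have := integral_neg_of_symm h (fun x => x ^ n)
  simp only [hn.neg_pow, integral_neg] at this
  unfold rawMoment
  linarith

theorem rawMoment_zero {μ : Measure ℝ} [IsProbabilityMeasure μ] : rawMoment μ 0 = 1 := by
  simp [rawMoment]

theorem rawMoment_even_nonneg (μ : Measure ℝ) (n : ℕ) : 0 ≤ rawMoment μ (2 * n) :=
  integral_nonneg fun x => (even_two_mul n).pow_nonneg x

theorem integral_add_add {α E : Type*} [MeasurableSpace α] [NormedAddCommGroup E]
    [NormedSpace ℝ E] {μ : Measure α} {f g h : α → E}
    (hf : Integrable f μ) (hg : Integrable g μ) (hh : Integrable h μ) :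
    ∫ x, f x + g x + h x ∂μ = ∫ x, f x ∂μ + ∫ x, g x ∂μ + ∫ x, h x ∂μ := by
  have h1 : ∫ x, f x + g x + h x ∂μ = ∫ x, (f x + g x) ∂μ + ∫ x, h x ∂μ :=
    integral_add (hf.add hg) hh
  rw [h1, integral_add hf hg]

/-- Cauchy–Schwarz: the quadratic polynomial s ↦ ∫ (a - s b)² is nonnegative, so its discriminant is
not positive. -/
theorem sq_integral_mul_le {α : Type*} [MeasurableSpace α] {μ : Measure α} {a b : α → ℝ}
    (ha : Integrable (fun x => a x ^ 2) μ) (hb : Integrable (fun x => b x ^ 2) μ)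
    (hab : Integrable (fun x => a x * b x) μ) :
    (∫ x, a x * b x ∂μ) ^ 2 ≤ (∫ x, a x ^ 2 ∂μ) * ∫ x, b x ^ 2 ∂μ := by
  have h : ∀ s : ℝ, 0 ≤ (∫ x, b x ^ 2 ∂μ) * (s * s) + (-2 * ∫ x, a x * b x ∂μ) * s
      + ∫ x, a x ^ 2 ∂μ := by
    intro s
    have h0 : 0 ≤ ∫ x, (a x - s * b x) ^ 2 ∂μ := integral_nonneg fun x => by positivity
    have h1 : ∫ x, (a x - s * b x) ^ 2 ∂μ
        = ∫ x, (s * s * b x ^ 2 + (-2 * s) * (a x * b x)) + a x ^ 2 ∂μ :=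
      integral_congr_ae (Eventually.of_forall fun x => by dsimp only; ring)
    rw [h1, integral_add_add (hb.const_mul _) (hab.const_mul _) ha, integral_const_mul,
      integral_const_mul] at h0
    linarith
  have := discrim_le_zero h
  unfold discrim at this
  nlinarith

/-! ### Moments of the entry law from its Poincaré inequality. -/

section EntryLaw

variable {μ : Measure ℝ} {σ : ℝ}

theorem IsEntryLaw.integrable_sq (h : IsEntryLaw μ σ) : Integrable (fun x : ℝ => x ^ 2) μ :=
  h.memLp_two.integrable_sq

theorem IsEntryLaw.rawMoment_two (h : IsEntryLaw μ σ) : rawMoment μ 2 = σ ^ 2 := by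
  have := h.isProbabilityMeasure
  have h1 := variance_eq_sub h.memLp_two
  rw [h.variance_eq] at h1
  have h2 : ∫ x, x ∂μ = 0 := by
    have := rawMoment_odd h.symmetric odd_one
    simpa [rawMoment] using this
  simp only [h2] at h1
  simp only [rawMoment]
  simpa using h1.symm

/-- The function R sin(x/R) is a bounded smooth truncation of x with slope at most 1. The Poincaré
inequality applies to its powers before any higher moment of μ is known to be finite. -/
theorem sinTrunc_abs_le {R : ℝ} (hR : 0 < R) (x : ℝ) : |R * Real.sin (x / R)| ≤ |x| := by
  rw [abs_mul, abs_of_pos hR]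
  calc R * |Real.sin (x / R)| ≤ R * |x / R| := mul_le_mul_of_nonneg_left Real.abs_sin_le_abs hR.le
    _ = |x| := by rw [abs_div, abs_of_pos hR]; field_simp

theorem sinTrunc_tendsto (x : ℝ) :
    Tendsto (fun k : ℕ => ((k : ℝ) + 1) * Real.sin (x / ((k : ℝ) + 1))) atTop (nhds x) := by
  have h1 : Tendsto (fun k : ℕ => x / ((k : ℝ) + 1)) atTop (nhds 0) := by
    have := (tendsto_one_div_add_atTop_nhds_zero_nat (𝕜 := ℝ)).const_mul x
    simpa [div_eq_mul_inv] using this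
  have h2 : Tendsto (fun k : ℕ => Real.sinc (x / ((k : ℝ) + 1))) atTop (nhds 1) := by
    have := (Real.continuous_sinc.tendsto 0).comp h1
    simpa [Function.comp_def] using this
  have h3 := h2.const_mul x
  rw [mul_one] at h3
  refine h3.congr fun k => ?_
  by_cases hx : x = 0
  · simp [hx]
  · have : (k : ℝ) + 1 ≠ 0 := by positivity
    rw [Real.sinc_of_ne_zero (by positivity)]
    field_simp

/-- Apply Poincaré to φ^(n+1), φ = R sin(x/R). The gradient term is at most C (n+1)² M₂ₙ since |φ'|
≤ 1 and |φ| ≤ |x|; the squared mean is at most M₂ₙ σ² by Cauchy–Schwarz on φⁿ · φ. The bound does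
not depend on R. -/
theorem IsEntryLaw.trunc_moment_le (h : IsEntryLaw μ σ) {C : ℝ} (hC : 0 < C)
    (hP : ∀ f : ℝ → ℂ, ContDiff ℝ 1 f → MemLp f 2 μ → MemLp (deriv f) 2 μ →
      ∫ x, ‖f x - ∫ y, f y ∂μ‖ ^ 2 ∂μ ≤ C * ∫ x, ‖deriv f x‖ ^ 2 ∂μ)
    (n : ℕ) (hn : Integrable (fun x : ℝ => x ^ (2 * n)) μ) {R : ℝ} (hR : 0 < R) :
    ∫ x, (R * Real.sin (x / R)) ^ (2 * n + 2) ∂μ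
      ≤ (C * (n + 1) ^ 2 + σ ^ 2) * rawMoment μ (2 * n) := by
  have := h.isProbabilityMeasure
  set φ : ℝ → ℝ := fun x => R * Real.sin (x / R) with hφ
  have hφc : Continuous φ := by fun_prop
  have hφb : ∀ x, |φ x| ≤ R := fun x => by
    rw [hφ]; simp only [abs_mul, abs_of_pos hR]
    nlinarith [Real.abs_sin_le_one (x / R)]
  have hb : ∀ m : ℕ, Integrable (fun x => φ x ^ m) μ := fun m =>
    Integrable.of_bound (C := R ^ m) (hφc.pow m).aestronglyMeasurable
      (Eventually.of_forall fun x => by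
        rw [Real.norm_eq_abs, abs_pow]; gcongr; exact hφb x)
  set f : ℝ → ℂ := fun x => ((φ x ^ (n + 1) : ℝ) : ℂ) with hf
  have hd : ∀ x, HasDerivAt (fun x => φ x ^ (n + 1)) ((n + 1) * φ x ^ n * Real.cos (x / R)) x := by
    intro x
    have h1 : HasDerivAt φ (R * (Real.cos (x / R) * (1 / R))) x :=
      (((hasDerivAt_id x).div_const R).sin).const_mul R
    have h2 := h1.pow (n + 1)
    refine h2.congr_deriv ?_
    have : R * (Real.cos (x / R) * (1 / R)) = Real.cos (x / R) := by field_simp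
    rw [this]
    push_cast
    simp
  have hdf : deriv f = fun x => (((n + 1) * φ x ^ n * Real.cos (x / R) : ℝ) : ℂ) := by
    funext x; exact (hd x).ofReal_comp.deriv
  have hcd : ContDiff ℝ 1 f := by
    refine Complex.ofRealCLM.contDiff.comp (ContDiff.pow ?_ _)
    exact contDiff_const.mul (Real.contDiff_sin.comp (contDiff_id.div_const R))
  have hL : MemLp f 2 μ := MemLp.of_bound hcd.continuous.aestronglyMeasurable (R ^ (n + 1))
    (Eventually.of_forall fun x => by
      simp only [hf, Complex.norm_real, Real.norm_eq_abs, abs_pow]; gcongr; exact hφb x)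
  have hL' : MemLp (deriv f) 2 μ := by
    refine MemLp.of_bound (C := (n + 1) * R ^ n) (Continuous.aestronglyMeasurable ?_)
      (Eventually.of_forall fun x => ?_)
    · rw [hdf]; fun_prop
    · rw [hdf]
      simp only [Complex.norm_real, Real.norm_eq_abs, abs_mul, abs_pow]
      have h3 : |(n : ℝ) + 1| = n + 1 := abs_of_pos (by positivity)
      rw [h3]
      calc ((n : ℝ) + 1) * |φ x| ^ n * |Real.cos (x / R)| ≤ (n + 1) * R ^ n * 1 := by
            gcongr
            · exact hφb x
            · exact Real.abs_cos_le_one _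
        _ = _ := mul_one _
  have key := hP f hcd hL hL'
  have hm : ∫ y, f y ∂μ = ((∫ y, φ y ^ (n + 1) ∂μ : ℝ) : ℂ) := integral_ofReal
  have h1 : ∫ x, ‖f x - ∫ y, f y ∂μ‖ ^ 2 ∂μ
      = ∫ x, φ x ^ (2 * n + 2) ∂μ - (∫ y, φ y ^ (n + 1) ∂μ) ^ 2 := by
    rw [hm]
    set c := ∫ y, φ y ^ (n + 1) ∂μ with hc
    have h2 : ∫ x, ‖f x - (c : ℂ)‖ ^ 2 ∂μ
        = ∫ x, (φ x ^ (2 * n + 2) + (-2 * c) * φ x ^ (n + 1)) + c ^ 2 ∂μ := by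
      refine integral_congr_ae (Eventually.of_forall fun x => ?_)
      simp only [hf]
      rw [← Complex.ofReal_sub, Complex.norm_real, Real.norm_eq_abs, sq_abs]
      ring
    rw [h2, integral_add_add (hb _) ((hb _).const_mul _) (integrable_const _),
      integral_const_mul, ← hc]
    simp
    ring
  have h2 : ∫ x, ‖deriv f x‖ ^ 2 ∂μ ≤ (n + 1) ^ 2 * rawMoment μ (2 * n) := by
    rw [rawMoment, ← integral_const_mul]
    refine integral_mono_of_nonneg (Eventually.of_forall fun x => by positivity)
      (hn.const_mul _) (Eventually.of_forall fun x => ?_)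
    simp only [hdf, Complex.norm_real, Real.norm_eq_abs, sq_abs]
    have h5 : φ x ^ 2 ≤ x ^ 2 := sq_le_sq.mpr (sinTrunc_abs_le hR x)
    have h6 : Real.cos (x / R) ^ 2 ≤ 1 := Real.cos_sq_le_one _
    calc ((n + 1) * φ x ^ n * Real.cos (x / R)) ^ 2
        = (n + 1) ^ 2 * (φ x ^ 2) ^ n * Real.cos (x / R) ^ 2 := by ring
      _ ≤ (n + 1) ^ 2 * (x ^ 2) ^ n * 1 := by gcongr
      _ = _ := by ring
  have h3 : (∫ y, φ y ^ (n + 1) ∂μ) ^ 2 ≤ rawMoment μ (2 * n) * σ ^ 2 := by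
    have h4 := sq_integral_mul_le (μ := μ) (a := fun x => φ x ^ n) (b := φ)
      (by simpa [← pow_mul] using hb (n * 2)) (hb 2) (by simpa [← pow_succ] using hb (n + 1))
    have h5 : ∫ x, (φ x ^ n) ^ 2 ∂μ ≤ rawMoment μ (2 * n) := by
      refine integral_mono_of_nonneg (Eventually.of_forall fun x => by positivity) hn
        (Eventually.of_forall fun x => ?_)
      have h5 : φ x ^ 2 ≤ x ^ 2 := sq_le_sq.mpr (sinTrunc_abs_le hR x)
      calc (φ x ^ n) ^ 2 = (φ x ^ 2) ^ n := by ring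
        _ ≤ (x ^ 2) ^ n := by gcongr
        _ = _ := by ring
    have h6 : ∫ x, φ x ^ 2 ∂μ ≤ σ ^ 2 := by
      rw [← h.rawMoment_two]
      exact integral_mono_of_nonneg (Eventually.of_forall fun x => by positivity) h.integrable_sq
        (Eventually.of_forall fun x => sq_le_sq.mpr (sinTrunc_abs_le hR x))
    have h7 : 0 ≤ ∫ x, φ x ^ 2 ∂μ := integral_nonneg fun x => by positivity
    calc (∫ y, φ y ^ (n + 1) ∂μ) ^ 2 = (∫ y, φ y ^ n * φ y ∂μ) ^ 2 := by simp [← pow_succ]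
      _ ≤ _ := h4
      _ ≤ _ := mul_le_mul h5 h6 h7 (rawMoment_even_nonneg μ n)
  rw [h1] at key
  nlinarith [mul_le_mul_of_nonneg_left h2 hC.le]

/-- Fatou's lemma along R = k + 1 → ∞ in the truncated bound. -/
theorem IsEntryLaw.moment_step (h : IsEntryLaw μ σ) {C : ℝ} (hC : 0 < C)
    (hP : ∀ f : ℝ → ℂ, ContDiff ℝ 1 f → MemLp f 2 μ → MemLp (deriv f) 2 μ →
      ∫ x, ‖f x - ∫ y, f y ∂μ‖ ^ 2 ∂μ ≤ C * ∫ x, ‖deriv f x‖ ^ 2 ∂μ)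
    (n : ℕ) (hn : Integrable (fun x : ℝ => x ^ (2 * n)) μ) :
    Integrable (fun x : ℝ => x ^ (2 * (n + 1))) μ ∧
      rawMoment μ (2 * (n + 1)) ≤ (C * (n + 1) ^ 2 + σ ^ 2) * rawMoment μ (2 * n) := by
  have := h.isProbabilityMeasure
  set K := (C * (n + 1) ^ 2 + σ ^ 2) * rawMoment μ (2 * n) with hK
  have hK0 : 0 ≤ K := mul_nonneg (by positivity) (rawMoment_even_nonneg μ n)
  have hle : ∫⁻ x, ENNReal.ofReal (x ^ (2 * (n + 1))) ∂μ ≤ ENNReal.ofReal K := by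
    have h1 : ∀ x : ℝ, ENNReal.ofReal (x ^ (2 * (n + 1)))
        = liminf (fun k : ℕ => ENNReal.ofReal
          ((((k : ℝ) + 1) * Real.sin (x / ((k : ℝ) + 1))) ^ (2 * n + 2))) atTop := fun x =>
      ((ENNReal.continuous_ofReal.tendsto _).comp ((sinTrunc_tendsto x).pow _)).liminf_eq.symm
    simp_rw [h1]
    refine (lintegral_liminf_le fun k => by fun_prop).trans ?_
    refine liminf_le_of_le (by isBoundedDefault) fun b hb => ?_
    obtain ⟨k, hk⟩ := hb.exists
    refine hk.trans ?_
    have hk0 : (0 : ℝ) < k + 1 := by positivity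
    rw [← ofReal_integral_eq_lintegral_ofReal]
    · exact ENNReal.ofReal_le_ofReal (h.trunc_moment_le hC hP n hn hk0)
    · refine Integrable.of_bound (C := ((k : ℝ) + 1) ^ (2 * n + 2))
        (Continuous.aestronglyMeasurable (by fun_prop)) (Eventually.of_forall fun x => ?_)
      rw [Real.norm_eq_abs, abs_pow, abs_mul, abs_of_pos hk0]
      gcongr
      nlinarith [Real.abs_sin_le_one (x / ((k : ℝ) + 1))]
    · exact Eventually.of_forall fun x => (even_two_mul (n + 1)).pow_nonneg _
  have hint : Integrable (fun x : ℝ => x ^ (2 * (n + 1))) μ := by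
    refine (lintegral_ofReal_ne_top_iff_integrable
      (Continuous.aestronglyMeasurable (by fun_prop))
      (Eventually.of_forall fun x => (even_two_mul (n + 1)).pow_nonneg _)).1 ?_
    exact (hle.trans_lt ENNReal.ofReal_lt_top).ne
  refine ⟨hint, ?_⟩
  rw [← ofReal_integral_eq_lintegral_ofReal hint
    (Eventually.of_forall fun x => (even_two_mul (n + 1)).pow_nonneg _)] at hle
  exact (ENNReal.ofReal_le_ofReal_iff hK0).1 hle

theorem IsEntryLaw.isSymmLaw (h : IsEntryLaw μ σ) : IsSymmLaw μ := by
  have := h.isProbabilityMeasure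
  obtain ⟨C, hC, hP⟩ := h.poincare
  have heven : ∀ n : ℕ, Integrable (fun x : ℝ => x ^ (2 * n)) μ := by
    intro n
    induction n with
    | zero => simp
    | succ n ih => exact (h.moment_step hC hP n ih).1
  refine ⟨h.isProbabilityMeasure, h.symmetric, fun n => ?_⟩
  refine Integrable.mono' ((integrable_const (1 : ℝ)).add (heven n))
    (Continuous.aestronglyMeasurable (by fun_prop)) (Eventually.of_forall fun x => ?_)
  rw [Real.norm_eq_abs]
  have h1 : (x ^ n) ^ 2 = x ^ (2 * n) := by ring
  simp only [Pi.add_apply, ← h1]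
  nlinarith [sq_nonneg (|x ^ n| - 1), sq_abs (x ^ n)]

/-- Growth of the even moments: `M₂ₙ ≤ σ² βⁿ⁻¹` up to `n = p`. -/
theorem IsEntryLaw.moment_growth (h : IsEntryLaw μ σ) :
    ∃ C : ℝ, 0 < C ∧ ∀ p : ℕ, ∀ n : ℕ, n + 1 ≤ p →
      rawMoment μ (2 * (n + 1)) ≤ σ ^ 2 * (C * (p : ℝ) ^ 2 + σ ^ 2) ^ n := by
  obtain ⟨C, hC, hP⟩ := h.poincare
  refine ⟨C, hC, fun p n => ?_⟩
  induction n with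
  | zero => intro _; simp [h.rawMoment_two]
  | succ n ih =>
    intro hn
    refine (h.moment_step hC hP (n + 1) (h.isSymmLaw.integrable_pow _)).2.trans ?_
    -- Each step gains at most the factor C p² + σ², because the index stays below p.
    have h1 : ((n + 1 : ℕ) : ℝ) + 1 ≤ p := by exact_mod_cast hn
    calc (C * (((n + 1 : ℕ) : ℝ) + 1) ^ 2 + σ ^ 2) * rawMoment μ (2 * (n + 1))
        ≤ (C * (p : ℝ) ^ 2 + σ ^ 2) * (σ ^ 2 * (C * (p : ℝ) ^ 2 + σ ^ 2) ^ n) := by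
          gcongr
          · exact rawMoment_even_nonneg μ (n + 1)
          · exact ih (by omega)
      _ = _ := by ring

end EntryLaw

/-! ### Polynomials in i.i.d. variables and tensorization of the Poincaré inequality. -/

section PolynomialMean

set_option linter.unusedSectionVars false

variable {ι : Type*} [Fintype ι] [DecidableEq ι] {𝕜 : Type*} [RCLike 𝕜]

/-- Evaluation of a polynomial with coefficients in `𝕜` at a real point. -/
noncomputable def evalAt (x : ι → ℝ) : MvPolynomial ι 𝕜 →+* 𝕜 :=
  MvPolynomial.eval fun e => ((x e : ℝ) : 𝕜)

@[simp] theorem evalAt_C (x : ι → ℝ) (a : 𝕜) : evalAt x (MvPolynomial.C a) = a := by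
  simp [evalAt]

@[simp] theorem evalAt_X (x : ι → ℝ) (e : ι) :
    evalAt x (MvPolynomial.X e : MvPolynomial ι 𝕜) = ((x e : ℝ) : 𝕜) := by
  simp [evalAt]

theorem evalAt_monomial (x : ι → ℝ) (m : ι →₀ ℕ) (a : 𝕜) :
    evalAt x (MvPolynomial.monomial m a) = a * ∏ e, ((x e : ℝ) : 𝕜) ^ m e := by
  rw [evalAt, MvPolynomial.eval_monomial, Finsupp.prod_fintype _ _ fun i => pow_zero _]

/-- The partial mean of a polynomial in i.i.d. variables of law `μ`: the variables in `s` are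
integrated out. -/
noncomputable def partialMean (μ : Measure ℝ) (s : Finset ι) :
    MvPolynomial ι 𝕜 →ₗ[𝕜] MvPolynomial ι 𝕜 :=
  (MvPolynomial.basisMonomials ι 𝕜).constr 𝕜 fun m =>
    MvPolynomial.monomial (m.filter (· ∉ s)) (∏ e ∈ s, (rawMoment μ (m e) : 𝕜))

/-- The mean of a polynomial in i.i.d. variables of law `μ`. -/
noncomputable def polyMean (μ : Measure ℝ) : MvPolynomial ι 𝕜 →ₗ[𝕜] 𝕜 :=
  (MvPolynomial.basisMonomials ι 𝕜).constr 𝕜 fun m => ∏ e, (rawMoment μ (m e) : 𝕜)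

theorem polyMean_monomial (μ : Measure ℝ) (m : ι →₀ ℕ) (a : 𝕜) :
    polyMean μ (MvPolynomial.monomial m a) = a * ∏ e, (rawMoment μ (m e) : 𝕜) := by
  have h : MvPolynomial.monomial m a = a • (MvPolynomial.basisMonomials ι 𝕜) m := by
    simp [MvPolynomial.smul_monomial]
  rw [h, map_smul, polyMean, Module.Basis.constr_basis, smul_eq_mul]

theorem partialMean_monomial (μ : Measure ℝ) (s : Finset ι) (m : ι →₀ ℕ) (a : 𝕜) :
    partialMean μ s (MvPolynomial.monomial m a)
      = MvPolynomial.monomial (m.filter (· ∉ s)) (a * ∏ e ∈ s, (rawMoment μ (m e) : 𝕜)) := by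
  have h : MvPolynomial.monomial m a = a • (MvPolynomial.basisMonomials ι 𝕜) m := by
    simp [MvPolynomial.smul_monomial]
  rw [h, map_smul, partialMean, Module.Basis.constr_basis, MvPolynomial.smul_monomial, smul_eq_mul]

theorem polyMean_C {μ : Measure ℝ} [IsProbabilityMeasure μ] (a : 𝕜) :
    polyMean (ι := ι) μ (MvPolynomial.C a) = a := by
  rw [← MvPolynomial.monomial_zero', polyMean_monomial]
  simp [rawMoment_zero]

theorem integrable_evalAt {μ : Measure ℝ} (h : IsSymmLaw μ) (P : MvPolynomial ι 𝕜) :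
    Integrable (fun x => evalAt x P) (Measure.pi fun _ : ι => μ) := by
  have := h.prob
  induction P using MvPolynomial.induction_on' with
  | monomial m a =>
    simp_rw [evalAt_monomial]
    refine Integrable.const_mul ?_ _
    refine Integrable.fintype_prod (f := fun e t => ((t : ℝ) : 𝕜) ^ m e) fun e => ?_
    simpa using (h.integrable_pow (m e)).ofReal (𝕜 := 𝕜)
  | add p q hp hq => simp only [map_add]; exact hp.add hq

/-- The bridge between two descriptions of the mean: `polyMean` is linear and explicit on monomials,
while the integral allows pointwise inequalities. -/
theorem integral_evalAt {μ : Measure ℝ} (h : IsSymmLaw μ) (P : MvPolynomial ι 𝕜) :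
    ∫ x, evalAt x P ∂(Measure.pi fun _ : ι => μ) = polyMean μ P := by
  have := h.prob
  induction P using MvPolynomial.induction_on' with
  | monomial m a =>
    simp_rw [evalAt_monomial]
    rw [integral_const_mul, integral_fintype_prod_eq_prod (fun e t => ((t : ℝ) : 𝕜) ^ m e),
      polyMean_monomial]
    congr 1
    refine Finset.prod_congr rfl fun e _ => ?_
    rw [rawMoment, ← integral_ofReal]
    simp
  | add p q hp hq =>
    simp only [map_add]
    rw [integral_add (integrable_evalAt h p) (integrable_evalAt h q), hp, hq]

theorem partialMean_empty (μ : Measure ℝ) (P : MvPolynomial ι 𝕜) : partialMean μ ∅ P = P := by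
  induction P using MvPolynomial.induction_on' with
  | monomial m a => 
    have h : m.filter (· ∉ (∅ : Finset ι)) = m := Finsupp.ext fun i => by simp
    rw [partialMean_monomial, h]
    simp
  | add p q hp hq => rw [map_add, hp, hq]

theorem partialMean_univ (μ : Measure ℝ) (P : MvPolynomial ι 𝕜) :
    partialMean μ Finset.univ P = MvPolynomial.C (polyMean μ P) := by
  induction P using MvPolynomial.induction_on' with
  | monomial m a =>
    have h : m.filter (· ∉ (Finset.univ : Finset ι)) = 0 := Finsupp.ext fun i => by simp
    rw [partialMean_monomial, polyMean_monomial, ← MvPolynomial.monomial_zero', h]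
  | add p q hp hq => rw [map_add, hp, hq, map_add, map_add]

theorem partialMean_insert (μ : Measure ℝ) {e : ι} {s : Finset ι} (he : e ∉ s)
    (P : MvPolynomial ι 𝕜) :
    partialMean μ (insert e s) P = partialMean μ {e} (partialMean μ s P) := by
  induction P using MvPolynomial.induction_on' with
  | monomial m a =>
    have h : m.filter (· ∉ insert e s) = (m.filter (· ∉ s)).filter (· ∉ ({e} : Finset ι)) :=
      Finsupp.ext fun i => by
        by_cases h1 : i = e <;> by_cases h2 : i ∈ s <;> simp [h1, h2]
    rw [partialMean_monomial, partialMean_monomial, partialMean_monomial, Finset.prod_insert he,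
      Finset.prod_singleton, h, Finsupp.filter_apply_pos (· ∉ s) _ he]
    congr 1
    ring
  | add p q hp hq => simp only [map_add, hp, hq]

theorem polyMean_partialMean {μ : Measure ℝ} [IsProbabilityMeasure μ] (e : ι)
    (P : MvPolynomial ι 𝕜) : polyMean μ (partialMean μ {e} P) = polyMean μ P := by
  induction P using MvPolynomial.induction_on' with
  | monomial m a =>
    rw [partialMean_monomial, polyMean_monomial, polyMean_monomial, Finset.prod_singleton, mul_assoc]
    congr 1
    rw [← Finset.mul_prod_erase Finset.univ (fun i => (rawMoment μ (m i) : 𝕜)) (Finset.mem_univ e),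
      ← Finset.mul_prod_erase Finset.univ _ (Finset.mem_univ e)]
    simp only [Finset.mem_singleton, not_true_eq_false, not_false_eq_true,
      Finsupp.filter_apply_neg, rawMoment_zero]
    simp only [RCLike.ofReal_one, one_mul]
    congr 1
    refine Finset.prod_congr rfl fun i hi => ?_
    rw [Finsupp.filter_apply_pos]
    simpa using hi
  | add p q hp hq => simp only [map_add, hp, hq]

/-- The pull-out property of conditional expectation: after integrating out the variable `e`, the
factor no longer involves it. -/
theorem partialMean_mul_partialMean {μ : Measure ℝ} [IsProbabilityMeasure μ] (e : ι)
    (P Q : MvPolynomial ι 𝕜) :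
    partialMean μ {e} (P * partialMean μ {e} Q) = partialMean μ {e} P * partialMean μ {e} Q := by
  induction Q using MvPolynomial.induction_on' with
  | monomial m a =>
    induction P using MvPolynomial.induction_on' with
    | monomial n b =>
      have h : (n + m.filter (· ∉ ({e} : Finset ι))).filter (· ∉ ({e} : Finset ι))
          = n.filter (· ∉ ({e} : Finset ι)) + m.filter (· ∉ ({e} : Finset ι)) :=
        Finsupp.ext fun i => by by_cases h : i = e <;> simp [h]
      rw [partialMean_monomial, partialMean_monomial, MvPolynomial.monomial_mul,
        MvPolynomial.monomial_mul, partialMean_monomial, h]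
      simp [Finsupp.filter_apply]
      congr 1
      ring
    | add p q hp hq => simp only [add_mul, map_add, hp, hq]
  | add p q hp hq => simp only [mul_add, map_add, hp, hq]

theorem partialMean_idem {μ : Measure ℝ} [IsProbabilityMeasure μ] (e : ι)
    (P : MvPolynomial ι 𝕜) :
    partialMean μ {e} (partialMean μ {e} P) = partialMean μ {e} P := by
  have h := partialMean_mul_partialMean (μ := μ) e 1 P
  have h1 : partialMean μ {e} (1 : MvPolynomial ι 𝕜) = 1 := by
    have h2 : (0 : ι →₀ ℕ).filter (· ∉ ({e} : Finset ι)) = 0 := Finsupp.filter_zero _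
    rw [← MvPolynomial.C_1, ← MvPolynomial.monomial_zero', partialMean_monomial, h2]
    simp [rawMoment_zero]
  simpa only [h1, one_mul] using h

theorem evalAt_monomial_update (x : ι → ℝ) (e : ι) (t : ℝ) (m : ι →₀ ℕ) (a : 𝕜) :
    evalAt (Function.update x e t) (MvPolynomial.monomial m a)
      = evalAt x (MvPolynomial.monomial (m.filter (· ∉ ({e} : Finset ι))) a)
        * ((t : ℝ) : 𝕜) ^ m e := by
  have h1 : evalAt (Function.update x e t) (MvPolynomial.monomial (m.filter (· ∉ ({e} : Finset ι))) a)
      = evalAt x (MvPolynomial.monomial (m.filter (· ∉ ({e} : Finset ι))) a) := by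
    simp only [evalAt, MvPolynomial.eval_monomial]
    congr 1
    refine Finsupp.prod_congr fun i hi => ?_
    have : i ≠ e := by
      rintro rfl
      simp [Finsupp.support_filter] at hi
    rw [Function.update_of_ne this]
  rw [← h1]
  have h2 : MvPolynomial.monomial m a
      = MvPolynomial.monomial (m.filter (· ∉ ({e} : Finset ι))) a
        * (MvPolynomial.X e : MvPolynomial ι 𝕜) ^ m e := by
    have h3 : m = m.filter (· ∉ ({e} : Finset ι)) + Finsupp.single e (m e) :=
      Finsupp.ext fun i => by
        by_cases h : i = e
        · subst h; simp
        · simp [h]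
    rw [MvPolynomial.X_pow_eq_monomial, MvPolynomial.monomial_mul, mul_one, ← h3]
  conv_lhs => rw [h2]
  simp

theorem integrable_evalAt_update {μ : Measure ℝ} (h : IsSymmLaw μ) (x : ι → ℝ) (e : ι)
    (P : MvPolynomial ι 𝕜) : Integrable (fun t => evalAt (Function.update x e t) P) μ := by
  induction P using MvPolynomial.induction_on' with
  | monomial m a =>
    simp_rw [evalAt_monomial_update]
    refine Integrable.const_mul ?_ _
    simpa using (h.integrable_pow (m e)).ofReal (𝕜 := 𝕜)
  | add p q hp hq => simp only [map_add]; exact hp.add hq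

theorem evalAt_partialMean {μ : Measure ℝ} (h : IsSymmLaw μ) (x : ι → ℝ) (e : ι)
    (P : MvPolynomial ι 𝕜) :
    evalAt x (partialMean μ {e} P) = ∫ t, evalAt (Function.update x e t) P ∂μ := by
  induction P using MvPolynomial.induction_on' with
  | monomial m a =>
    simp_rw [evalAt_monomial_update]
    rw [integral_const_mul, partialMean_monomial, Finset.prod_singleton,
      mul_comm a, ← MvPolynomial.C_mul_monomial, map_mul, evalAt_C, mul_comm]
    congr 1
    rw [rawMoment, ← integral_ofReal]
    simp
  | add p q hp hq =>
    simp only [map_add, hp, hq]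
    rw [integral_add (integrable_evalAt_update h x e p) (integrable_evalAt_update h x e q)]

theorem evalAt_update_partialMean {μ : Measure ℝ} (x : ι → ℝ) (e : ι) (t : ℝ)
    (P : MvPolynomial ι 𝕜) :
    evalAt (Function.update x e t) (partialMean μ {e} P) = evalAt x (partialMean μ {e} P) := by
  induction P using MvPolynomial.induction_on' with
  | monomial m a =>
    have h1 : (m.filter (· ∉ ({e} : Finset ι))) e = 0 := by simp
    have h2 : (m.filter (· ∉ ({e} : Finset ι))).filter (· ∉ ({e} : Finset ι))
        = m.filter (· ∉ ({e} : Finset ι)) :=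
      Finsupp.ext fun i => by by_cases h : i = e <;> simp [h]
    rw [partialMean_monomial, evalAt_monomial_update, h1, h2, pow_zero, mul_one]
  | add p q hp hq => simp only [map_add, hp, hq]

theorem hasDerivAt_evalAt_update (x : ι → ℝ) (e : ι) (t : ℝ) (P : MvPolynomial ι ℂ) :
    HasDerivAt (fun t => evalAt (Function.update x e t) P)
      (evalAt (Function.update x e t) (MvPolynomial.pderiv e P)) t := by
  induction P using MvPolynomial.induction_on with
  | C a => simpa using hasDerivAt_const t a
  | add p q hp hq => simp only [map_add]; exact hp.add hq
  | mul_X p i hp =>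
    have hX : HasDerivAt (fun t => evalAt (Function.update x e t) (MvPolynomial.X i : MvPolynomial ι ℂ))
        (evalAt (Function.update x e t) (MvPolynomial.pderiv e (MvPolynomial.X i))) t := by
      by_cases h : i = e
      · subst h
        simpa using (hasDerivAt_id t).ofReal_comp
      · simpa [h, Function.update_of_ne h, MvPolynomial.pderiv_X_of_ne h]
          using hasDerivAt_const t ((x i : ℝ) : ℂ)
    have := hp.mul hX
    simp only [MvPolynomial.pderiv_mul, map_add, map_mul]
    exact this

theorem continuous_evalAt_update (x : ι → ℝ) (e : ι) (P : MvPolynomial ι ℂ) :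
    Continuous (fun t => evalAt (Function.update x e t) P) :=
  continuous_iff_continuousAt.2 fun t => (hasDerivAt_evalAt_update x e t P).continuousAt

theorem deriv_evalAt_update (x : ι → ℝ) (e : ι) (P : MvPolynomial ι ℂ) :
    deriv (fun t => evalAt (Function.update x e t) P)
      = fun t => evalAt (Function.update x e t) (MvPolynomial.pderiv e P) :=
  funext fun t => (hasDerivAt_evalAt_update x e t P).deriv

/-- The polynomial with conjugate coefficients. -/
noncomputable def conjPoly : MvPolynomial ι ℂ →+* MvPolynomial ι ℂ :=
  MvPolynomial.map (starRingEnd ℂ)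

theorem evalAt_conjPoly (x : ι → ℝ) (P : MvPolynomial ι ℂ) :
    evalAt x (conjPoly P) = starRingEnd ℂ (evalAt x P) := by
  induction P using MvPolynomial.induction_on with
  | C a => simp [conjPoly]
  | add p q hp hq => simp [hp, hq]
  | mul_X p i hp => simp only [map_mul, hp]; simp [conjPoly]

theorem evalAt_mul_conjPoly (x : ι → ℝ) (P : MvPolynomial ι ℂ) :
    evalAt x (P * conjPoly P) = ((‖evalAt x P‖ ^ 2 : ℝ) : ℂ) := by
  rw [map_mul, evalAt_conjPoly, Complex.mul_conj, Complex.normSq_eq_norm_sq]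

theorem conjPoly_partialMean (μ : Measure ℝ) (s : Finset ι) (P : MvPolynomial ι ℂ) :
    conjPoly (partialMean μ s P) = partialMean μ s (conjPoly P) := by
  induction P using MvPolynomial.induction_on' with
  | monomial m a =>
    simp only [conjPoly, MvPolynomial.map_monomial]
    rw [partialMean_monomial, partialMean_monomial, MvPolynomial.map_monomial]
    simp
  | add p q hp hq => simp only [map_add, hp, hq]

theorem integrable_norm_sq_evalAt {μ : Measure ℝ} (h : IsSymmLaw μ) (P : MvPolynomial ι ℂ) :
    Integrable (fun x => ‖evalAt x P‖ ^ 2) (Measure.pi fun _ : ι => μ) := by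
  have := (integrable_evalAt h (P * conjPoly P)).re
  simpa only [evalAt_mul_conjPoly, RCLike.re_eq_complex_re, Complex.ofReal_re] using this

theorem integrable_norm_sq_evalAt_update {μ : Measure ℝ} (h : IsSymmLaw μ) (x : ι → ℝ) (e : ι)
    (P : MvPolynomial ι ℂ) :
    Integrable (fun t => ‖evalAt (Function.update x e t) P‖ ^ 2) μ := by
  have := (integrable_evalAt_update h x e (P * conjPoly P)).re
  simpa only [evalAt_mul_conjPoly, RCLike.re_eq_complex_re, Complex.ofReal_re] using this

/-- The squared `L²` norm of a polynomial. -/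
noncomputable def sqMean (μ : Measure ℝ) (P : MvPolynomial ι ℂ) : ℝ :=
  ∫ x, ‖evalAt x P‖ ^ 2 ∂(Measure.pi fun _ : ι => μ)

theorem sqMean_eq {μ : Measure ℝ} (h : IsSymmLaw μ) (P : MvPolynomial ι ℂ) :
    ((sqMean μ P : ℝ) : ℂ) = polyMean μ (P * conjPoly P) := by
  rw [sqMean, ← integral_evalAt h]
  simp_rw [evalAt_mul_conjPoly]
  exact integral_ofReal.symm

theorem sqMean_nonneg (μ : Measure ℝ) (P : MvPolynomial ι ℂ) : 0 ≤ sqMean μ P :=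
  integral_nonneg fun x => by positivity

/-- Pythagoras: P minus its partial mean is orthogonal to every polynomial free of the variable `e`.
-/
theorem sqMean_add_partialMean {μ : Measure ℝ} (h : IsSymmLaw μ) (e : ι)
    (P R : MvPolynomial ι ℂ) :
    sqMean μ (P - partialMean μ {e} P + partialMean μ {e} R)
      = sqMean μ (P - partialMean μ {e} P) + sqMean μ (partialMean μ {e} R) := by
  have := h.prob
  have horth : ∀ S T : MvPolynomial ι ℂ,
      polyMean μ ((S - partialMean μ {e} S) * partialMean μ {e} T) = 0 := by
    intro S T
    rw [← polyMean_partialMean e, partialMean_mul_partialMean, map_sub, partialMean_idem,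
      sub_self, zero_mul, map_zero]
  have h1 := horth P (conjPoly R)
  have h2 := horth (conjPoly P) R
  have h3 : ((sqMean μ (P - partialMean μ {e} P + partialMean μ {e} R) : ℝ) : ℂ)
      = ((sqMean μ (P - partialMean μ {e} P) + sqMean μ (partialMean μ {e} R) : ℝ) : ℂ) := by
    rw [Complex.ofReal_add, sqMean_eq h, sqMean_eq h, sqMean_eq h]
    simp only [map_add, map_sub, conjPoly_partialMean, mul_add, add_mul]
    rw [h1, mul_comm (partialMean μ {e} R), h2]
    simp
  exact_mod_cast h3

theorem sqMean_partialMean_le {μ : Measure ℝ} (h : IsSymmLaw μ) (e : ι) (R : MvPolynomial ι ℂ) :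
    sqMean μ (partialMean μ {e} R) ≤ sqMean μ R := by
  have := sqMean_add_partialMean h e R R
  rw [sub_add_cancel] at this
  rw [this]
  linarith [sqMean_nonneg μ (R - partialMean μ {e} R)]

/-- The one-dimensional Poincaré inequality for `μ` with constant `C`. -/
def PoincareWith (μ : Measure ℝ) (C : ℝ) : Prop :=
  ∀ f : ℝ → ℂ, ContDiff ℝ 1 f → MemLp f 2 μ → MemLp (deriv f) 2 μ →
    ∫ x, ‖f x - ∫ y, f y ∂μ‖ ^ 2 ∂μ ≤ C * ∫ x, ‖deriv f x‖ ^ 2 ∂μ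

theorem sqMean_sub_partialMean_le {μ : Measure ℝ} (h : IsSymmLaw μ) {C : ℝ}
    (hP : PoincareWith μ C) (e : ι) (P : MvPolynomial ι ℂ) :
    sqMean μ (P - partialMean μ {e} P) ≤ C * sqMean μ (MvPolynomial.pderiv e P) := by
  have := h.prob
  -- Fubini in the variable `e`, obtained algebraically: |Q|² is itself a polynomial, and averaging
  -- its partial mean gives its mean. The one-dimensional inequality then applies on each fibre.
  have fub : ∀ Q : MvPolynomial ι ℂ, sqMean μ Q
      = ∫ x, (∫ t, ‖evalAt (Function.update x e t) Q‖ ^ 2 ∂μ) ∂(Measure.pi fun _ : ι => μ) ∧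
      Integrable (fun x => ∫ t, ‖evalAt (Function.update x e t) Q‖ ^ 2 ∂μ)
        (Measure.pi fun _ : ι => μ) := by
    intro Q
    have h1 : ∀ x : ι → ℝ, evalAt x (partialMean μ {e} (Q * conjPoly Q))
        = ((∫ t, ‖evalAt (Function.update x e t) Q‖ ^ 2 ∂μ : ℝ) : ℂ) := by
      intro x
      rw [evalAt_partialMean h]
      simp_rw [evalAt_mul_conjPoly]
      exact integral_ofReal
    constructor
    · have h2 : ((sqMean μ Q : ℝ) : ℂ) = ((∫ x, (∫ t, ‖evalAt (Function.update x e t) Q‖ ^ 2 ∂μ)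
          ∂(Measure.pi fun _ : ι => μ) : ℝ) : ℂ) := by
        rw [sqMean_eq h, ← polyMean_partialMean e, ← integral_evalAt h]
        simp_rw [h1]
        exact integral_ofReal
      exact_mod_cast h2
    · have := (integrable_evalAt h (partialMean μ {e} (Q * conjPoly Q))).re
      simpa only [h1, RCLike.re_eq_complex_re, Complex.ofReal_re] using this
  rw [(fub _).1, (fub (MvPolynomial.pderiv e P)).1, ← integral_const_mul]
  refine integral_mono (fub _).2 ((fub _).2.const_mul _) fun x => ?_
  have hc := continuous_evalAt_update x e P
  have hc' := continuous_evalAt_update x e (MvPolynomial.pderiv e P)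
  have hd := deriv_evalAt_update x e P
  have := hP (fun t => evalAt (Function.update x e t) P)
    (by
      rw [contDiff_one_iff_deriv, hd]
      exact ⟨fun t => (hasDerivAt_evalAt_update x e t P).differentiableAt, hc'⟩)
    ((memLp_two_iff_integrable_sq_norm hc.aestronglyMeasurable).2
      (integrable_norm_sq_evalAt_update h x e P))
    (by
      rw [hd]
      exact (memLp_two_iff_integrable_sq_norm hc'.aestronglyMeasurable).2
        (integrable_norm_sq_evalAt_update h x e _))
  rw [hd] at this
  simp only [map_sub, evalAt_update_partialMean]
  rwa [evalAt_partialMean h]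

/-- **Tensorization of the Poincaré inequality**, for polynomials in i.i.d. variables. -/
theorem sqMean_sub_polyMean_le {μ : Measure ℝ} (h : IsSymmLaw μ) {C : ℝ}
    (hP : PoincareWith μ C) (P : MvPolynomial ι ℂ) :
    sqMean μ (P - MvPolynomial.C (polyMean μ P))
      ≤ C * ∑ e, sqMean μ (MvPolynomial.pderiv e P) := by
  have key : ∀ s : Finset ι, sqMean μ (P - partialMean μ s P)
      ≤ C * ∑ e ∈ s, sqMean μ (MvPolynomial.pderiv e P) := by
    intro s
    induction s using Finset.induction_on with
    | empty => simp [partialMean_empty, sqMean]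
    | insert e s he ih =>
      rw [partialMean_insert μ he, Finset.sum_insert he, mul_add]
      -- The two summands are orthogonal. The first costs one partial derivative; the second is a
      -- contraction of the induction hypothesis.
      have h1 : P - partialMean μ {e} (partialMean μ s P)
          = P - partialMean μ {e} P + partialMean μ {e} (P - partialMean μ s P) := by
        rw [map_sub]; ring
      rw [h1, sqMean_add_partialMean h]
      exact add_le_add (sqMean_sub_partialMean_le h hP e P)
        ((sqMean_partialMean_le h e _).trans ih)
  have := key Finset.univ
  rwa [partialMean_univ] at this

end PolynomialMean

/-! ### The three-point law that dominates the entry moments. -/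

section ThreePointLaw

/-- The symmetric law on `{-√β, 0, √β}` with variance `v`. -/
noncomputable def threePointLaw (v β : ℝ) : Measure ℝ :=
  ENNReal.ofReal (1 - v / β) • Measure.dirac 0 +
    ENNReal.ofReal (v / (2 * β)) • (Measure.dirac (Real.sqrt β) + Measure.dirac (-Real.sqrt β))

variable {v β : ℝ}

theorem threePointLaw_prob (hv : 0 < v) (hβ : v ≤ β) : IsProbabilityMeasure (threePointLaw v β) := by
  have hβ0 : 0 < β := hv.trans_le hβ
  have h1 : 0 ≤ 1 - v / β := by rw [sub_nonneg, div_le_one hβ0]; exact hβ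
  refine ⟨?_⟩
  simp only [threePointLaw, Measure.coe_add, Measure.coe_smul, Pi.add_apply, Pi.smul_apply,
    measure_univ, smul_eq_mul, mul_one]
  rw [one_add_one_eq_two, ← ENNReal.ofReal_ofNat 2, ← ENNReal.ofReal_mul (by positivity),
    ← ENNReal.ofReal_add h1 (by positivity)]
  rw [ENNReal.ofReal_eq_one]
  field_simp
  ring

theorem threePointLaw_integrable (f : ℝ → ℝ) : Integrable f (threePointLaw v β) := by
  refine Integrable.add_measure (Integrable.smul_measure ?_ ENNReal.ofReal_ne_top)
    (Integrable.smul_measure (Integrable.add_measure ?_ ?_) ENNReal.ofReal_ne_top) <;>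
  exact integrable_dirac (by simp)

theorem threePointLaw_integral (hv : 0 < v) (hβ : v ≤ β) (f : ℝ → ℝ) :
    ∫ x, f x ∂(threePointLaw v β)
      = (1 - v / β) * f 0 + v / (2 * β) * (f (Real.sqrt β) + f (-Real.sqrt β)) := by
  have hβ0 : 0 < β := hv.trans_le hβ
  have h1 : 0 ≤ 1 - v / β := by rw [sub_nonneg, div_le_one hβ0]; exact hβ
  have hd : ∀ a : ℝ, Integrable f (Measure.dirac a) := fun a => integrable_dirac (by simp)
  rw [threePointLaw, integral_add_measure, integral_smul_measure, integral_smul_measure,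
    integral_add_measure (hd _) (hd _), integral_dirac, integral_dirac, integral_dirac,
    ENNReal.toReal_ofReal h1, ENNReal.toReal_ofReal (by positivity), smul_eq_mul, smul_eq_mul]
  · exact (hd _).smul_measure ENNReal.ofReal_ne_top
  · exact ((hd _).add_measure (hd _)).smul_measure ENNReal.ofReal_ne_top

theorem threePointLaw_symm : (threePointLaw v β).map (fun x => -x) = threePointLaw v β := by
  have hm : Measurable (fun x : ℝ => -x) := measurable_neg
  rw [threePointLaw, Measure.map_add _ _ hm, Measure.map_smul, Measure.map_smul,
    Measure.map_add _ _ hm, Measure.map_dirac' hm, Measure.map_dirac' hm, Measure.map_dirac' hm,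
    neg_zero, neg_neg, add_comm (Measure.dirac (-Real.sqrt β))]

theorem threePointLaw_isSymmLaw (hv : 0 < v) (hβ : v ≤ β) : IsSymmLaw (threePointLaw v β) :=
  ⟨threePointLaw_prob hv hβ, threePointLaw_symm, fun _ => threePointLaw_integrable _⟩

/-- With v = σ² and β = C p² + σ² these are exactly the bounds of `IsEntryLaw.moment_growth`.
Realizing the bounds as moments of a law keeps integrals and independence available for the
dominating quantities. -/
theorem threePointLaw_moment_even (hv : 0 < v) (hβ : v ≤ β) (n : ℕ) :
    rawMoment (threePointLaw v β) (2 * (n + 1)) = v * β ^ n := by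
  have hβ0 : 0 < β := hv.trans_le hβ
  rw [rawMoment, threePointLaw_integral hv hβ, (even_two_mul (n + 1)).neg_pow,
    pow_mul (Real.sqrt β), Real.sq_sqrt hβ0.le]
  simp
  field_simp
  ring

theorem threePointLaw_moment_zero (hv : 0 < v) (hβ : v ≤ β) :
    rawMoment (threePointLaw v β) 0 = 1 := by
  have := threePointLaw_prob hv hβ
  exact rawMoment_zero

theorem threePointLaw_moment_nonneg (n : ℕ) :
    0 ≤ rawMoment (threePointLaw v β) n := by
  rcases Nat.even_or_odd' n with ⟨k, rfl | rfl⟩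
  · exact rawMoment_even_nonneg _ _
  · rw [rawMoment_odd threePointLaw_symm ⟨k, rfl⟩]

theorem threePointLaw_moment_add_two (hv : 0 < v) (hβ : v ≤ β) (n : ℕ) :
    rawMoment (threePointLaw v β) (n + 2) ≤ β * rawMoment (threePointLaw v β) n := by
  rcases Nat.even_or_odd' n with ⟨k, rfl | rfl⟩
  · rcases k with _ | k
    · have := threePointLaw_moment_even hv hβ 0
      simp only [zero_add, mul_one, pow_zero] at this
      rw [mul_zero, zero_add, this, threePointLaw_moment_zero hv hβ]
      simpa using hβ
    · have h1 : 2 * (k + 1) + 2 = 2 * (k + 1 + 1) := by ring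
      rw [h1, threePointLaw_moment_even hv hβ, threePointLaw_moment_even hv hβ]
      exact le_of_eq (by ring)
  · rw [rawMoment_odd threePointLaw_symm ⟨k, rfl⟩, rawMoment_odd threePointLaw_symm ⟨k + 1, by ring⟩]
    simp

theorem desc_three_ge {n : ℕ} (hn : 3 ≤ n) : n + 1 ≤ n * (n - 1) * (n - 2) := by
  obtain ⟨k, rfl⟩ := Nat.exists_eq_add_of_le hn
  have h1 : 3 + k - 1 = k + 2 := by omega
  have h2 : 3 + k - 2 = k + 1 := by omega
  rw [h1, h2]
  nlinarith [Nat.zero_le (k * k), Nat.zero_le k]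

/-- The law `μ` has variance `v` and its moments up to order `d` are at most those of the
three-point law. -/
structure MomentsLE (μ : Measure ℝ) (v β : ℝ) (d : ℕ) : Prop where
  law : IsSymmLaw μ
  two : rawMoment μ 2 = v
  le : ∀ n ≤ d, rawMoment μ n ≤ rawMoment (threePointLaw v β) n

theorem MomentsLE.nonneg {μ : Measure ℝ} {d : ℕ} (h : MomentsLE μ v β d) (n : ℕ) :
    0 ≤ rawMoment μ n := by
  rcases Nat.even_or_odd' n with ⟨k, rfl | rfl⟩
  · exact rawMoment_even_nonneg _ _
  · rw [rawMoment_odd h.law.symm ⟨k, rfl⟩]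

/-- Integration by parts for f = xⁿ: E[x f] against v E f' plus a remainder in f'''. For n < 3 the
truncated subtractions make the remainder vanish and the relation is exact; for n ≥ 3 the remainder
alone suffices, since two steps of M_(j+2) ≤ β M_j bring M_(n+1) down to M_(n-3). -/
theorem threePointLaw_moment_ibp (hv : 0 < v) (hβ : v ≤ β) (n : ℕ) :
    rawMoment (threePointLaw v β) (n + 1) ≤ v * (n * rawMoment (threePointLaw v β) (n - 1))
      + β ^ 2 * ((n * (n - 1 : ℕ) * (n - 2 : ℕ)) * rawMoment (threePointLaw v β) (n - 3)) := by
  have h0 := threePointLaw_moment_zero hv hβ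
  have h2 := threePointLaw_moment_even hv hβ 0
  simp only [zero_add, mul_one, pow_zero] at h2
  have hnn := threePointLaw_moment_nonneg (v := v) (β := β)
  rcases Nat.lt_or_ge n 3 with hn | hn
  · interval_cases n
    · simp [rawMoment_odd threePointLaw_symm odd_one]
    · simp [h2, h0]
    · simp [rawMoment_odd threePointLaw_symm (by decide : Odd (2 + 1)),
        rawMoment_odd threePointLaw_symm odd_one]
  · obtain ⟨k, rfl⟩ := Nat.exists_eq_add_of_le hn
    have h3 : ((3 + k : ℕ) + 1 : ℝ) ≤ ((3 + k : ℕ) : ℝ) * ((3 + k - 1 : ℕ) : ℝ) * ((3 + k - 2 : ℕ) : ℝ) := by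
      exact_mod_cast desc_three_ge hn
    have h4 : (1 : ℝ) ≤ ((3 + k : ℕ) : ℝ) * ((3 + k - 1 : ℕ) : ℝ) * ((3 + k - 2 : ℕ) : ℝ) := by
      have : (0 : ℝ) ≤ ((3 + k : ℕ) : ℝ) := by positivity
      linarith
    have h5 : rawMoment (threePointLaw v β) (3 + k + 1)
        ≤ β ^ 2 * (1 * rawMoment (threePointLaw v β) (3 + k - 3)) := by
      have h6 : 3 + k + 1 = (k + 2) + 2 := by ring
      have h7 : 3 + k - 3 = k := by omega
      rw [h6, h7, one_mul, sq, mul_assoc]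
      exact (threePointLaw_moment_add_two hv hβ _).trans
        (mul_le_mul_of_nonneg_left (threePointLaw_moment_add_two hv hβ _) (hv.le.trans hβ))
    refine h5.trans ((mul_le_mul_of_nonneg_left (mul_le_mul_of_nonneg_right h4 (hnn _))
      (sq_nonneg _)).trans ?_)
    have : 0 ≤ v * (((3 + k : ℕ) : ℝ) * rawMoment (threePointLaw v β) (3 + k - 1)) :=
      mul_nonneg hv.le (mul_nonneg (by positivity) (hnn _))
    linarith

/-- For n < 3 both terms cancel, as the law is symmetric with second moment v. For n ≥ 3 no
cancellation is used: both are nonnegative and each is at most β² n(n-1)(n-2) times the three-point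
moment. -/
theorem MomentsLE.ibp {μ : Measure ℝ} {d : ℕ} (h : MomentsLE μ v β d) (hv : 0 < v) (hβ : v ≤ β)
    {n : ℕ} (hn : n + 1 ≤ d) :
    |rawMoment μ (n + 1) - v * (n * rawMoment μ (n - 1))|
      ≤ 2 * β ^ 2 * ((n * (n - 1 : ℕ) * (n - 2 : ℕ)) * rawMoment (threePointLaw v β) (n - 3)) := by
  have := h.law.prob
  have hnn := threePointLaw_moment_nonneg (v := v) (β := β)
  rcases Nat.lt_or_ge n 3 with hn3 | hn3
  · interval_cases n
    · simp [rawMoment_odd h.law.symm odd_one]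
    · simp [h.two, rawMoment_zero]
    · simp [rawMoment_odd h.law.symm (by decide : Odd (2 + 1)), rawMoment_odd h.law.symm odd_one]
  · obtain ⟨k, rfl⟩ := Nat.exists_eq_add_of_le hn3
    have h3 : ((3 + k : ℕ) + 1 : ℝ) ≤ ((3 + k : ℕ) : ℝ) * ((3 + k - 1 : ℕ) : ℝ) * ((3 + k - 2 : ℕ) : ℝ) := by
      exact_mod_cast desc_three_ge hn3
    set D : ℝ := ((3 + k : ℕ) : ℝ) * ((3 + k - 1 : ℕ) : ℝ) * ((3 + k - 2 : ℕ) : ℝ) with hD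
    set T := rawMoment (threePointLaw v β) (3 + k - 3) with hT
    have hT0 : 0 ≤ T := hnn _
    have hβ0 : 0 ≤ β := hv.le.trans hβ
    have h7 : 3 + k - 3 = k := by omega
    have h8 : 3 + k - 1 = k + 2 := by omega
    have hb : rawMoment μ (3 + k - 1) ≤ β * T := by
      rw [hT, h7, h8]
      exact (h.le _ (by omega)).trans (threePointLaw_moment_add_two hv hβ _)
    have ha : rawMoment μ (3 + k + 1) ≤ β ^ 2 * T := by
      have h6 : 3 + k + 1 = (k + 2) + 2 := by ring
      rw [hT, h7, h6, sq, mul_assoc]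
      exact (h.le _ (by omega)).trans ((threePointLaw_moment_add_two hv hβ _).trans
        (mul_le_mul_of_nonneg_left (threePointLaw_moment_add_two hv hβ _) hβ0))
    have hc : v * (((3 + k : ℕ) : ℝ) * rawMoment μ (3 + k - 1)) ≤ β ^ 2 * (D * T) := by
      calc v * (((3 + k : ℕ) : ℝ) * rawMoment μ (3 + k - 1)) ≤ β * (D * (β * T)) := by
            have : ((3 + k : ℕ) : ℝ) ≤ D := by linarith
            have := h.nonneg (3 + k - 1)
            gcongr
        _ = _ := by ring
    have hd : β ^ 2 * T ≤ β ^ 2 * (D * T) := by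
      have : 1 ≤ D := by
        have : (0 : ℝ) ≤ ((3 + k : ℕ) : ℝ) := by positivity
        linarith
      have : 1 * T ≤ D * T := mul_le_mul_of_nonneg_right this hT0
      rw [one_mul] at this
      exact mul_le_mul_of_nonneg_left this (sq_nonneg _)
    have hp1 := h.nonneg (3 + k + 1)
    have hp2 : 0 ≤ v * (((3 + k : ℕ) : ℝ) * rawMoment μ (3 + k - 1)) :=
      mul_nonneg hv.le (mul_nonneg (by positivity) (h.nonneg _))
    rw [abs_le]
    constructor <;> linarith

end ThreePointLaw

/-! ### Coefficientwise domination of polynomials. -/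

section CoefficientOrder

set_option linter.unusedSectionVars false

variable {ι : Type*} [Fintype ι] [DecidableEq ι]

/-- The coefficients of `P` are bounded in norm by those of `Q`. -/
def CoeffLE {𝕜 : Type*} [RCLike 𝕜] (P : MvPolynomial ι 𝕜) (Q : MvPolynomial ι ℝ) : Prop :=
  ∀ m, ‖P.coeff m‖ ≤ Q.coeff m

/-- The coefficients of `Q` are nonnegative. -/
def CoeffNonneg (Q : MvPolynomial ι ℝ) : Prop := ∀ m, 0 ≤ Q.coeff m

section

variable {𝕜 : Type*} [RCLike 𝕜] {P P' : MvPolynomial ι 𝕜} {Q Q' : MvPolynomial ι ℝ}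

theorem CoeffLE.nonneg (h : CoeffLE P Q) : CoeffNonneg Q := fun m => (norm_nonneg _).trans (h m)

theorem CoeffLE.zero : CoeffLE (0 : MvPolynomial ι 𝕜) 0 := fun m => by simp

theorem CoeffLE.sum {κ : Type*} (s : Finset κ) {p : κ → MvPolynomial ι 𝕜}
    {q : κ → MvPolynomial ι ℝ} (h : ∀ k ∈ s, CoeffLE (p k) (q k)) :
    CoeffLE (∑ k ∈ s, p k) (∑ k ∈ s, q k) := fun m => by
  simp only [MvPolynomial.coeff_sum]
  exact (norm_sum_le _ _).trans (Finset.sum_le_sum fun k hk => h k hk m)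

theorem CoeffLE.mul (h : CoeffLE P Q) (h' : CoeffLE P' Q') : CoeffLE (P * P') (Q * Q') :=
  fun m => by
    simp only [MvPolynomial.coeff_mul]
    refine (norm_sum_le _ _).trans (Finset.sum_le_sum fun k _ => ?_)
    rw [norm_mul]
    exact mul_le_mul (h _) (h' _) (norm_nonneg _) (h.nonneg _)

theorem CoeffLE.C {a : 𝕜} {b : ℝ} (h : ‖a‖ ≤ b) :
    CoeffLE (MvPolynomial.C a : MvPolynomial ι 𝕜) (MvPolynomial.C b) := fun m => by
  simp only [MvPolynomial.coeff_C]
  split_ifs <;> simp [h]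

theorem CoeffLE.one : CoeffLE (1 : MvPolynomial ι 𝕜) 1 := by
  rw [← MvPolynomial.C_1, ← MvPolynomial.C_1]
  exact CoeffLE.C (by simp)

theorem CoeffLE.X (e : ι) : CoeffLE (MvPolynomial.X e : MvPolynomial ι 𝕜) (MvPolynomial.X e) :=
  fun m => by
    simp only [MvPolynomial.coeff_X]
    split_ifs <;> simp

/-- Comparison of linear functionals from their values on monomials. -/
theorem CoeffLE.norm_apply_le (h : CoeffLE P Q) (L : MvPolynomial ι 𝕜 →ₗ[𝕜] 𝕜)
    (L' : MvPolynomial ι ℝ →ₗ[ℝ] ℝ) (hnn : ∀ m, 0 ≤ L' (MvPolynomial.monomial m 1))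
    (hL : ∀ m, m.degree ≤ P.totalDegree →
      ‖L (MvPolynomial.monomial m 1)‖ ≤ L' (MvPolynomial.monomial m 1)) :
    ‖L P‖ ≤ L' Q := by
  have hQ : L' Q = ∑ m ∈ Q.support, Q.coeff m * L' (MvPolynomial.monomial m 1) := by
    conv_lhs => rw [Q.as_sum]
    rw [map_sum]
    refine Finset.sum_congr rfl fun m _ => ?_
    have : MvPolynomial.monomial m (Q.coeff m) = Q.coeff m • MvPolynomial.monomial m (1 : ℝ) := by
      simp [MvPolynomial.smul_monomial]
    rw [this, map_smul, smul_eq_mul]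
  have hP : L P = ∑ m ∈ P.support, P.coeff m * L (MvPolynomial.monomial m 1) := by
    conv_lhs => rw [P.as_sum]
    rw [map_sum]
    refine Finset.sum_congr rfl fun m _ => ?_
    have : MvPolynomial.monomial m (P.coeff m) = P.coeff m • MvPolynomial.monomial m (1 : 𝕜) := by
      simp [MvPolynomial.smul_monomial]
    rw [this, map_smul, smul_eq_mul]
  have hsub : P.support ⊆ Q.support := by
    intro m hm
    rw [MvPolynomial.mem_support_iff] at hm ⊢
    have := h m
    have h1 : 0 < ‖P.coeff m‖ := norm_pos_iff.2 hm
    exact (h1.trans_le this).ne'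
  rw [hP, hQ]
  refine (norm_sum_le _ _).trans ?_
  refine (Finset.sum_le_sum (g := fun m => Q.coeff m * L' (MvPolynomial.monomial m 1))
    fun m hm => ?_).trans
    (Finset.sum_le_sum_of_subset_of_nonneg hsub fun m _ _ => mul_nonneg (h.nonneg m) (hnn m))
  rw [norm_mul]
  exact mul_le_mul (h m) (hL m (MvPolynomial.le_totalDegree hm)) (norm_nonneg _) (h.nonneg m)

end

theorem CoeffNonneg.apply_le {Q : MvPolynomial ι ℝ} (h : CoeffNonneg Q)
    (L L' : MvPolynomial ι ℝ →ₗ[ℝ] ℝ)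
    (hL : ∀ m, L (MvPolynomial.monomial m 1) ≤ L' (MvPolynomial.monomial m 1)) : L Q ≤ L' Q := by
  have hQ : ∀ L : MvPolynomial ι ℝ →ₗ[ℝ] ℝ,
      L Q = ∑ m ∈ Q.support, Q.coeff m * L (MvPolynomial.monomial m 1) := by
    intro L
    conv_lhs => rw [Q.as_sum]
    rw [map_sum]
    refine Finset.sum_congr rfl fun m _ => ?_
    have : MvPolynomial.monomial m (Q.coeff m) = Q.coeff m • MvPolynomial.monomial m (1 : ℝ) := by
      simp [MvPolynomial.smul_monomial]
    rw [this, map_smul, smul_eq_mul]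
  rw [hQ, hQ]
  exact Finset.sum_le_sum fun m _ => mul_le_mul_of_nonneg_left (hL m) (h m)

theorem polyMean_monomial_split {𝕜 : Type*} [RCLike 𝕜] (μ : Measure ℝ) (e : ι) (m : ι →₀ ℕ)
    (a : 𝕜) : polyMean μ (MvPolynomial.monomial m a)
      = a * ((rawMoment μ (m e) * ∏ i ∈ Finset.univ.erase e, rawMoment μ (m i) : ℝ) : 𝕜) := by
  rw [polyMean_monomial, Finset.mul_prod_erase _ (fun i => rawMoment μ (m i)) (Finset.mem_univ e)]
  simp

theorem prod_erase_congr (μ : Measure ℝ) (e : ι) {m m' : ι →₀ ℕ} (h : ∀ i, i ≠ e → m i = m' i) :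
    ∏ i ∈ Finset.univ.erase e, rawMoment μ (m i)
      = ∏ i ∈ Finset.univ.erase e, rawMoment μ (m' i) :=
  Finset.prod_congr rfl fun i hi => by rw [h i (Finset.ne_of_mem_erase hi)]

theorem pderiv_three_monomial {R : Type*} [CommSemiring R] (e : ι) (m : ι →₀ ℕ) (a : R) :
    MvPolynomial.pderiv e (MvPolynomial.pderiv e (MvPolynomial.pderiv e (MvPolynomial.monomial m a)))
      = MvPolynomial.monomial (m - Finsupp.single e 3)
        (a * (m e * (m e - 1 : ℕ) * (m e - 2 : ℕ) : R)) := by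
  simp only [MvPolynomial.pderiv_monomial]
  have h : m - Finsupp.single e 1 - Finsupp.single e 1 - Finsupp.single e 1
      = m - Finsupp.single e 3 := by
    rw [tsub_tsub, tsub_tsub, ← Finsupp.single_add, ← Finsupp.single_add]
    norm_num
  rw [h]
  simp [mul_assoc, Nat.sub_sub]

section

variable {v β : ℝ} (hv : 0 < v) (hβ : v ≤ β)
include hv hβ

theorem polyMean_threePoint_monomial_nonneg (m : ι →₀ ℕ) :
    0 ≤ polyMean (threePointLaw v β) (MvPolynomial.monomial m (1 : ℝ)) := by
  rw [polyMean_monomial]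
  have : 0 ≤ ∏ e, rawMoment (threePointLaw v β) (m e) :=
    Finset.prod_nonneg fun e _ => threePointLaw_moment_nonneg _
  simpa using this

theorem CoeffNonneg.polyMean_nonneg {Q : MvPolynomial ι ℝ} (h : CoeffNonneg Q) :
    0 ≤ polyMean (threePointLaw v β) Q := by
  have := h.apply_le 0 (polyMean (threePointLaw v β))
    fun m => polyMean_threePoint_monomial_nonneg hv hβ m
  simpa using this

/-- The mean of a monomial is a product of moments, dominated factor by factor; the degree bound
keeps every exponent within the range where the moments compare. -/
theorem CoeffLE.norm_polyMean_le {𝕜 : Type*} [RCLike 𝕜] {μ : Measure ℝ} {d : ℕ}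
    (hμ : MomentsLE μ v β d) {P : MvPolynomial ι 𝕜} {Q : MvPolynomial ι ℝ} (h : CoeffLE P Q)
    (hd : P.totalDegree ≤ d) : ‖polyMean μ P‖ ≤ polyMean (threePointLaw v β) Q := by
  refine h.norm_apply_le _ _ (polyMean_threePoint_monomial_nonneg hv hβ) fun m hm => ?_
  rw [polyMean_monomial, polyMean_monomial, one_mul, one_mul, norm_prod]
  refine Finset.prod_le_prod (fun e _ => norm_nonneg _) fun e _ => ?_
  rw [RCLike.norm_ofReal, abs_of_nonneg (hμ.nonneg _)]
  exact hμ.le _ ((Finsupp.le_degree e m).trans (hm.trans hd))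

/-- Both sides are linear in Q, so monomials suffice. There the variables other than `e` contribute
a common nonnegative factor, and `threePointLaw_moment_ibp` remains. -/
theorem CoeffNonneg.polyMean_X_mul_le {Q : MvPolynomial ι ℝ} (h : CoeffNonneg Q) (e : ι) :
    polyMean (threePointLaw v β) (MvPolynomial.X e * Q)
      ≤ v * polyMean (threePointLaw v β) (MvPolynomial.pderiv e Q)
        + β ^ 2 * polyMean (threePointLaw v β)
          (MvPolynomial.pderiv e (MvPolynomial.pderiv e (MvPolynomial.pderiv e Q))) := by
  set ν := threePointLaw v β with hν
  let D : MvPolynomial ι ℝ →ₗ[ℝ] MvPolynomial ι ℝ := (MvPolynomial.pderiv e).toLinearMap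
  have key := h.apply_le ((polyMean ν).comp (LinearMap.mulLeft ℝ (MvPolynomial.X e)))
    (v • (polyMean ν).comp D + β ^ 2 • (polyMean ν).comp (D.comp (D.comp D)))
  simp only [D, LinearMap.add_apply, LinearMap.smul_apply, LinearMap.comp_apply,
    LinearMap.mulLeft_apply, Derivation.coeFn_coe,
    smul_eq_mul] at key
  refine key fun m => ?_
  rw [pderiv_three_monomial, MvPolynomial.pderiv_monomial, MvPolynomial.X,
    MvPolynomial.monomial_mul, polyMean_monomial_split ν e, polyMean_monomial_split ν e,
    polyMean_monomial_split ν e,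
    prod_erase_congr ν e (m := Finsupp.single e 1 + m) (m' := m)
      (fun i hi => by simp [Ne.symm hi]),
    prod_erase_congr ν e (m := m - Finsupp.single e 1) (m' := m)
      (fun i hi => by simp [Ne.symm hi]),
    prod_erase_congr ν e (m := m - Finsupp.single e 3) (m' := m)
      (fun i hi => by simp [Ne.symm hi])]
  simp only [Finsupp.coe_add, Finsupp.coe_tsub, Pi.add_apply, Pi.sub_apply, Finsupp.single_eq_same,
    one_mul, RCLike.ofReal_real_eq_id, id]
  have hR : 0 ≤ ∏ i ∈ Finset.univ.erase e, rawMoment ν (m i) :=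
    Finset.prod_nonneg fun i _ => threePointLaw_moment_nonneg _
  have := mul_le_mul_of_nonneg_right (threePointLaw_moment_ibp hv hβ (m e)) hR
  rw [add_comm 1 (m e)]
  refine this.trans (le_of_eq ?_)
  ring

/-- The integration by parts error for μ is charged to the dominating polynomial under the
three-point law, where nonnegative coefficients allow upper bounds without cancellation. -/
theorem CoeffLE.norm_polyMean_X_mul_sub_le {𝕜 : Type*} [RCLike 𝕜] {μ : Measure ℝ} {d : ℕ}
    (hμ : MomentsLE μ v β d) {P : MvPolynomial ι 𝕜} {Q : MvPolynomial ι ℝ} (h : CoeffLE P Q)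
    (hd : P.totalDegree + 1 ≤ d) (e : ι) :
    ‖polyMean μ (MvPolynomial.X e * P) - (v : 𝕜) * polyMean μ (MvPolynomial.pderiv e P)‖
      ≤ 2 * β ^ 2 * polyMean (threePointLaw v β)
          (MvPolynomial.pderiv e (MvPolynomial.pderiv e (MvPolynomial.pderiv e Q))) := by
  set ν := threePointLaw v β with hν
  let D : MvPolynomial ι ℝ →ₗ[ℝ] MvPolynomial ι ℝ := (MvPolynomial.pderiv e).toLinearMap
  let D' : MvPolynomial ι 𝕜 →ₗ[𝕜] MvPolynomial ι 𝕜 := (MvPolynomial.pderiv e).toLinearMap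
  have key := h.norm_apply_le ((polyMean μ).comp (LinearMap.mulLeft 𝕜 (MvPolynomial.X e))
    - (v : 𝕜) • (polyMean μ).comp D') ((2 * β ^ 2) • (polyMean ν).comp (D.comp (D.comp D)))
  simp only [D, D', LinearMap.sub_apply, LinearMap.smul_apply, LinearMap.comp_apply,
    LinearMap.mulLeft_apply, Derivation.coeFn_coe,
    smul_eq_mul] at key
  refine key (fun m => ?_) fun m hm => ?_
  · refine mul_nonneg (by positivity) (CoeffNonneg.polyMean_nonneg hv hβ ?_)
    rw [pderiv_three_monomial]
    intro n
    rw [MvPolynomial.coeff_monomial]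
    split_ifs
    · positivity
    · exact le_rfl
  · rw [pderiv_three_monomial, MvPolynomial.pderiv_monomial, MvPolynomial.X,
      MvPolynomial.monomial_mul, polyMean_monomial_split μ e, polyMean_monomial_split μ e,
      polyMean_monomial_split ν e,
      prod_erase_congr μ e (m := Finsupp.single e 1 + m) (m' := m)
        (fun i hi => by simp [Ne.symm hi]),
      prod_erase_congr μ e (m := m - Finsupp.single e 1) (m' := m)
        (fun i hi => by simp [Ne.symm hi]),
      prod_erase_congr ν e (m := m - Finsupp.single e 3) (m' := m)
        (fun i hi => by simp [Ne.symm hi])]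
    simp only [Finsupp.coe_add, Finsupp.coe_tsub, Pi.add_apply, Pi.sub_apply,
      Finsupp.single_eq_same, one_mul, RCLike.ofReal_real_eq_id, id]
    have hdeg : ∀ i, m i + 1 ≤ d := fun i => by
      have := (Finsupp.le_degree i m).trans hm
      omega
    have hR0 : 0 ≤ ∏ i ∈ Finset.univ.erase e, rawMoment μ (m i) :=
      Finset.prod_nonneg fun i _ => hμ.nonneg _
    have hR : ∏ i ∈ Finset.univ.erase e, rawMoment μ (m i)
        ≤ ∏ i ∈ Finset.univ.erase e, rawMoment ν (m i) :=
      Finset.prod_le_prod (fun i _ => hμ.nonneg _)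
        fun i _ => hμ.le _ ((Nat.le_succ _).trans (hdeg i))
    set R := ∏ i ∈ Finset.univ.erase e, rawMoment μ (m i) with hRdef
    have h1 := hμ.ibp hv hβ (hdeg e)
    have h2 : ((rawMoment μ (1 + m e) * R : ℝ) : 𝕜)
        - (v : 𝕜) * (((m e : ℕ) : 𝕜) * ((rawMoment μ (m e - 1) * R : ℝ) : 𝕜))
        = (((rawMoment μ (m e + 1) - v * (m e * rawMoment μ (m e - 1))) * R : ℝ) : 𝕜) := by
      rw [add_comm 1 (m e)]
      push_cast
      ring
    rw [h2, RCLike.norm_ofReal, abs_mul, abs_of_nonneg hR0]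
    refine (mul_le_mul h1 hR hR0 ?_).trans (le_of_eq (by ring))
    exact (abs_nonneg _).trans h1

/-- A covariance bound. Monomials without a common variable are independent and their means
multiply; if they share `e`, lowering both exponents by one costs at most β, and the derivative
prefactors are at least 1. Bilinearity and nonnegative coefficients do the rest. -/
theorem CoeffNonneg.polyMean_mul_le {F H : MvPolynomial ι ℝ} (hF : CoeffNonneg F)
    (hH : CoeffNonneg H) :
    polyMean (threePointLaw v β) (F * H)
      ≤ polyMean (threePointLaw v β) F * polyMean (threePointLaw v β) H
        + β * ∑ e, polyMean (threePointLaw v β)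
          (MvPolynomial.pderiv e F * MvPolynomial.pderiv e H) := by
  set ν := threePointLaw v β with hν
  have hnn := threePointLaw_moment_nonneg (v := v) (β := β)
  have hβ0 : 0 ≤ β := hv.le.trans hβ
  let D : ι → MvPolynomial ι ℝ →ₗ[ℝ] MvPolynomial ι ℝ :=
    fun e => (MvPolynomial.pderiv e).toLinearMap
  have hmon : ∀ m n : ι →₀ ℕ,
      polyMean ν (MvPolynomial.monomial m (1 : ℝ) * MvPolynomial.monomial n 1)
      ≤ polyMean ν (MvPolynomial.monomial m (1 : ℝ)) * polyMean ν (MvPolynomial.monomial n (1 : ℝ))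
        + β * ∑ e, polyMean ν (MvPolynomial.pderiv e (MvPolynomial.monomial m (1 : ℝ))
          * MvPolynomial.pderiv e (MvPolynomial.monomial n 1)) := by
    intro m n
    have hterm : ∀ e, 0 ≤ polyMean ν (MvPolynomial.pderiv e (MvPolynomial.monomial m (1 : ℝ))
          * MvPolynomial.pderiv e (MvPolynomial.monomial n 1)) := by
      intro e
      refine CoeffNonneg.polyMean_nonneg hv hβ ?_
      rw [MvPolynomial.pderiv_monomial, MvPolynomial.pderiv_monomial, MvPolynomial.monomial_mul]
      intro k
      rw [MvPolynomial.coeff_monomial]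
      split_ifs
      · positivity
      · exact le_rfl
    by_cases hex : ∃ e, m e ≠ 0 ∧ n e ≠ 0
    · obtain ⟨e, hme, hne⟩ := hex
      have h1 : polyMean ν (MvPolynomial.monomial m (1 : ℝ) * MvPolynomial.monomial n 1)
          ≤ β * polyMean ν (MvPolynomial.pderiv e (MvPolynomial.monomial m (1 : ℝ))
          * MvPolynomial.pderiv e (MvPolynomial.monomial n 1)) := by
        rw [MvPolynomial.pderiv_monomial, MvPolynomial.pderiv_monomial, MvPolynomial.monomial_mul,
          MvPolynomial.monomial_mul, polyMean_monomial_split ν e, polyMean_monomial_split ν e,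
          prod_erase_congr ν e (m := m - Finsupp.single e 1 + (n - Finsupp.single e 1))
            (m' := m + n) (fun i hi => by simp [Ne.symm hi])]
        simp only [Finsupp.coe_add, Finsupp.coe_tsub, Pi.add_apply, Pi.sub_apply,
          Finsupp.single_eq_same, one_mul, RCLike.ofReal_real_eq_id, id]
        have hR : 0 ≤ ∏ i ∈ Finset.univ.erase e, rawMoment ν (m i + n i) :=
          Finset.prod_nonneg fun i _ => hnn _
        set R := ∏ i ∈ Finset.univ.erase e, rawMoment ν (m i + n i)
        have h2 : m e + n e = (m e - 1 + (n e - 1)) + 2 := by omega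
        have h3 := threePointLaw_moment_add_two hv hβ (m e - 1 + (n e - 1))
        rw [← h2] at h3
        have h4 : (1 : ℝ) ≤ (m e : ℝ) * (n e : ℝ) := by
          have : 1 ≤ m e * n e := Nat.mul_pos (Nat.pos_of_ne_zero hme) (Nat.pos_of_ne_zero hne)
          exact_mod_cast this
        calc rawMoment ν (m e + n e) * R
            ≤ (β * rawMoment ν (m e - 1 + (n e - 1))) * R := mul_le_mul_of_nonneg_right h3 hR
          _ = β * (1 * (rawMoment ν (m e - 1 + (n e - 1)) * R)) := by ring
          _ ≤ _ := mul_le_mul_of_nonneg_left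
            (mul_le_mul_of_nonneg_right h4 (mul_nonneg (hnn _) hR)) hβ0
      have h2 := Finset.single_le_sum (f := fun e => polyMean ν
        (MvPolynomial.pderiv e (MvPolynomial.monomial m (1 : ℝ))
          * MvPolynomial.pderiv e (MvPolynomial.monomial n 1))) (fun e _ => hterm e)
        (Finset.mem_univ e)
      have h3 := mul_nonneg (polyMean_threePoint_monomial_nonneg hv hβ m)
        (polyMean_threePoint_monomial_nonneg hv hβ n)
      have h4 := mul_le_mul_of_nonneg_left h2 hβ0
      linarith
    · push Not at hex
      have h1 : polyMean ν (MvPolynomial.monomial m (1 : ℝ) * MvPolynomial.monomial n 1)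
          = polyMean ν (MvPolynomial.monomial m (1 : ℝ))
            * polyMean ν (MvPolynomial.monomial n (1 : ℝ)) := by
        rw [MvPolynomial.monomial_mul, polyMean_monomial, polyMean_monomial, polyMean_monomial,
          one_mul, one_mul, one_mul, one_mul, ← Finset.prod_mul_distrib]
        refine Finset.prod_congr rfl fun i _ => ?_
        have h0 := threePointLaw_moment_zero hv hβ
        by_cases hi : m i = 0
        · simp [hi, hν, h0]
        · simp [hex i hi, hν, h0]
      rw [h1]
      have := mul_nonneg hβ0 (Finset.sum_nonneg fun e (_ : e ∈ Finset.univ) => hterm e)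
      linarith
  have hstep : ∀ n : ι →₀ ℕ, polyMean ν (F * MvPolynomial.monomial n 1)
      ≤ polyMean ν F * polyMean ν (MvPolynomial.monomial n (1 : ℝ))
        + β * ∑ e, polyMean ν (MvPolynomial.pderiv e F
          * MvPolynomial.pderiv e (MvPolynomial.monomial n 1)) := by
    intro n
    have := hF.apply_le ((polyMean ν).comp (LinearMap.mulRight ℝ (MvPolynomial.monomial n 1)))
      ((LinearMap.mulRight ℝ (polyMean ν (MvPolynomial.monomial n (1 : ℝ)))).comp (polyMean ν)
        + β • ∑ e, (polyMean ν).comp ((LinearMap.mulRight ℝ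
          (MvPolynomial.pderiv e (MvPolynomial.monomial n 1))).comp (D e)))
      (fun m => by simpa [D] using hmon m n)
    simpa [D] using this
  have := hH.apply_le ((polyMean ν).comp (LinearMap.mulLeft ℝ F))
      ((LinearMap.mulLeft ℝ (polyMean ν F)).comp (polyMean ν)
        + β • ∑ e, (polyMean ν).comp ((LinearMap.mulLeft ℝ (MvPolynomial.pderiv e F)).comp (D e)))
      (fun n => by simpa [D] using hstep n)
  simpa [D] using this

end

end CoefficientOrder

/-! ### Words in two matrices and derivatives of powers. -/

section InsertSum

set_option linter.unusedSectionVars false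

variable {n R : Type*} [Fintype n] [DecidableEq n] [CommRing R]

/-- The sum of all words with `k` letters `D` and `m - k` letters `Y`. -/
def insertSum (Y D : Matrix n n R) : ℕ → ℕ → Matrix n n R
  | 0, m => Y ^ m
  | _ + 1, 0 => 0
  | k + 1, m + 1 => Y * insertSum Y D (k + 1) m + D * insertSum Y D k m

theorem insertSum_eq_zero (Y D : Matrix n n R) {k m : ℕ} (h : m < k) : insertSum Y D k m = 0 := by
  induction m generalizing k with
  | zero =>
    obtain ⟨k, rfl⟩ := Nat.exists_eq_succ_of_ne_zero h.ne'
    rfl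
  | succ m ih =>
    obtain ⟨k, rfl⟩ := Nat.exists_eq_succ_of_ne_zero (Nat.ne_zero_of_lt h)
    rw [Nat.succ_eq_add_one, insertSum, ih (by omega), ih (by omega)]
    simp

/-- The words are sorted by the position a of their first letter D. -/
theorem insertSum_succ_eq_sum (Y D : Matrix n n R) (k m : ℕ) :
    insertSum Y D (k + 1) m = ∑ a ∈ Finset.range m, Y ^ a * D * insertSum Y D k (m - 1 - a) := by
  induction m with
  | zero => simp [insertSum]
  | succ m ih =>
    rw [insertSum, ih, Finset.sum_range_succ', Finset.mul_sum]
    congr 1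
    · refine Finset.sum_congr rfl fun a _ => ?_
      rw [pow_succ' Y a]
      have : m + 1 - 1 - (a + 1) = m - 1 - a := by omega
      rw [this]
      simp only [mul_assoc]
    · simp

theorem insertSum_map {S : Type*} [CommRing S] (f : R →+* S) (Y D : Matrix n n R) (k m : ℕ) :
    (insertSum Y D k m).map f = insertSum (Y.map f) (D.map f) k m := by
  induction m generalizing k with
  | zero =>
    rcases k with _ | k
    · simp [insertSum]
    · ext; simp [insertSum]
  | succ m ih =>
    rcases k with _ | k
    · simp only [insertSum]
      exact Matrix.map_pow Y f (m + 1)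
    · simp only [insertSum]
      rw [Matrix.map_add _ (map_add f), Matrix.map_mul, Matrix.map_mul, ih, ih]

theorem map_pderiv_mul {ι : Type*} (e : ι) (A B : Matrix n n (MvPolynomial ι R)) :
    (A * B).map (MvPolynomial.pderiv e)
      = A.map (MvPolynomial.pderiv e) * B + A * B.map (MvPolynomial.pderiv e) := by
  ext i j
  simp only [Matrix.map_apply, Matrix.mul_apply, Matrix.add_apply, map_sum,
    MvPolynomial.pderiv_mul, Finset.sum_add_distrib]

/-- Leibniz rule: differentiation turns one letter Y into D, and a word with k + 1 letters D arises
in this way from k + 1 words, one for each of its letters D. -/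
theorem insertSum_map_pderiv {ι : Type*} (e : ι) {Y D : Matrix n n (MvPolynomial ι R)}
    (hY : Y.map (MvPolynomial.pderiv e) = D) (hD : D.map (MvPolynomial.pderiv e) = 0) (k m : ℕ) :
    (insertSum Y D k m).map (MvPolynomial.pderiv e) = (k + 1) • insertSum Y D (k + 1) m := by
  induction m generalizing k with
  | zero =>
    rcases k with _ | k
    · ext i j
      simp only [insertSum, pow_zero, Matrix.map_apply, Matrix.one_apply]
      split_ifs <;> simp
    · ext; simp [insertSum]
  | succ m ih =>
    rcases k with _ | k
    · have h0 := ih 0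
      simp only [insertSum, zero_add, one_smul, pow_succ'] at h0 ⊢
      rw [map_pderiv_mul, hY, h0, add_comm]
    · have h0 := ih k
      have h1 := ih (k + 1)
      rw [insertSum, Matrix.map_add _ (map_add _), map_pderiv_mul, map_pderiv_mul, hY, hD, h0, h1]
      rw [insertSum]
      simp only [zero_mul, zero_add, mul_smul_comm, smul_add]
      rw [add_smul (k + 1) 1 (D * _), one_smul]
      abel

end InsertSum

/-! ### Entrywise bounds for powers of a symmetric matrix. -/

section SymmetricPowers

variable {N : ℕ}

theorem Matrix.IsHermitian.pow_apply_eq {Y : Matrix (Fin N) (Fin N) ℝ} (hY : Y.IsHermitian)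
    (a : ℕ) (u v : Fin N) :
    (Y ^ a) u v = ∑ m, hY.eigenvalues m ^ a
      * ((hY.eigenvectorUnitary : Matrix (Fin N) (Fin N) ℝ) u m
        * (hY.eigenvectorUnitary : Matrix (Fin N) (Fin N) ℝ) v m) := by
  have h := hY.spectral_theorem
  have h2 : Y ^ a = (hY.eigenvectorUnitary : Matrix (Fin N) (Fin N) ℝ)
      * Matrix.diagonal (fun m => hY.eigenvalues m ^ a)
      * star (hY.eigenvectorUnitary : Matrix (Fin N) (Fin N) ℝ) := by
    conv_lhs => rw [h]
    rw [← map_pow, Matrix.diagonal_pow, Unitary.conjStarAlgAut_apply]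
    rfl
  rw [h2, Matrix.mul_apply]
  refine Finset.sum_congr rfl fun m _ => ?_
  rw [Matrix.mul_diagonal, Matrix.star_apply]
  simp
  ring

/-- Jensen's inequality for the convex function s ↦ s^(n/a), applied to the values x_i^a. -/
theorem sum_mul_pow_le {κ : Type*} (s : Finset κ) (w x : κ → ℝ) (hw : ∀ i ∈ s, 0 ≤ w i)
    (hw1 : ∑ i ∈ s, w i = 1) (hx : ∀ i ∈ s, 0 ≤ x i) {t : ℝ} (ht : 0 ≤ t) {a n : ℕ} (han : a ≤ n)
    (h : ∑ i ∈ s, w i * x i ^ n ≤ t ^ n) : ∑ i ∈ s, w i * x i ^ a ≤ t ^ a := by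
  rcases Nat.eq_zero_or_pos a with rfl | ha
  · simp [hw1]
  have ha0 : (0 : ℝ) < a := by exact_mod_cast ha
  have hn0 : (0 : ℝ) < n := by exact_mod_cast ha.trans_le han
  have hp : (1 : ℝ) ≤ (n : ℝ) / a := by
    rw [one_le_div ha0]; exact_mod_cast han
  have key := Real.rpow_arith_mean_le_arith_mean_rpow s w (fun i => x i ^ a) hw hw1
    (fun i hi => pow_nonneg (hx i hi) _) hp
  have h1 : ∀ y : ℝ, 0 ≤ y → (y ^ a) ^ ((n : ℝ) / a) = y ^ n := by
    intro y hy
    rw [← Real.rpow_natCast y a, ← Real.rpow_mul hy, mul_div_cancel₀ _ ha0.ne',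
      Real.rpow_natCast]
  have h2 : ∑ i ∈ s, w i * (x i ^ a) ^ ((n : ℝ) / a) = ∑ i ∈ s, w i * x i ^ n :=
    Finset.sum_congr rfl fun i hi => by rw [h1 _ (hx i hi)]
  rw [h2] at key
  have h3 := key.trans h
  rw [← h1 t ht] at h3
  exact (Real.rpow_le_rpow_iff (Finset.sum_nonneg fun i hi =>
    mul_nonneg (hw i hi) (pow_nonneg (hx i hi) _)) (pow_nonneg ht _)
    (by positivity)).1 h3

/-- The squared coordinates at u of the eigenvectors are probability weights, and (Yⁿ)_uu is the
n-th absolute moment of the eigenvalues for them, so lower moments are controlled by Jensen. Mixed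
entries reduce to the two diagonal ones by the arithmetic-geometric mean inequality. -/
theorem Matrix.IsHermitian.abs_pow_apply_le {Y : Matrix (Fin N) (Fin N) ℝ} (hY : Y.IsHermitian)
    {n : ℕ} (hn : Even n) {a : ℕ} (ha : a ≤ n) {u v : Fin N} {t : ℝ} (ht : 0 ≤ t)
    (hu : (Y ^ n) u u ≤ t ^ n) (hv : (Y ^ n) v v ≤ t ^ n) : |(Y ^ a) u v| ≤ t ^ a := by
  set U : Matrix (Fin N) (Fin N) ℝ := (hY.eigenvectorUnitary : Matrix (Fin N) (Fin N) ℝ) with hU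
  have hrow : ∀ w : Fin N, ∑ m, U w m ^ 2 = 1 := by
    intro w
    have h1 := hY.pow_apply_eq 0 w w
    simp only [pow_zero, Matrix.one_apply_eq, one_mul] at h1
    rw [h1]
    exact Finset.sum_congr rfl fun m _ => sq _
  have hdiag : ∀ w : Fin N, (Y ^ n) w w ≤ t ^ n →
      ∑ m, U w m ^ 2 * |hY.eigenvalues m| ^ a ≤ t ^ a := by
    intro w hw
    refine sum_mul_pow_le Finset.univ _ _ (fun _ _ => sq_nonneg _) (hrow w)
      (fun _ _ => abs_nonneg _) ht ha ?_
    rw [hY.pow_apply_eq] at hw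
    refine le_trans (le_of_eq ?_) hw
    refine Finset.sum_congr rfl fun m _ => ?_
    rw [hn.pow_abs, mul_comm, sq]
  rw [hY.pow_apply_eq]
  calc |∑ m, hY.eigenvalues m ^ a * (U u m * U v m)|
      ≤ ∑ m, |hY.eigenvalues m ^ a * (U u m * U v m)| := Finset.abs_sum_le_sum_abs _ _
    _ ≤ ∑ m, (1 / 2 * (U u m ^ 2 * |hY.eigenvalues m| ^ a)
          + 1 / 2 * (U v m ^ 2 * |hY.eigenvalues m| ^ a)) := by
        refine Finset.sum_le_sum fun m _ => ?_
        rw [abs_mul, abs_pow, abs_mul]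
        have h1 : |U u m| * |U v m| ≤ 1 / 2 * (U u m ^ 2 + U v m ^ 2) := by
          nlinarith [sq_nonneg (|U u m| - |U v m|), sq_abs (U u m), sq_abs (U v m)]
        have h2 : 0 ≤ |hY.eigenvalues m| ^ a := by positivity
        nlinarith
    _ = 1 / 2 * ∑ m, U u m ^ 2 * |hY.eigenvalues m| ^ a
          + 1 / 2 * ∑ m, U v m ^ 2 * |hY.eigenvalues m| ^ a := by
        rw [Finset.sum_add_distrib, Finset.mul_sum, Finset.mul_sum]
    _ ≤ t ^ a := by linarith [hdiag u hu, hdiag v hv]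

theorem Matrix.IsHermitian.pow_apply_self_nonneg {Y : Matrix (Fin N) (Fin N) ℝ}
    (hY : Y.IsHermitian) {n : ℕ} (hn : Even n) (u : Fin N) : 0 ≤ (Y ^ n) u u := by
  rw [hY.pow_apply_eq]
  exact Finset.sum_nonneg fun m _ => mul_nonneg (hn.pow_nonneg _) (mul_self_nonneg _)

/-- One scale t controls the block on {i, j} of all powers up to n. A product of such entries is
then bounded by t to the total exponent, and tⁿ returns to diagonal entries, which sum to a trace.
-/
theorem Matrix.IsHermitian.exists_entry_bound {Y : Matrix (Fin N) (Fin N) ℝ}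
    (hY : Y.IsHermitian) {n : ℕ} (hn : Even n) (i j : Fin N) :
    ∃ t : ℝ, 0 ≤ t ∧ t ^ n ≤ (Y ^ n) i i + (Y ^ n) j j ∧
      ∀ a ≤ n, ∀ u v, (u = i ∨ u = j) → (v = i ∨ v = j) → |(Y ^ a) u v| ≤ t ^ a := by
  have hi := hY.pow_apply_self_nonneg hn i
  have hj := hY.pow_apply_self_nonneg hn j
  rcases Nat.eq_zero_or_pos n with rfl | hn0
  -- For n = 0 no n-th root exists, but t = 1 works.
  · refine ⟨1, zero_le_one, by simp, fun a ha u v hu hv => ?_⟩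
    have ha0 : a = 0 := by omega
    subst ha0
    simp only [pow_zero, Matrix.one_apply]
    split_ifs <;> simp
  · refine ⟨((Y ^ n) i i + (Y ^ n) j j) ^ ((n : ℝ)⁻¹), by positivity, ?_, ?_⟩
    · rw [Real.rpow_inv_natCast_pow (by positivity) hn0.ne']
    · intro a ha u v hu hv
      have h1 : ∀ w, (w = i ∨ w = j) →
          (Y ^ n) w w ≤ (((Y ^ n) i i + (Y ^ n) j j) ^ ((n : ℝ)⁻¹)) ^ n := by
        intro w hw
        rw [Real.rpow_inv_natCast_pow (by positivity) hn0.ne']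
        rcases hw with rfl | rfl <;> linarith
      exact hY.abs_pow_apply_le hn ha (by positivity) (h1 u hu) (h1 v hv)

/-- `D` vanishes outside the positions `(i, j)` and `(j, i)`. -/
def PairSupported {R : Type*} [Zero R] (D : Matrix (Fin N) (Fin N) R) (i j : Fin N) : Prop :=
  ∀ k l, D k l ≠ 0 → (k = i ∧ l = j) ∨ (k = j ∧ l = i)

theorem PairSupported.abs_sum_le {D : Matrix (Fin N) (Fin N) ℝ} {i j : Fin N}
    (hD : PairSupported D i j) {f : Fin N → Fin N → ℝ} {c : ℝ} (hc : 0 ≤ c)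
    (hf : ∀ k l, (k = i ∨ k = j) → (l = i ∨ l = j) → |D k l * f k l| ≤ c) :
    |∑ k, ∑ l, D k l * f k l| ≤ 2 * c := by
  have h0 : ∑ k, ∑ l, D k l * f k l
      = ∑ p ∈ ({(i, j), (j, i)} : Finset (Fin N × Fin N)), D p.1 p.2 * f p.1 p.2 := by
    rw [← Fintype.sum_prod_type' (f := fun k l => D k l * f k l)]
    symm
    refine Finset.sum_subset (Finset.subset_univ _) fun p _ hp => ?_
    by_cases hz : D p.1 p.2 = 0
    · simp [hz]
    · exfalso
      apply hp
      rcases hD _ _ hz with ⟨h1, h2⟩ | ⟨h1, h2⟩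
      · simp [← h1, ← h2]
      · simp [← h1, ← h2]
  rw [h0]
  refine (Finset.abs_sum_le_sum_abs _ _).trans ?_
  refine (Finset.sum_le_card_nsmul _ _ c fun p hp => ?_).trans ?_
  · simp only [Finset.mem_insert, Finset.mem_singleton] at hp
    rcases hp with rfl | rfl
    · exact hf _ _ (Or.inl rfl) (Or.inr rfl)
    · exact hf _ _ (Or.inr rfl) (Or.inl rfl)
  · rw [nsmul_eq_mul]
    gcongr
    exact_mod_cast Finset.card_le_two

/-- Every intermediate index next to a letter D is i or j, so only the controlled block of the
powers of Y is seen. Each D has at most m positions and two entries of size at most d, which gives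
2md per letter; the runs of Y multiply to t^(m-k). -/
theorem PairSupported.abs_insertSum_le {Y D : Matrix (Fin N) (Fin N) ℝ} {i j : Fin N}
    (hD : PairSupported D i j) {d : ℝ} (hd : ∀ k l, |D k l| ≤ d) {t : ℝ} (ht : 0 ≤ t) {n : ℕ}
    (hY : ∀ a ≤ n, ∀ u v, (u = i ∨ u = j) → (v = i ∨ v = j) → |(Y ^ a) u v| ≤ t ^ a)
    {k m : ℕ} (hm : m ≤ n + k) {u v : Fin N} (hu : u = i ∨ u = j) (hv : v = i ∨ v = j) :
    |insertSum Y D k m u v| ≤ (2 * m * d) ^ k * t ^ (m - k) := by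
  have hd0 : 0 ≤ d := (abs_nonneg _).trans (hd u v)
  induction k generalizing m u with
  | zero => simpa [insertSum] using hY m (by omega) u v hu hv
  | succ k ih =>
    rw [insertSum_succ_eq_sum, Matrix.sum_apply]
    have hterm : ∀ a ∈ Finset.range m, |(Y ^ a * D * insertSum Y D k (m - 1 - a)) u v|
        ≤ 2 * (d * ((2 * m * d) ^ k * t ^ (m - (k + 1)))) := by
      intro a ha
      have ham : a < m := Finset.mem_range.1 ha
      by_cases hk : m - 1 - a < k
      · rw [insertSum_eq_zero _ _ hk]
        simp only [mul_zero, Matrix.zero_apply, abs_zero]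
        positivity
      · have h1 : (Y ^ a * D * insertSum Y D k (m - 1 - a)) u v
            = ∑ w, ∑ w', D w w' * ((Y ^ a) u w * insertSum Y D k (m - 1 - a) w' v) := by
          rw [Matrix.mul_apply, Finset.sum_comm]
          refine Finset.sum_congr rfl fun w' _ => ?_
          rw [Matrix.mul_apply, Finset.sum_mul]
          exact Finset.sum_congr rfl fun w _ => by ring
        rw [h1]
        refine hD.abs_sum_le (by positivity) fun w w' hw hw' => ?_
        rw [abs_mul, abs_mul]
        have h2 := hY a (by omega) u w hu hw
        have h3 := ih (m := m - 1 - a) (by omega) hw'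
        have h4 : ((m - 1 - a : ℕ) : ℝ) ≤ m := by exact_mod_cast (by omega : m - 1 - a ≤ m)
        have h5 : t ^ (m - (k + 1)) = t ^ a * t ^ (m - 1 - a - k) := by
          rw [← pow_add]; congr 1; omega
        calc |D w w'| * (|(Y ^ a) u w| * |insertSum Y D k (m - 1 - a) w' v|)
            ≤ d * (t ^ a * ((2 * m * d) ^ k * t ^ (m - 1 - a - k))) := by
              refine mul_le_mul (hd _ _) (mul_le_mul h2 (h3.trans ?_) (abs_nonneg _)
                (by positivity)) (by positivity) hd0
              gcongr
          _ = _ := by rw [h5]; ring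
    calc |∑ a ∈ Finset.range m, (Y ^ a * D * insertSum Y D k (m - 1 - a)) u v|
        ≤ ∑ a ∈ Finset.range m, |(Y ^ a * D * insertSum Y D k (m - 1 - a)) u v| :=
          Finset.abs_sum_le_sum_abs _ _
      _ ≤ ∑ a ∈ Finset.range m, 2 * (d * ((2 * m * d) ^ k * t ^ (m - (k + 1)))) :=
          Finset.sum_le_sum hterm
      _ = _ := by
          rw [Finset.sum_const, Finset.card_range, nsmul_eq_mul]; ring

theorem PairSupported.abs_trace_mul_insertSum_le {Y D : Matrix (Fin N) (Fin N) ℝ} {i j : Fin N}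
    (hD : PairSupported D i j) {d : ℝ} (hd : ∀ k l, |D k l| ≤ d) {t : ℝ} (ht : 0 ≤ t) {n : ℕ}
    (hY : ∀ a ≤ n, ∀ u v, (u = i ∨ u = j) → (v = i ∨ v = j) → |(Y ^ a) u v| ≤ t ^ a)
    {k m : ℕ} (hm : m ≤ n + k) :
    |(D * insertSum Y D k m).trace| ≤ 2 * (d * ((2 * m * d) ^ k * t ^ (m - k))) := by
  have h1 : (D * insertSum Y D k m).trace = ∑ w, ∑ w', D w w' * insertSum Y D k m w' w := by
    simp [Matrix.trace, Matrix.mul_apply]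
  have hd0 : 0 ≤ d := (abs_nonneg _).trans (hd i j)
  rw [h1]
  refine hD.abs_sum_le (by positivity) fun w w' hw hw' => ?_
  rw [abs_mul]
  exact mul_le_mul (hd _ _) (hD.abs_insertSum_le hd ht hY hm hw' hw) (abs_nonneg _) hd0

theorem PairSupported.abs_mul_insertSum_apply_le {Y D : Matrix (Fin N) (Fin N) ℝ} {i j : Fin N}
    (hD : PairSupported D i j) {d : ℝ} (hd : ∀ k l, |D k l| ≤ d) {t : ℝ} (ht : 0 ≤ t) {n : ℕ}
    (hY : ∀ a ≤ n, ∀ u v, (u = i ∨ u = j) → (v = i ∨ v = j) → |(Y ^ a) u v| ≤ t ^ a)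
    {k m : ℕ} (hm : m ≤ n + k) {u : Fin N} (hu : u = i ∨ u = j) :
    |(D * insertSum Y D k m) u u| ≤ 2 * (d * ((2 * m * d) ^ k * t ^ (m - k))) := by
  have h1 : (D * insertSum Y D k m) u u
      = ∑ w, ∑ w', D w w' * (if w = u then insertSum Y D k m w' u else 0) := by
    symm
    rw [Finset.sum_eq_single u]
    · simp [Matrix.mul_apply]
    · intro w _ hw; simp [hw]
    · simp
  have hd0 : 0 ≤ d := (abs_nonneg _).trans (hd i j)
  rw [h1]
  refine hD.abs_sum_le (by positivity) fun w w' hw hw' => ?_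
  rw [abs_mul]
  refine mul_le_mul (hd _ _) ?_ (abs_nonneg _) hd0
  have := hD.abs_insertSum_le hd ht hY hm hw' hu
  split_ifs
  · exact this
  · simp only [abs_zero]; positivity

end SymmetricPowers

/-! ### Covariance structure and index contractions. -/

section Covariance

variable {N : ℕ} {ι S : Type*} [Fintype ι] [CommRing S]

/-- The matrices `c e` satisfy `∑ₑ c e k l * c e m n = p [k = n, l = m] + q [k = m, l = n]`. -/
def HasCovariance (c : ι → Matrix (Fin N) (Fin N) S) (p q : S) : Prop :=
  ∀ k l m n, ∑ e, c e k l * c e m n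
    = p * (if k = n ∧ l = m then 1 else 0) + q * (if k = m ∧ l = n then 1 else 0)

variable {c : ι → Matrix (Fin N) (Fin N) S} {p q : S}

theorem HasCovariance.map {T : Type*} [CommRing T] (h : HasCovariance c p q) (f : S →+* T) :
    HasCovariance (fun e => (c e).map f) (f p) (f q) := by
  intro k l m n
  have := congrArg f (h k l m n)
  simpa [apply_ite f] using this

/-- Contraction of the two occurrences of c: the p-pairing closes A into its trace, the q-pairing
transposes it. -/
theorem HasCovariance.sum_mul_mul (h : HasCovariance c p q) (A : Matrix (Fin N) (Fin N) S) :
    ∑ e, c e * A * c e = p • (A.trace • (1 : Matrix (Fin N) (Fin N) S)) + q • A.transpose := by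
  ext k n
  have h1 : ∀ e, (c e * A * c e) k n = ∑ m, ∑ l, A l m * (c e k l * c e m n) := by
    intro e
    rw [Matrix.mul_apply]
    refine Finset.sum_congr rfl fun m _ => ?_
    rw [Matrix.mul_apply, Finset.sum_mul]
    exact Finset.sum_congr rfl fun l _ => by ring
  rw [Matrix.sum_apply]
  simp_rw [h1]
  rw [Finset.sum_comm]
  simp_rw [Finset.sum_comm (s := (Finset.univ : Finset ι)), ← Finset.mul_sum, h k _ _ n]
  simp only [mul_add, Finset.sum_add_distrib, Matrix.add_apply, Matrix.smul_apply, smul_eq_mul,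
    Matrix.transpose_apply]
  congr 1
  · by_cases hkn : k = n
    · subst hkn
      simp [Matrix.trace, Finset.mul_sum, mul_comm]
    · simp [hkn]
  · rw [Finset.sum_eq_single k]
    · rw [Finset.sum_eq_single n]
      · simp [mul_comm]
      · intro l _ hl; simp [hl]
      · simp
    · intro m _ hm; simp [Ne.symm hm]
    · simp

theorem HasCovariance.sum_trace_mul (h : HasCovariance c p q) (A B : Matrix (Fin N) (Fin N) S) :
    ∑ e, (c e * A * c e * B).trace = p * (A.trace * B.trace) + q * (A.transpose * B).trace := by
  rw [← Matrix.trace_sum, ← Finset.sum_mul, h.sum_mul_mul, add_mul, Matrix.trace_add]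
  simp

/-- The complementary contraction, between two traces, merges them into a single one; it governs
covariances of traces. -/
theorem HasCovariance.sum_trace_mul_trace (h : HasCovariance c p q)
    (A B : Matrix (Fin N) (Fin N) S) :
    ∑ e, (c e * A).trace * (c e * B).trace = p * (A * B).trace + q * (A.transpose * B).trace := by
  have h0 : ∀ e (M : Matrix (Fin N) (Fin N) S),
      (c e * M).trace = ∑ x : Fin N × Fin N, c e x.1 x.2 * M x.2 x.1 := by
    intro e M
    rw [Fintype.sum_prod_type]
    simp [Matrix.trace, Matrix.mul_apply]
  have h1 : ∀ e, (c e * A).trace * (c e * B).trace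
      = ∑ x : Fin N × Fin N, ∑ y : Fin N × Fin N,
        A x.2 x.1 * B y.2 y.1 * (c e x.1 x.2 * c e y.1 y.2) := by
    intro e
    rw [h0, h0, Finset.sum_mul_sum]
    exact Finset.sum_congr rfl fun x _ => Finset.sum_congr rfl fun y _ => by ring
  have h3 : ∑ e, (c e * A).trace * (c e * B).trace
      = ∑ x : Fin N × Fin N, ∑ y : Fin N × Fin N, A x.2 x.1 * B y.2 y.1
        * (p * (if x.1 = y.2 ∧ x.2 = y.1 then 1 else 0)
          + q * (if x.1 = y.1 ∧ x.2 = y.2 then 1 else 0)) := by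
    rw [Finset.sum_congr rfl fun e _ => h1 e, Finset.sum_comm]
    refine Finset.sum_congr rfl fun x _ => ?_
    rw [Finset.sum_comm]
    refine Finset.sum_congr rfl fun y _ => ?_
    rw [← Finset.mul_sum, h]
  rw [h3]
  simp only [mul_add, Finset.sum_add_distrib]
  congr 1
  · have h2 : ∀ x : Fin N × Fin N, ∑ y : Fin N × Fin N,
        A x.2 x.1 * B y.2 y.1 * (p * if x.1 = y.2 ∧ x.2 = y.1 then 1 else 0)
        = p * (A x.2 x.1 * B x.1 x.2) := by
      intro x
      rw [Finset.sum_eq_single (x.2, x.1)]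
      · simp only [and_self, if_true]; ring
      · intro y _ hy
        have : ¬ (x.1 = y.2 ∧ x.2 = y.1) := fun ⟨h3, h4⟩ => hy (Prod.ext h4.symm h3.symm)
        simp [this]
      · simp
    simp_rw [h2]
    rw [← Finset.mul_sum, Fintype.sum_prod_type, Finset.sum_comm]
    simp [Matrix.trace, Matrix.mul_apply]
  · have h2 : ∀ x : Fin N × Fin N, ∑ y : Fin N × Fin N,
        A x.2 x.1 * B y.2 y.1 * (q * if x.1 = y.1 ∧ x.2 = y.2 then 1 else 0)
        = q * (A x.2 x.1 * B x.2 x.1) := by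
      intro x
      rw [Finset.sum_eq_single x]
      · simp only [and_self, if_true]; ring
      · intro y _ hy
        have : ¬ (x.1 = y.1 ∧ x.2 = y.2) := fun ⟨h3, h4⟩ => hy (Prod.ext h3.symm h4.symm)
        simp [this]
      · simp
    simp_rw [h2]
    rw [← Finset.mul_sum, Fintype.sum_prod_type]
    simp [Matrix.trace, Matrix.mul_apply]

end Covariance

/-! ### A common framework for Hermitian and symmetric Wigner matrices. -/

/-- A random matrix `∑ₑ xₑ mat e` with independent real coordinates, where `mat e` is Hermitian and
dominated entrywise by a symmetric nonnegative matrix `dom e` that is supported on the positions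
`(src e, tgt e)` and `(tgt e, src e)`. -/
structure EdgeModel (N : ℕ) (ι : Type) [Fintype ι] where
  src : ι → Fin N
  tgt : ι → Fin N
  inj : Function.Injective fun e => (src e, tgt e)
  mat : ι → Matrix (Fin N) (Fin N) ℂ
  dom : ι → Matrix (Fin N) (Fin N) ℝ
  -- The value is 0 in the Hermitian and 1 in the symmetric model. The dominating matrices have the
  -- symmetric covariance p = q = 1/N in both cases.
  κ : ℝ
  κ_nonneg : 0 ≤ κ
  κ_le_one : κ ≤ 1
  mat_herm : ∀ e, (mat e).IsHermitian
  dom_herm : ∀ e, (dom e).IsHermitian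
  dom_supp : ∀ e, PairSupported (dom e) (src e) (tgt e)
  norm_le : ∀ e k l, ‖mat e k l‖ ≤ dom e k l
  dom_sq_le : ∀ e k l, dom e k l ^ 2 ≤ 2 / N
  mat_cov : HasCovariance mat (1 / (N : ℂ)) ((κ : ℂ) / N)
  dom_cov : HasCovariance dom (1 / (N : ℝ)) (1 / N)

/-! ### Matrices of linear forms, their powers and derivatives. -/

section LinearMatrix

set_option linter.unusedSectionVars false

variable {N : ℕ} {ι : Type} [Fintype ι] [DecidableEq ι] {𝕜 : Type*} [RCLike 𝕜]

/-- The matrix `∑ₑ xₑ A e` at a real point `x`. -/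
noncomputable def linMat (A : ι → Matrix (Fin N) (Fin N) 𝕜) (x : ι → ℝ) :
    Matrix (Fin N) (Fin N) 𝕜 := ∑ e, ((x e : ℝ) : 𝕜) • A e

/-- A constant matrix as a matrix of polynomials. -/
noncomputable def constPoly (D : Matrix (Fin N) (Fin N) 𝕜) :
    Matrix (Fin N) (Fin N) (MvPolynomial ι 𝕜) := D.map MvPolynomial.C

/-- The matrix `∑ₑ Xₑ A e` of linear forms. -/
noncomputable def linPoly (A : ι → Matrix (Fin N) (Fin N) 𝕜) :
    Matrix (Fin N) (Fin N) (MvPolynomial ι 𝕜) :=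
  ∑ e, (MvPolynomial.X e : MvPolynomial ι 𝕜) • constPoly (A e)

theorem constPoly_map_evalAt (x : ι → ℝ) (D : Matrix (Fin N) (Fin N) 𝕜) :
    (constPoly D).map (evalAt x) = D := by
  ext i j; simp [constPoly]

theorem linPoly_apply (A : ι → Matrix (Fin N) (Fin N) 𝕜) (i j : Fin N) :
    linPoly A i j = ∑ e, MvPolynomial.X e * MvPolynomial.C (A e i j) := by
  simp [linPoly, constPoly, Matrix.sum_apply]

theorem linPoly_map_evalAt (A : ι → Matrix (Fin N) (Fin N) 𝕜) (x : ι → ℝ) :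
    (linPoly A).map (evalAt x) = linMat A x := by
  ext i j
  simp [linPoly_apply, linMat, Matrix.sum_apply, RCLike.real_smul_eq_coe_mul]

theorem evalAt_linPoly_pow (A : ι → Matrix (Fin N) (Fin N) 𝕜) (x : ι → ℝ) (k : ℕ) (i j : Fin N) :
    evalAt x ((linPoly A ^ k) i j) = (linMat A x ^ k) i j := by
  rw [← linPoly_map_evalAt, ← Matrix.map_pow]; rfl

theorem linPoly_map_pderiv (A : ι → Matrix (Fin N) (Fin N) 𝕜) (e : ι) :
    (linPoly A).map (MvPolynomial.pderiv e) = constPoly (A e) := by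
  ext1 i j
  simp only [Matrix.map_apply, linPoly_apply, map_sum, MvPolynomial.pderiv_mul,
    MvPolynomial.pderiv_C, mul_zero, add_zero, constPoly]
  rw [Finset.sum_eq_single e]
  · simp
  · intro f _ hf; simp [MvPolynomial.pderiv_X_of_ne hf]
  · simp

theorem constPoly_map_pderiv (D : Matrix (Fin N) (Fin N) 𝕜) (e : ι) :
    (constPoly D : Matrix _ _ (MvPolynomial ι 𝕜)).map (MvPolynomial.pderiv e) = 0 := by
  ext1 i j; simp [constPoly]

/-- Words with `k` letters `A e` among `m` letters, the others being the random matrix. -/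
noncomputable def insertPoly (A : ι → Matrix (Fin N) (Fin N) 𝕜) (e : ι) (k m : ℕ) :
    Matrix (Fin N) (Fin N) (MvPolynomial ι 𝕜) := insertSum (linPoly A) (constPoly (A e)) k m

theorem insertPoly_map_pderiv (A : ι → Matrix (Fin N) (Fin N) 𝕜) (e : ι) (k m : ℕ) :
    (insertPoly A e k m).map (MvPolynomial.pderiv e) = (k + 1) • insertPoly A e (k + 1) m :=
  insertSum_map_pderiv e (linPoly_map_pderiv A e) (constPoly_map_pderiv _ e) k m

theorem insertPoly_map_evalAt (A : ι → Matrix (Fin N) (Fin N) 𝕜) (e : ι) (k m : ℕ) (x : ι → ℝ) :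
    (insertPoly A e k m).map (evalAt x) = insertSum (linMat A x) (A e) k m := by
  rw [insertPoly, insertSum_map, linPoly_map_evalAt, constPoly_map_evalAt]

theorem insertPoly_zero (A : ι → Matrix (Fin N) (Fin N) 𝕜) (e : ι) (m : ℕ) :
    insertPoly A e 0 m = linPoly A ^ m := by
  cases m <;> rfl

theorem linPoly_mul (A : ι → Matrix (Fin N) (Fin N) 𝕜)
    (M : Matrix (Fin N) (Fin N) (MvPolynomial ι 𝕜)) :
    linPoly A * M = ∑ e, (MvPolynomial.X e : MvPolynomial ι 𝕜) • (constPoly (A e) * M) := by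
  rw [linPoly, Finset.sum_mul]
  exact Finset.sum_congr rfl fun e _ => Matrix.smul_mul _ _ _

theorem map_pderiv_constPoly_mul (A : ι → Matrix (Fin N) (Fin N) 𝕜) (e : ι) (k m : ℕ) :
    (constPoly (A e) * insertPoly A e k m).map (MvPolynomial.pderiv e)
      = (k + 1) • (constPoly (A e) * insertPoly A e (k + 1) m) := by
  rw [map_pderiv_mul, constPoly_map_pderiv, zero_mul, zero_add, insertPoly_map_pderiv,
    mul_smul_comm]

/-- The factor 6 is 1 · 2 · 3, from three applications of the Leibniz rule for words. -/
theorem map_pderiv_three (A : ι → Matrix (Fin N) (Fin N) 𝕜) (e : ι) (m : ℕ) :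
    (((constPoly (A e) * linPoly A ^ m).map (MvPolynomial.pderiv e)).map
      (MvPolynomial.pderiv e)).map (MvPolynomial.pderiv e)
      = 6 • (constPoly (A e) * insertPoly A e 3 m) := by
  have hs : ∀ (k : ℕ) (M : Matrix (Fin N) (Fin N) (MvPolynomial ι 𝕜)),
      (k • M).map (MvPolynomial.pderiv e) = k • M.map (MvPolynomial.pderiv e) := by
    intro k M; ext1 i j
    rw [Matrix.map_apply, Matrix.smul_apply, map_nsmul, Matrix.smul_apply, Matrix.map_apply]
  rw [← insertPoly_zero A e m, map_pderiv_constPoly_mul, hs, map_pderiv_constPoly_mul, hs, hs,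
    map_pderiv_constPoly_mul, smul_smul, smul_smul]
  norm_num

theorem trace_map_pderiv (e : ι) (M : Matrix (Fin N) (Fin N) (MvPolynomial ι 𝕜)) :
    MvPolynomial.pderiv e M.trace = (M.map (MvPolynomial.pderiv e)).trace := by
  simp [Matrix.trace]

theorem evalAt_trace (x : ι → ℝ) (M : Matrix (Fin N) (Fin N) (MvPolynomial ι 𝕜)) :
    evalAt x M.trace = (M.map (evalAt x)).trace := by
  simp [Matrix.trace]

/-- By cyclicity of the trace all a positions of the differentiated letter contribute equally. -/
theorem pderiv_trace_pow (A : ι → Matrix (Fin N) (Fin N) 𝕜) (e : ι) (a : ℕ) :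
    MvPolynomial.pderiv e (linPoly A ^ a).trace
      = a • (constPoly (A e) * linPoly A ^ (a - 1)).trace := by
  rw [trace_map_pderiv, ← insertPoly_zero A e a, insertPoly_map_pderiv, zero_add, one_smul,
    insertPoly, insertSum_succ_eq_sum, Matrix.trace_sum]
  rw [Finset.sum_congr rfl (g := fun _ => (constPoly (A e) * linPoly A ^ (a - 1)).trace)]
  · simp
  · intro i hi
    have h1 : a - 1 - i + i = a - 1 := by have := Finset.mem_range.1 hi; omega
    rw [← insertPoly, insertPoly_zero, Matrix.mul_assoc, Matrix.trace_mul_comm, Matrix.mul_assoc,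
      ← pow_add, h1]

/-- Entrywise comparison of the coefficients. -/
def MatCoeffLE (P : Matrix (Fin N) (Fin N) (MvPolynomial ι 𝕜))
    (Q : Matrix (Fin N) (Fin N) (MvPolynomial ι ℝ)) : Prop := ∀ i j, CoeffLE (P i j) (Q i j)

theorem MatCoeffLE.mul {P P' : Matrix (Fin N) (Fin N) (MvPolynomial ι 𝕜)}
    {Q Q' : Matrix (Fin N) (Fin N) (MvPolynomial ι ℝ)} (h : MatCoeffLE P Q)
    (h' : MatCoeffLE P' Q') : MatCoeffLE (P * P') (Q * Q') := fun i j => by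
  rw [Matrix.mul_apply, Matrix.mul_apply]
  exact CoeffLE.sum _ fun k _ => (h i k).mul (h' k j)

theorem MatCoeffLE.pow {P : Matrix (Fin N) (Fin N) (MvPolynomial ι 𝕜)}
    {Q : Matrix (Fin N) (Fin N) (MvPolynomial ι ℝ)} (h : MatCoeffLE P Q) (k : ℕ) :
    MatCoeffLE (P ^ k) (Q ^ k) := by
  induction k with
  | zero =>
    intro i j
    simp only [pow_zero, Matrix.one_apply]
    split_ifs
    · exact CoeffLE.one
    · exact CoeffLE.zero
  | succ k ih => rw [pow_succ, pow_succ]; exact ih.mul h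

theorem MatCoeffLE.trace {P : Matrix (Fin N) (Fin N) (MvPolynomial ι 𝕜)}
    {Q : Matrix (Fin N) (Fin N) (MvPolynomial ι ℝ)} (h : MatCoeffLE P Q) :
    CoeffLE P.trace Q.trace := CoeffLE.sum _ fun i _ => h i i

theorem MatCoeffLE.constPoly {D : Matrix (Fin N) (Fin N) 𝕜} {D' : Matrix (Fin N) (Fin N) ℝ}
    (h : ∀ i j, ‖D i j‖ ≤ D' i j) :
    MatCoeffLE (constPoly D : Matrix _ _ (MvPolynomial ι 𝕜)) (_root_.constPoly D') :=
  fun i j => CoeffLE.C (h i j)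

theorem MatCoeffLE.linPoly {A : ι → Matrix (Fin N) (Fin N) 𝕜} {B : ι → Matrix (Fin N) (Fin N) ℝ}
    (h : ∀ e i j, ‖A e i j‖ ≤ B e i j) : MatCoeffLE (linPoly A) (_root_.linPoly B) := fun i j => by
  rw [linPoly_apply, linPoly_apply]
  exact CoeffLE.sum _ fun e _ => (CoeffLE.X e).mul (CoeffLE.C (h e i j))

theorem totalDegree_linPoly_pow (A : ι → Matrix (Fin N) (Fin N) 𝕜) (k : ℕ) (i j : Fin N) :
    ((linPoly A ^ k) i j).totalDegree ≤ k := by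
  induction k generalizing i with
  | zero =>
    simp only [pow_zero, Matrix.one_apply]
    split_ifs <;> simp
  | succ k ih =>
    rw [pow_succ', Matrix.mul_apply]
    refine MvPolynomial.totalDegree_finsetSum_le fun l _ => ?_
    refine (MvPolynomial.totalDegree_mul _ _).trans ?_
    have : (linPoly A i l).totalDegree ≤ 1 := by
      rw [linPoly_apply]
      refine MvPolynomial.totalDegree_finsetSum_le fun e _ => ?_
      refine (MvPolynomial.totalDegree_mul _ _).trans ?_
      simp
    have := ih l
    omega

theorem linMat_isHermitian {A : ι → Matrix (Fin N) (Fin N) 𝕜} (h : ∀ e, (A e).IsHermitian)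
    (x : ι → ℝ) : (linMat A x).IsHermitian := by
  rw [Matrix.IsHermitian, linMat, Matrix.conjTranspose_sum]
  refine Finset.sum_congr rfl fun e _ => ?_
  rw [Matrix.conjTranspose_smul, (h e).eq]
  simp

end LinearMatrix

/-! ### Vanishing of means by sign symmetry. -/

section SignFlip

set_option linter.unusedSectionVars false

variable {ι : Type} [Fintype ι] [DecidableEq ι] {𝕜 : Type*} [RCLike 𝕜]

theorem polyMean_sign_flip {μ : Measure ℝ} (h : IsSymmLaw μ) {s : ι → ℝ}
    (hs : ∀ e, s e = 1 ∨ s e = -1) (P : MvPolynomial ι 𝕜) :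
    ∫ x, evalAt (fun e => s e * x e) P ∂(Measure.pi fun _ : ι => μ) = polyMean μ P := by
  have := h.prob
  have hone : ∀ e, μ.map (fun t => s e * t) = μ := by
    intro e
    rcases hs e with h1 | h1
    · simp [h1]
    · simpa [h1] using h.symm
  have hm : (Measure.pi fun _ : ι => μ).map (fun x e => s e * x e) = Measure.pi fun _ : ι => μ := by
    have : ∀ e, SigmaFinite (μ.map (fun t => s e * t)) := fun e => by rw [hone e]; infer_instance
    have h2 := Measure.pi_map_pi (μ := fun _ : ι => μ) (f := fun e t => s e * t)
      (fun e => by fun_prop)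
    rw [h2]
    simp_rw [hone]
  have h3 := integral_map (μ := Measure.pi fun _ : ι => μ) (φ := fun x e => s e * x e)
    (f := fun x => evalAt x P)
    (measurable_pi_lambda _ fun e => (measurable_pi_apply e).const_mul (s e)).aemeasurable
    (by rw [hm]; exact (integrable_evalAt h P).aestronglyMeasurable)
  rw [hm, integral_evalAt h] at h3
  exact h3.symm

/-- The product law is invariant under coordinatewise sign changes, so the mean equals its own
negative. -/
theorem polyMean_eq_zero_of_sign {μ : Measure ℝ} (h : IsSymmLaw μ) {s : ι → ℝ}
    (hs : ∀ e, s e = 1 ∨ s e = -1) {P : MvPolynomial ι 𝕜}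
    (hP : ∀ x, evalAt (fun e => s e * x e) P = -evalAt x P) : polyMean μ P = 0 := by
  have h1 := polyMean_sign_flip h hs P
  simp_rw [hP] at h1
  rw [integral_neg, integral_evalAt h] at h1
  exact self_eq_neg.1 h1.symm

end SignFlip

/-! ### Recursion for the mean traces of the dominating matrix. -/

section TraceMoments

set_option linter.unusedSectionVars false

variable {N : ℕ} {ι : Type} [Fintype ι] [DecidableEq ι] (E : EdgeModel N ι) {v β : ℝ}

/-- The mean trace of the `k`-th power of the dominating matrix with three-point entries. -/
noncomputable def EdgeModel.domMoment (v β : ℝ) (k : ℕ) : ℝ :=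
  polyMean (threePointLaw v β) (linPoly E.dom ^ k).trace

theorem EdgeModel.dom_nonneg (e : ι) (k l : Fin N) : 0 ≤ E.dom e k l :=
  (norm_nonneg _).trans (E.norm_le e k l)

theorem EdgeModel.matCoeffLE_dom : MatCoeffLE (linPoly E.dom) (linPoly E.dom) :=
  MatCoeffLE.linPoly fun e i j => (Real.norm_of_nonneg (E.dom_nonneg e i j)).le

theorem EdgeModel.matCoeffLE_mat : MatCoeffLE (linPoly E.mat) (linPoly E.dom) :=
  MatCoeffLE.linPoly E.norm_le

theorem EdgeModel.matCoeffLE_const_dom (e : ι) :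
    MatCoeffLE (constPoly (E.dom e) : Matrix _ _ (MvPolynomial ι ℝ)) (constPoly (E.dom e)) :=
  MatCoeffLE.constPoly fun i j => (Real.norm_of_nonneg (E.dom_nonneg e i j)).le

theorem EdgeModel.coeffNonneg_trace_pow (k : ℕ) : CoeffNonneg (linPoly E.dom ^ k).trace :=
  (E.matCoeffLE_dom.pow k).trace.nonneg

theorem EdgeModel.domMoment_nonneg (hv : 0 < v) (hβ : v ≤ β) (k : ℕ) : 0 ≤ E.domMoment v β k :=
  (E.coeffNonneg_trace_pow k).polyMean_nonneg hv hβ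

theorem EdgeModel.domMoment_zero (hv : 0 < v) (hβ : v ≤ β) : E.domMoment v β 0 = N := by
  have := threePointLaw_prob hv hβ
  have h : (linPoly E.dom ^ 0).trace = (MvPolynomial.C (N : ℝ) : MvPolynomial ι ℝ) := by
    simp [Matrix.trace_one]
  rw [EdgeModel.domMoment, h, polyMean_C]

theorem EdgeModel.domMoment_odd (hv : 0 < v) (hβ : v ≤ β) {k : ℕ} (hk : Odd k) :
    E.domMoment v β k = 0 := by
  refine polyMean_eq_zero_of_sign (threePointLaw_isSymmLaw hv hβ) (s := fun _ => -1)
    (fun _ => Or.inr rfl) fun x => ?_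
  have h1 : linMat E.dom (fun e => -1 * x e) = -linMat E.dom x := by
    simp [linMat]
  simp only [Matrix.trace, Matrix.diag_apply, map_sum, evalAt_linPoly_pow, h1, hk.neg_pow]
  simp

theorem EdgeModel.linPoly_dom_transpose : (linPoly E.dom).transpose = linPoly E.dom := by
  ext1 i j
  rw [Matrix.transpose_apply, linPoly_apply, linPoly_apply]
  refine Finset.sum_congr rfl fun e _ => ?_
  have := congrFun (congrFun (E.dom_herm e).eq i) j
  rw [Matrix.conjTranspose_apply] at this
  rw [← this]
  simp

theorem EdgeModel.linPoly_dom_pow_transpose (k : ℕ) :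
    (linPoly E.dom ^ k).transpose = linPoly E.dom ^ k := by
  rw [Matrix.transpose_pow, E.linPoly_dom_transpose]

theorem EdgeModel.dom_cov_poly : HasCovariance
    (fun e => (constPoly (E.dom e) : Matrix _ _ (MvPolynomial ι ℝ)))
    (MvPolynomial.C (1 / (N : ℝ))) (MvPolynomial.C (1 / (N : ℝ))) :=
  E.dom_cov.map MvPolynomial.C

/-- Expand one factor of the power as Σ X_e D_e and integrate by parts in each X_e. The third
derivative produces words with three more letters D_e, with multiplicity 6. -/
theorem EdgeModel.domMoment_succ_le (hv : 0 < v) (hβ : v ≤ β) (n : ℕ) :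
    E.domMoment v β (n + 1)
      ≤ v * ∑ e, polyMean (threePointLaw v β) (constPoly (E.dom e) * insertPoly E.dom e 1 n).trace
        + 6 * β ^ 2 * ∑ e, polyMean (threePointLaw v β)
          (constPoly (E.dom e) * insertPoly E.dom e 3 n).trace := by
  rw [EdgeModel.domMoment, pow_succ', linPoly_mul, Matrix.trace_sum, map_sum, Finset.mul_sum,
    Finset.mul_sum, ← Finset.sum_add_distrib]
  refine Finset.sum_le_sum fun e _ => ?_
  rw [Matrix.trace_smul, smul_eq_mul]
  have hQ : CoeffNonneg (constPoly (E.dom e) * linPoly E.dom ^ n).trace :=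
    ((E.matCoeffLE_const_dom e).mul (E.matCoeffLE_dom.pow n)).trace.nonneg
  refine (hQ.polyMean_X_mul_le hv hβ e).trans (le_of_eq ?_)
  rw [trace_map_pderiv, trace_map_pderiv, trace_map_pderiv, map_pderiv_three,
    ← insertPoly_zero E.dom e n, map_pderiv_constPoly_mul, zero_add, one_smul,
    Matrix.trace_smul, map_nsmul]
  simp only [nsmul_eq_mul]
  push_cast
  ring

/-- The contraction of the two letters D_e yields the product of traces of the Catalan recursion. As
the matrix is symmetric, the transposed pairing adds tr Y^(n-1), a term of lower order in N. -/
theorem EdgeModel.sum_trace_insert_one (n : ℕ) :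
    ∑ e, (constPoly (E.dom e) * insertPoly E.dom e 1 n).trace
      = ∑ a ∈ Finset.range n, MvPolynomial.C (1 / (N : ℝ)) *
        ((linPoly E.dom ^ a).trace * (linPoly E.dom ^ (n - 1 - a)).trace
          + (linPoly E.dom ^ (n - 1)).trace) := by
  have h1 : ∀ e, (constPoly (E.dom e) * insertPoly E.dom e 1 n).trace
      = ∑ a ∈ Finset.range n, (constPoly (E.dom e) * linPoly E.dom ^ a * constPoly (E.dom e)
        * linPoly E.dom ^ (n - 1 - a)).trace := by
    intro e
    rw [insertPoly, insertSum_succ_eq_sum, Finset.mul_sum, Matrix.trace_sum]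
    refine Finset.sum_congr rfl fun a _ => ?_
    rw [← insertPoly, insertPoly_zero]
    simp only [mul_assoc]
  simp_rw [h1]
  rw [Finset.sum_comm]
  refine Finset.sum_congr rfl fun a ha => ?_
  have h2 : a + (n - 1 - a) = n - 1 := by have := Finset.mem_range.1 ha; omega
  rw [E.dom_cov_poly.sum_trace_mul, E.linPoly_dom_pow_transpose, ← pow_add, h2]
  ring

/-- The mean of a product of traces nearly factorizes. The covariance bound leaves Σ_e of the
product of the two gradients, which contracts to a single trace with weight 2ab/N. -/
theorem EdgeModel.polyMean_trace_mul_trace_le (hv : 0 < v) (hβ : v ≤ β) (a b : ℕ) :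
    polyMean (threePointLaw v β) ((linPoly E.dom ^ a).trace * (linPoly E.dom ^ b).trace)
      ≤ E.domMoment v β a * E.domMoment v β b
        + 2 * a * b * β / N * E.domMoment v β (a + b - 2) := by
  refine ((E.coeffNonneg_trace_pow a).polyMean_mul_le hv hβ (E.coeffNonneg_trace_pow b)).trans
    (le_of_eq ?_)
  rw [← map_sum]
  have h1 : ∑ e, MvPolynomial.pderiv e (linPoly E.dom ^ a).trace
      * MvPolynomial.pderiv e (linPoly E.dom ^ b).trace
      = ((2 * a * b / N : ℝ)) • ((linPoly E.dom ^ (a - 1 + (b - 1))).trace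
        : MvPolynomial ι ℝ) := by
    simp_rw [pderiv_trace_pow, nsmul_eq_mul]
    have h2 : ∀ e, (a : MvPolynomial ι ℝ) * (constPoly (E.dom e) * linPoly E.dom ^ (a - 1)).trace
        * ((b : MvPolynomial ι ℝ) * (constPoly (E.dom e) * linPoly E.dom ^ (b - 1)).trace)
        = ((a : MvPolynomial ι ℝ) * (b : MvPolynomial ι ℝ)) * ((constPoly (E.dom e) * linPoly E.dom ^ (a - 1)).trace
          * (constPoly (E.dom e) * linPoly E.dom ^ (b - 1)).trace) := fun e => by ring
    simp_rw [h2]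
    rw [← Finset.mul_sum, E.dom_cov_poly.sum_trace_mul_trace, E.linPoly_dom_pow_transpose,
      ← pow_add, MvPolynomial.smul_eq_C_mul]
    have h3 : (MvPolynomial.C (2 * (a : ℝ) * b / N) : MvPolynomial ι ℝ)
        = (a : MvPolynomial ι ℝ) * (b : MvPolynomial ι ℝ) * (MvPolynomial.C (1 / (N : ℝ)) + MvPolynomial.C (1 / (N : ℝ))) := by
      rw [← map_add, ← map_natCast (MvPolynomial.C : ℝ →+* MvPolynomial ι ℝ) a,
        ← map_natCast (MvPolynomial.C : ℝ →+* MvPolynomial ι ℝ) b, ← map_mul, ← map_mul]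
      congr 1
      ring
    rw [h3]
    ring
  rw [h1, map_smul, smul_eq_mul]
  change _ + β * ((2 * a * b / N : ℝ) * E.domMoment v β _) = _
  rcases Nat.eq_zero_or_pos a with rfl | ha
  · simp [EdgeModel.domMoment]
  rcases Nat.eq_zero_or_pos b with rfl | hb
  · simp [EdgeModel.domMoment]
  have h4 : a - 1 + (b - 1) = a + b - 2 := by omega
  rw [h4]
  simp only [EdgeModel.domMoment]
  ring

/-- Edges are distinct ordered pairs of indices, so the sum over edges is at most the sum over all
pairs. -/
theorem EdgeModel.sum_src_le {f : Fin N → ℝ} (hf : ∀ i, 0 ≤ f i) :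
    ∑ e, (f (E.src e) + f (E.tgt e)) ≤ 2 * N * ∑ i, f i := by
  have h1 : ∑ e, (f (E.src e) + f (E.tgt e)) ≤ ∑ p : Fin N × Fin N, (f p.1 + f p.2) := by
    have := Finset.sum_map Finset.univ ⟨_, E.inj⟩ (fun p : Fin N × Fin N => f p.1 + f p.2)
    simp only [Function.Embedding.coeFn_mk] at this
    rw [← this]
    exact Finset.sum_le_sum_of_subset_of_nonneg (Finset.subset_univ _)
      fun p _ _ => add_nonneg (hf _) (hf _)
  refine h1.trans (le_of_eq ?_)
  rw [Fintype.sum_prod_type]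
  simp [Finset.sum_add_distrib, ← Finset.mul_sum]
  ring

theorem EdgeModel.abs_dom_le (e : ι) (k l : Fin N) : |E.dom e k l| ≤ Real.sqrt (2 / N) :=
  Real.abs_le_sqrt (E.dom_sq_le e k l)

/-- A pointwise estimate: the entry bound gives tᵐ for each edge, and tᵐ is at most the sum of two
diagonal entries of Yᵐ. The four letters D_e contribute 4/N², the sum over edges returns 2N tr Yᵐ,
so one factor 1/N remains. -/
theorem EdgeModel.sum_insert_three_le (hv : 0 < v) (hβ : v ≤ β) {m : ℕ} (hm : Even m) :
    ∑ e, polyMean (threePointLaw v β)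
        (constPoly (E.dom e) * insertPoly E.dom e 3 (m + 3)).trace
      ≤ 128 * ((m + 3 : ℕ) : ℝ) ^ 3 / N * E.domMoment v β m := by
  have hlaw := threePointLaw_isSymmLaw hv hβ
  rw [← map_sum, EdgeModel.domMoment]
  have hint : ∀ P : MvPolynomial ι ℝ, ∫ x, evalAt x P ∂(Measure.pi fun _ : ι => threePointLaw v β)
      = polyMean (threePointLaw v β) P := fun P => integral_evalAt hlaw P
  rw [← hint, ← hint, ← integral_const_mul]
  refine integral_mono (integrable_evalAt hlaw _) ((integrable_evalAt hlaw _).const_mul _)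
    fun x => ?_
  simp only
  set Y := linMat E.dom x with hY
  have hYh : Y.IsHermitian := linMat_isHermitian E.dom_herm x
  have h1 : evalAt x (∑ e, (constPoly (E.dom e) * insertPoly E.dom e 3 (m + 3)).trace)
      = ∑ e, (E.dom e * insertSum Y (E.dom e) 3 (m + 3)).trace := by
    rw [map_sum]
    refine Finset.sum_congr rfl fun e _ => ?_
    rw [evalAt_trace, Matrix.map_mul, constPoly_map_evalAt, insertPoly_map_evalAt]
  have h2 : evalAt x (linPoly E.dom ^ m).trace = ∑ i, (Y ^ m) i i := by
    rw [Matrix.trace, map_sum]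
    exact Finset.sum_congr rfl fun i _ => evalAt_linPoly_pow _ _ _ _ _
  rw [h1, h2]
  have hterm : ∀ e, (E.dom e * insertSum Y (E.dom e) 3 (m + 3)).trace
      ≤ 64 * ((m + 3 : ℕ) : ℝ) ^ 3 / N ^ 2 * ((Y ^ m) (E.src e) (E.src e)
        + (Y ^ m) (E.tgt e) (E.tgt e)) := by
    intro e
    obtain ⟨t, ht, htn, hta⟩ := hYh.exists_entry_bound hm (E.src e) (E.tgt e)
    have h3 := (E.dom_supp e).abs_trace_mul_insertSum_le (E.abs_dom_le e) ht hta (k := 3)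
      (m := m + 3) le_rfl
    refine (le_abs_self _).trans (h3.trans ?_)
    have h4 : Real.sqrt (2 / N) ^ 4 = 4 / (N : ℝ) ^ 2 := by
      have : Real.sqrt (2 / (N : ℝ)) ^ 2 = 2 / N := Real.sq_sqrt (by positivity)
      calc Real.sqrt (2 / (N : ℝ)) ^ 4 = (Real.sqrt (2 / (N : ℝ)) ^ 2) ^ 2 := by ring
        _ = _ := by rw [this]; ring
    have h5 : m + 3 - 3 = m := by omega
    rw [h5]
    calc 2 * (Real.sqrt (2 / N) * ((2 * ((m + 3 : ℕ) : ℝ) * Real.sqrt (2 / N)) ^ 3 * t ^ m))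
        = 16 * ((m + 3 : ℕ) : ℝ) ^ 3 * Real.sqrt (2 / N) ^ 4 * t ^ m := by ring
      _ = 64 * ((m + 3 : ℕ) : ℝ) ^ 3 / N ^ 2 * t ^ m := by rw [h4]; ring
      _ ≤ _ := by gcongr
  refine (Finset.sum_le_sum fun e _ => hterm e).trans ?_
  rw [← Finset.mul_sum]
  have h6 := E.sum_src_le (f := fun i => (Y ^ m) i i) (fun i => hYh.pow_apply_self_nonneg hm i)
  rcases Nat.eq_zero_or_pos N with hN | hN
  · subst hN; simp
  have hN0 : (0 : ℝ) < N := by exact_mod_cast hN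
  refine (mul_le_mul_of_nonneg_left h6 (by positivity)).trans (le_of_eq ?_)
  field_simp
  ring

/-- The recursion for the mean traces. -/
theorem EdgeModel.domMoment_recursion (hv : 0 < v) (hβ : v ≤ β) (n : ℕ) :
    E.domMoment v β (n + 1) ≤ v / N * ∑ a ∈ Finset.range n,
        (E.domMoment v β a * E.domMoment v β (n - 1 - a)
          + 2 * a * (n - 1 - a : ℕ) * β / N * E.domMoment v β (n - 3) + E.domMoment v β (n - 1))
      + 6 * β ^ 2 * ∑ e, polyMean (threePointLaw v β)
          (constPoly (E.dom e) * insertPoly E.dom e 3 n).trace := by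
  refine (E.domMoment_succ_le hv hβ n).trans (add_le_add_left ?_ _)
  rw [← map_sum, E.sum_trace_insert_one, map_sum, div_mul_eq_mul_div, mul_div_assoc]
  refine mul_le_mul_of_nonneg_left ?_ hv.le
  rw [Finset.sum_div]
  refine Finset.sum_le_sum fun a ha => ?_
  rw [← MvPolynomial.smul_eq_C_mul, map_smul, smul_eq_mul, map_add, one_div, div_eq_inv_mul]
  refine mul_le_mul_of_nonneg_left ?_ (by positivity)
  refine add_le_add ?_ le_rfl
  have h := E.polyMean_trace_mul_trace_le hv hβ a (n - 1 - a)
  have h2 : a + (n - 1 - a) - 2 = n - 3 := by have := Finset.mem_range.1 ha; omega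
  rwa [h2] at h

end TraceMoments

/-! ### Perturbed Catalan recursion. -/

section CatalanBound

theorem sum_range_even_of_odd_eq_zero {f : ℕ → ℝ} (hf : ∀ k, f (2 * k + 1) = 0) (p : ℕ) :
    ∑ a ∈ Finset.range (2 * p + 1), f a = ∑ k ∈ Finset.range (p + 1), f (2 * k) := by
  induction p with
  | zero => simp
  | succ p ih =>
    rw [show 2 * (p + 1) + 1 = 2 * p + 1 + 1 + 1 by ring, Finset.sum_range_succ,
      Finset.sum_range_succ, ih, hf, Finset.sum_range_succ _ (p + 1), add_zero]
    rfl

theorem catalan_succ_eq_sum (p : ℕ) :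
    catalan (p + 1) = ∑ k ∈ Finset.range (p + 1), catalan k * catalan (p - k) := by
  rw [catalan_succ', Finset.Nat.sum_antidiagonal_eq_sum_range_succ fun i j => catalan i * catalan j]

theorem catalan_le_succ (p : ℕ) : catalan p ≤ catalan (p + 1) := by
  rw [catalan_succ_eq_sum]
  have := Finset.single_le_sum (f := fun k => catalan k * catalan (p - k)) (fun _ _ => Nat.zero_le _)
    (Finset.mem_range.2 (Nat.succ_pos p))
  simpa using this

theorem catalan_le_four_pow (p : ℕ) : catalan p ≤ 4 ^ p := by
  have h1 := succ_mul_catalan_eq_centralBinom p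
  have h2 : p.centralBinom ≤ 2 ^ (2 * p) := Nat.choose_le_two_pow _ _
  rw [pow_mul] at h2
  have h3 : catalan p ≤ (p + 1) * catalan p := Nat.le_mul_of_pos_left _ (Nat.succ_pos p)
  norm_num at h2
  omega

variable {N : ℕ} {ι : Type} [Fintype ι] [DecidableEq ι] (E : EdgeModel N ι) {v β : ℝ}

/-- Odd mean traces vanish, so only even indices remain. The error term is absent for p = 0: the
covariance weights vanish and no word of one letter has three insertions. -/
theorem EdgeModel.domMoment_even_succ_le (hv : 0 < v) (hβ : v ≤ β) (hN : 0 < N) (p : ℕ) :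
    E.domMoment v β (2 * (p + 1)) ≤ v / N * ∑ k ∈ Finset.range (p + 1),
        E.domMoment v β (2 * k) * E.domMoment v β (2 * (p - k))
      + 2 * (p + 1) * v / N * E.domMoment v β (2 * p)
      + (if p = 0 then 0 else
        6160 * β ^ 2 * (p + 1) ^ 3 / N * E.domMoment v β (2 * (p - 1))) := by
  have hN0 : (0 : ℝ) < N := by exact_mod_cast hN
  have hN1 : (1 : ℝ) ≤ N := by exact_mod_cast hN
  have hβ0 : 0 < β := hv.trans_le hβ
  have hnn := E.domMoment_nonneg hv hβ
  have h := E.domMoment_recursion hv hβ (2 * p + 1)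
  have hsimp : 2 * p + 1 - 1 = 2 * p := by omega
  rw [show 2 * p + 1 + 1 = 2 * (p + 1) by ring, hsimp] at h
  simp only [Finset.sum_add_distrib, Finset.sum_const, Finset.card_range, nsmul_eq_mul] at h
  have h1 : ∑ a ∈ Finset.range (2 * p + 1), E.domMoment v β a * E.domMoment v β (2 * p - a)
      = ∑ k ∈ Finset.range (p + 1), E.domMoment v β (2 * k) * E.domMoment v β (2 * (p - k)) := by
    rw [sum_range_even_of_odd_eq_zero fun k => by
      rw [E.domMoment_odd hv hβ ⟨k, rfl⟩, zero_mul]]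
    refine Finset.sum_congr rfl fun k _ => ?_
    rw [Nat.mul_sub]
  rw [h1] at h
  refine h.trans ?_
  have h3 : v / N * (((2 * p + 1 : ℕ) : ℝ) * E.domMoment v β (2 * p))
      ≤ 2 * (p + 1) * v / N * E.domMoment v β (2 * p) := by
    have : ((2 * p + 1 : ℕ) : ℝ) ≤ 2 * (p + 1) := by push_cast; linarith
    calc v / N * (((2 * p + 1 : ℕ) : ℝ) * E.domMoment v β (2 * p))
        ≤ v / N * ((2 * (p + 1)) * E.domMoment v β (2 * p)) := by
          have := hnn (2 * p); gcongr
      _ = _ := by ring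
  have h4 : v / N * (∑ a ∈ Finset.range (2 * p + 1), 2 * (a : ℝ) * ((2 * p - a : ℕ) : ℝ) * β / N
        * E.domMoment v β (2 * p + 1 - 3))
      + 6 * β ^ 2 * ∑ e, polyMean (threePointLaw v β)
          (constPoly (E.dom e) * insertPoly E.dom e 3 (2 * p + 1)).trace
      ≤ (if p = 0 then 0 else
        6160 * β ^ 2 * (p + 1) ^ 3 / N * E.domMoment v β (2 * (p - 1))) := by
    rcases Nat.eq_zero_or_pos p with rfl | hp
    · have : ∀ e, insertPoly E.dom e 3 (2 * 0 + 1) = 0 := fun e =>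
        insertSum_eq_zero _ _ (by norm_num)
      simp [this]
    · obtain ⟨q, rfl⟩ := Nat.exists_eq_add_of_le hp
      rw [if_neg (by omega)]
      have e1 : 2 * (1 + q) + 1 - 3 = 2 * q := by omega
      have e2 : 1 + q - 1 = q := by omega
      have e3 : 2 * (1 + q) + 1 = 2 * q + 3 := by ring
      rw [e1, e2]
      have hT := hnn (2 * q)
      set T := E.domMoment v β (2 * q) with hTd
      have h5 : ∑ a ∈ Finset.range (2 * (1 + q) + 1),
          2 * (a : ℝ) * ((2 * (1 + q) - a : ℕ) : ℝ) * β / N * T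
          ≤ 16 * ((1 + q : ℕ) + 1 : ℝ) ^ 3 * β / N * T := by
        have h6 : ∀ a ∈ Finset.range (2 * (1 + q) + 1),
            2 * (a : ℝ) * ((2 * (1 + q) - a : ℕ) : ℝ) * β / N * T
            ≤ 2 * (2 * ((1 + q : ℕ) + 1 : ℝ)) * (2 * ((1 + q : ℕ) + 1 : ℝ)) * β / N * T := by
          intro a ha
          have ha' := Finset.mem_range.1 ha
          have h7 : (a : ℝ) ≤ 2 * ((1 + q : ℕ) + 1 : ℝ) := by
            exact_mod_cast (by omega : a ≤ 2 * ((1 + q) + 1))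
          have h8 : ((2 * (1 + q) - a : ℕ) : ℝ) ≤ 2 * ((1 + q : ℕ) + 1 : ℝ) := by
            exact_mod_cast (by omega : 2 * (1 + q) - a ≤ 2 * ((1 + q) + 1))
          gcongr
        refine (Finset.sum_le_sum h6).trans ?_
        rw [Finset.sum_const, Finset.card_range, nsmul_eq_mul]
        have h9 : ((2 * (1 + q) + 1 : ℕ) : ℝ) ≤ 2 * ((1 + q : ℕ) + 1 : ℝ) := by
          push_cast; linarith
        refine (mul_le_mul_of_nonneg_right h9 (by positivity)).trans (le_of_eq ?_)
        ring
      have h6 := E.sum_insert_three_le hv hβ (even_two_mul q)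
      rw [e3]
      have h7 : ((2 * q + 3 : ℕ) : ℝ) ≤ 2 * ((1 + q : ℕ) + 1 : ℝ) := by push_cast; linarith
      have h8 : v / N ≤ β := by
        rw [div_le_iff₀ hN0]; nlinarith
      rw [e3] at h5
      -- The covariance error and the third-order error are merged: 6160 = 16 + 6 · 128 · 2³.
      calc _ ≤ β * (16 * ((1 + q : ℕ) + 1 : ℝ) ^ 3 * β / N * T)
            + 6 * β ^ 2 * (128 * (2 * ((1 + q : ℕ) + 1 : ℝ)) ^ 3 / N * T) := by
            refine add_le_add (mul_le_mul h8 h5 ?_ hβ0.le)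
              (mul_le_mul_of_nonneg_left (h6.trans ?_) (by positivity))
            · exact Finset.sum_nonneg fun a _ => by positivity
            · gcongr
        _ = _ := by ring
  rw [mul_add, mul_add]
  linarith

/-- The mean traces of the powers of the dominating matrix are at most those of a semicircular
law of slightly larger variance. -/
theorem EdgeModel.domMoment_le_catalan (hv : 0 < v) (hβ : v ≤ β) (hN : 0 < N) {P : ℕ} {r : ℝ}
    (hr : v + 2 * P * v / N + 6160 * β ^ 2 * P ^ 3 / (N * v) ≤ r) :
    ∀ p ≤ P, E.domMoment v β (2 * p) ≤ N * catalan p * r ^ p := by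
  have hN0 : (0 : ℝ) < N := by exact_mod_cast hN
  have hβ0 : 0 < β := hv.trans_le hβ
  have hnn := E.domMoment_nonneg hv hβ
  have hvr : v ≤ r := by
    have h1 : 0 ≤ 2 * P * v / N := by positivity
    have h2 : 0 ≤ 6160 * β ^ 2 * P ^ 3 / (N * v) := by positivity
    linarith
  have hr0 : 0 < r := hv.trans_le hvr
  intro p
  induction p using Nat.strong_induction_on with
  | _ p ih =>
  intro hp
  rcases Nat.eq_zero_or_pos p with rfl | hp0
  · simp [E.domMoment_zero hv hβ]
  obtain ⟨q, rfl⟩ : ∃ q, p = q + 1 := ⟨p - 1, by omega⟩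
  refine (E.domMoment_even_succ_le hv hβ hN q).trans ?_
  have hqP : (q : ℝ) + 1 ≤ P := by exact_mod_cast hp
  have hc : (catalan q : ℝ) ≤ catalan (q + 1) := by exact_mod_cast catalan_le_succ q
  -- The main term: the convolution of Catalan numbers is the next one, so it reproduces the claimed
  -- bound with v in place of one factor r. The two error terms supply the rest of r.
  have h1 : v / N * ∑ k ∈ Finset.range (q + 1),
        E.domMoment v β (2 * k) * E.domMoment v β (2 * (q - k))
      ≤ v * (N * catalan (q + 1) * r ^ q) := by
    have h2 : ∑ k ∈ Finset.range (q + 1),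
        E.domMoment v β (2 * k) * E.domMoment v β (2 * (q - k))
        ≤ N ^ 2 * catalan (q + 1) * r ^ q := by
      rw [catalan_succ_eq_sum]
      push_cast
      rw [Finset.mul_sum, Finset.sum_mul]
      refine Finset.sum_le_sum fun k hk => ?_
      have hk' := Finset.mem_range.1 hk
      have h3 : r ^ q = r ^ k * r ^ (q - k) := by rw [← pow_add]; congr 1; omega
      refine (mul_le_mul (ih k (by omega) (by omega)) (ih (q - k) (by omega) (by omega)) (hnn _)
        (by positivity)).trans (le_of_eq ?_)
      rw [h3]; ring
    refine (mul_le_mul_of_nonneg_left h2 (by positivity)).trans (le_of_eq ?_)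
    field_simp
  have h2 : 2 * (q + 1) * v / N * E.domMoment v β (2 * q)
      ≤ 2 * P * v / N * (N * catalan (q + 1) * r ^ q) := by
    have h3 := ih q (by omega) (by omega)
    have h4 := hnn (2 * q)
    calc 2 * (q + 1) * v / N * E.domMoment v β (2 * q)
        ≤ 2 * P * v / N * (N * catalan q * r ^ q) := by gcongr
      _ ≤ _ := by gcongr
  -- The trace of index q - 1 has one power of r too few; inserting v ≤ r restores it, which
  -- explains the division by v in the condition on r.
  have h3 : (if q = 0 then 0 else
        6160 * β ^ 2 * (q + 1) ^ 3 / N * E.domMoment v β (2 * (q - 1)))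
      ≤ 6160 * β ^ 2 * P ^ 3 / (N * v) * (N * catalan (q + 1) * r ^ q) := by
    split_ifs with hq
    · positivity
    · obtain ⟨s, rfl⟩ : ∃ s, q = s + 1 := ⟨q - 1, by omega⟩
      have h4 := ih s (by omega) (by omega)
      have h5 : (catalan s : ℝ) ≤ catalan (s + 1 + 1) := by
        exact_mod_cast (catalan_le_succ s).trans (catalan_le_succ (s + 1))
      have h6 := hnn (2 * s)
      rw [Nat.add_sub_cancel]
      calc 6160 * β ^ 2 * (((s + 1 : ℕ) : ℝ) + 1) ^ 3 / N * E.domMoment v β (2 * s)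
          ≤ 6160 * β ^ 2 * P ^ 3 / N * (N * catalan (s + 1 + 1) * r ^ s) := by
            refine mul_le_mul (by gcongr) (h4.trans (by gcongr)) h6 (by positivity)
        _ = 6160 * β ^ 2 * P ^ 3 / (N * v) * (N * catalan (s + 1 + 1) * (r ^ s * v)) := by
            field_simp
        _ ≤ 6160 * β ^ 2 * P ^ 3 / (N * v) * (N * catalan (s + 1 + 1) * (r ^ s * r)) := by gcongr
        _ = _ := by rw [pow_succ r s]
  calc _ ≤ v * (N * catalan (q + 1) * r ^ q) + 2 * P * v / N * (N * catalan (q + 1) * r ^ q)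
        + 6160 * β ^ 2 * P ^ 3 / (N * v) * (N * catalan (q + 1) * r ^ q) :=
        add_le_add (add_le_add h1 h2) h3
    _ = (v + 2 * P * v / N + 6160 * β ^ 2 * P ^ 3 / (N * v)) * (N * catalan (q + 1) * r ^ q) := by
        ring
    _ ≤ r * (N * catalan (q + 1) * r ^ q) := by gcongr
    _ = _ := by rw [pow_succ]; ring

theorem EdgeModel.domMoment_le (hv : 0 < v) (hβ : v ≤ β) (hN : 0 < N) {p : ℕ} {r : ℝ}
    (hr : v + 2 * p * v / N + 6160 * β ^ 2 * p ^ 3 / (N * v) ≤ r) :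
    E.domMoment v β (2 * p) ≤ N * (4 * r) ^ p := by
  refine (E.domMoment_le_catalan hv hβ hN hr p le_rfl).trans ?_
  have hβ0 : 0 < β := hv.trans_le hβ
  have hr0 : 0 ≤ r := by
    have h1 : 0 ≤ 2 * p * v / N := by positivity
    have h2 : 0 ≤ 6160 * β ^ 2 * p ^ 3 / (N * v) := by positivity
    linarith
  have h1 : (catalan p : ℝ) ≤ 4 ^ p := by exact_mod_cast catalan_le_four_pow p
  rw [mul_pow, mul_assoc]
  gcongr

end CatalanBound

/-! ### From trace moments to moments of the operator norm. -/

section NormMoments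

set_option linter.unusedSectionVars false

open scoped Matrix.Norms.L2Operator

/-- The norm is the largest |eigenvalue|, and the trace of an even power is a sum of nonnegative
terms containing its power. -/
theorem Matrix.IsHermitian.norm_pow_le_trace {N : ℕ} (hN : 0 < N) {X : Matrix (Fin N) (Fin N) ℂ}
    (hX : X.IsHermitian) (p : ℕ) : ‖X‖ ^ (2 * p) ≤ ((X ^ (2 * p)).trace).re := by
  have hne : Nonempty (Fin N) := ⟨⟨0, hN⟩⟩
  have h0 := hX.spectral_theorem
  set U := hX.eigenvectorUnitary with hU
  have h := h0
  rw [Unitary.conjStarAlgAut_apply] at h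
  have h1 : ‖X‖ = ‖(fun i => (hX.eigenvalues i : ℂ) : Fin N → ℂ)‖ := by
    conv_lhs => rw [h]
    rw [← Unitary.coe_star, CStarRing.norm_mul_coe_unitary, CStarRing.norm_coe_unitary_mul,
      Matrix.l2_opNorm_diagonal]
    rfl
  have h2 : (X ^ (2 * p)).trace = ∑ i, ((hX.eigenvalues i ^ (2 * p) : ℝ) : ℂ) := by
    have h3 : X ^ (2 * p) = (U : Matrix (Fin N) (Fin N) ℂ)
        * Matrix.diagonal (fun m => ((hX.eigenvalues m ^ (2 * p) : ℝ) : ℂ))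
        * star (U : Matrix (Fin N) (Fin N) ℂ) := by
      conv_lhs => rw [h0]
      rw [← map_pow, Matrix.diagonal_pow, Unitary.conjStarAlgAut_apply]
      congr 3
      ext i
      simp
    rw [h3, Matrix.trace_mul_comm, ← mul_assoc, Unitary.coe_star_mul_self, one_mul,
      Matrix.trace_diagonal]
  obtain ⟨i, hi⟩ := Finite.exists_max fun i => ‖(hX.eigenvalues i : ℂ)‖
  have h4 : ‖X‖ ≤ |hX.eigenvalues i| := by
    rw [h1]
    refine (pi_norm_le_iff_of_nonneg (abs_nonneg _)).2 fun j => ?_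
    simpa using hi j
  calc ‖X‖ ^ (2 * p) ≤ |hX.eigenvalues i| ^ (2 * p) := by gcongr
    _ = hX.eigenvalues i ^ (2 * p) := (even_two_mul p).pow_abs _
    _ ≤ ∑ i, hX.eigenvalues i ^ (2 * p) :=
        Finset.single_le_sum (f := fun i => hX.eigenvalues i ^ (2 * p))
          (fun j _ => (even_two_mul p).pow_nonneg _) (Finset.mem_univ i)
    _ = _ := by rw [h2, ← Complex.ofReal_sum, Complex.ofReal_re]

variable {N : ℕ} {ι : Type} [Fintype ι] [DecidableEq ι] (E : EdgeModel N ι) {v β : ℝ}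
  {μ : Measure ℝ}

theorem continuous_linMat (A : ι → Matrix (Fin N) (Fin N) ℂ) : Continuous (linMat A) := by
  unfold linMat
  refine continuous_finsetSum _ fun e _ => ?_
  exact ((RCLike.continuous_ofReal (K := ℂ)).comp
    (continuous_apply (A := fun _ : ι => ℝ) e)).smul continuous_const

theorem EdgeModel.norm_pow_le (hN : 0 < N) (x : ι → ℝ) (p : ℕ) :
    ‖linMat E.mat x‖ ^ (2 * p) ≤ (evalAt x (linPoly E.mat ^ (2 * p)).trace).re := by
  rw [evalAt_trace, Matrix.map_pow, linPoly_map_evalAt]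
  exact (linMat_isHermitian E.mat_herm x).norm_pow_le_trace hN p

theorem EdgeModel.integrable_norm_pow_even (h : IsSymmLaw μ) (hN : 0 < N) (p : ℕ) :
    Integrable (fun x => ‖linMat E.mat x‖ ^ (2 * p)) (Measure.pi fun _ : ι => μ) := by
  refine (integrable_evalAt h (linPoly E.mat ^ (2 * p)).trace).re.mono'
    ((continuous_linMat E.mat).norm.pow _).aestronglyMeasurable (Eventually.of_forall fun x => ?_)
  rw [Real.norm_of_nonneg (by positivity)]
  exact E.norm_pow_le hN x p

theorem EdgeModel.integral_norm_pow_even_le (hv : 0 < v) (hβ : v ≤ β) (hN : 0 < N) {p : ℕ}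
    (hμ : MomentsLE μ v β (2 * p)) :
    ∫ x, ‖linMat E.mat x‖ ^ (2 * p) ∂(Measure.pi fun _ : ι => μ) ≤ E.domMoment v β (2 * p) := by
  have hint := integrable_evalAt hμ.law (linPoly E.mat ^ (2 * p)).trace
  calc ∫ x, ‖linMat E.mat x‖ ^ (2 * p) ∂(Measure.pi fun _ : ι => μ)
      ≤ ∫ x, (evalAt x (linPoly E.mat ^ (2 * p)).trace).re ∂(Measure.pi fun _ : ι => μ) :=
        integral_mono (E.integrable_norm_pow_even hμ.law hN p) hint.re
          fun x => E.norm_pow_le hN x p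
    _ = (polyMean μ (linPoly E.mat ^ (2 * p)).trace).re := by
        rw [← integral_evalAt hμ.law]; exact integral_re hint
    _ ≤ ‖polyMean μ (linPoly E.mat ^ (2 * p)).trace‖ := Complex.re_le_norm _
    _ ≤ _ := (E.matCoeffLE_mat.pow (2 * p)).trace.norm_polyMean_le hv hβ hμ
        (MvPolynomial.totalDegree_finsetSum_le fun i _ => totalDegree_linPoly_pow _ _ _ _)

theorem EdgeModel.integrable_norm_pow (h : IsSymmLaw μ) (hN : 0 < N) (k : ℕ) :
    Integrable (fun x => ‖linMat E.mat x‖ ^ k) (Measure.pi fun _ : ι => μ) := by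
  have := h.prob
  refine ((integrable_const (1 : ℝ)).add (E.integrable_norm_pow_even h hN k)).mono'
    ((continuous_linMat E.mat).norm.pow _).aestronglyMeasurable (Eventually.of_forall fun x => ?_)
  rw [Real.norm_of_nonneg (by positivity)]
  simp only [Pi.add_apply]
  rw [mul_comm, pow_mul]
  nlinarith [sq_nonneg (‖linMat E.mat x‖ ^ k - 1), sq_nonneg (‖linMat E.mat x‖ ^ k)]

/-- Converts a bound of order n on the mean of z² into a bound of order √n on the mean of z. -/
theorem le_sqrt_mul_one_add {n : ℝ} (hn : 0 < n) (z : ℝ) : z ≤ Real.sqrt n * (1 + z ^ 2 / n) := by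
  have h1 := Real.sqrt_pos.2 hn
  have h2 : Real.sqrt n * (1 + z ^ 2 / n) - z
      = Real.sqrt n * ((z / Real.sqrt n - 1 / 2) ^ 2 + 3 / 4) := by
    have h3 : z ^ 2 / n = (z / Real.sqrt n) ^ 2 := by rw [div_pow, Real.sq_sqrt hn.le]
    rw [h3]
    field_simp
    ring
  have : 0 ≤ Real.sqrt n * ((z / Real.sqrt n - 1 / 2) ^ 2 + 3 / 4) := by positivity
  linarith

end NormMoments

/-! ### Moment bounds for the norm at fixed order, uniform in the model. -/

section EntryLawMoments

variable {μ : Measure ℝ} {σ : ℝ}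

theorem IsEntryLaw.exists_momentsLE (h : IsEntryLaw μ σ) (hσ : 0 < σ) :
    ∃ C : ℝ, 0 < C ∧ ∀ p : ℕ, MomentsLE μ (σ ^ 2) (C * (p : ℝ) ^ 2 + σ ^ 2) (2 * p) := by
  obtain ⟨C, hC, hg⟩ := h.moment_growth
  have := h.isProbabilityMeasure
  refine ⟨C, hC, fun p => ⟨h.isSymmLaw, h.rawMoment_two, fun n hn => ?_⟩⟩
  have hv : 0 < σ ^ 2 := by positivity
  have hβ : σ ^ 2 ≤ C * (p : ℝ) ^ 2 + σ ^ 2 := by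
    have : 0 ≤ C * (p : ℝ) ^ 2 := by positivity
    linarith
  rcases Nat.even_or_odd' n with ⟨k, rfl | rfl⟩
  · rcases k with _ | k
    · rw [mul_zero, threePointLaw_moment_zero hv hβ, rawMoment_zero]
    · rw [threePointLaw_moment_even hv hβ]
      exact hg p k (by omega)
  · rw [rawMoment_odd h.symmetric ⟨k, rfl⟩]
    exact threePointLaw_moment_nonneg _

theorem EdgeModel.exists_domMoment_le {v β : ℝ} (hv : 0 < v) (hβ : v ≤ β) (p : ℕ) :
    ∃ K : ℝ, 0 ≤ K ∧ ∀ N : ℕ, 0 < N → ∀ (ι : Type) [Fintype ι] [DecidableEq ι]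
      (E : EdgeModel N ι), E.domMoment v β (2 * p) ≤ K * N := by
  have hβ0 : 0 < β := hv.trans_le hβ
  refine ⟨(4 * (v + 2 * p * v + 6160 * β ^ 2 * p ^ 3 / v)) ^ p, by positivity,
    fun N hN ι _ _ E => ?_⟩
  have hN1 : (1 : ℝ) ≤ N := by exact_mod_cast hN
  refine (E.domMoment_le hv hβ hN (p := p) ?_).trans (le_of_eq (mul_comm _ _))
  refine add_le_add (add_le_add le_rfl ?_) ?_
  · exact div_le_self (by positivity) hN1
  · rw [mul_comm (N : ℝ), ← div_div]
    exact div_le_self (by positivity) hN1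

open scoped Matrix.Norms.L2Operator in
-- The mean of the 2k-th power is O(N) by the trace bound, hence that of the k-th power is O(√N).
-- The loss of √N is harmless: the fourth central moments gain N⁻², and N^(-3/2) is summable.
theorem IsEntryLaw.exists_norm_pow_le (h : IsEntryLaw μ σ) (hσ : 0 < σ) (k : ℕ) :
    ∃ K : ℝ, 0 ≤ K ∧ ∀ N : ℕ, 0 < N → ∀ (ι : Type) [Fintype ι] [DecidableEq ι]
      (E : EdgeModel N ι),
      ∫ x, ‖linMat E.mat x‖ ^ k ∂(Measure.pi fun _ : ι => μ) ≤ K * Real.sqrt N := by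
  obtain ⟨C, hC, hM⟩ := h.exists_momentsLE hσ
  have hv : 0 < σ ^ 2 := by positivity
  have hβ : σ ^ 2 ≤ C * (k : ℝ) ^ 2 + σ ^ 2 := by
    have : 0 ≤ C * (k : ℝ) ^ 2 := by positivity
    linarith
  obtain ⟨K, hK, hb⟩ := EdgeModel.exists_domMoment_le hv hβ k
  refine ⟨1 + K, by positivity, fun N hN ι _ _ E => ?_⟩
  have := h.isProbabilityMeasure
  have hN0 : (0 : ℝ) < N := by exact_mod_cast hN
  have hint := E.integrable_norm_pow_even h.isSymmLaw hN k
  calc ∫ x, ‖linMat E.mat x‖ ^ k ∂(Measure.pi fun _ : ι => μ)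
      ≤ ∫ x, Real.sqrt N * (1 + ‖linMat E.mat x‖ ^ (2 * k) / N) ∂(Measure.pi fun _ : ι => μ) := by
        refine integral_mono (E.integrable_norm_pow h.isSymmLaw hN k)
          (((integrable_const _).add (hint.div_const _)).const_mul _) fun x => ?_
        rw [mul_comm 2 k, pow_mul]
        exact le_sqrt_mul_one_add hN0 _
    _ = Real.sqrt N * (1 + (∫ x, ‖linMat E.mat x‖ ^ (2 * k) ∂(Measure.pi fun _ : ι => μ)) / N) := by
        rw [integral_const_mul, integral_add (integrable_const _) (hint.div_const _),
          integral_div]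
        simp
    _ ≤ Real.sqrt N * (1 + K) := by
        gcongr
        rw [div_le_iff₀ hN0]
        exact (E.integral_norm_pow_even_le hv hβ hN (hM k)).trans (hb N hN ι E)
    _ = _ := mul_comm _ _

end EntryLawMoments

/-! ### Tail of the operator norm. -/

section NormTail

/-- Take p of order c log N with c = 3/(-log ρ), so that ρ^p ≤ N⁻³. The seventh power is what the
trace bound requires: the error β² p³/N with β of order p². -/
theorem exists_log_exponent {ρ : ℝ} (hρ : 0 < ρ) (hρ1 : ρ < 1) :
    ∃ p : ℕ → ℕ, (∀ᶠ N : ℕ in atTop, 1 ≤ p N ∧ (N : ℝ) * ρ ^ p N ≤ 1 / (N : ℝ) ^ 2) ∧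
      Tendsto (fun N : ℕ => (p N : ℝ) ^ 7 / N) atTop (nhds 0) := by
  have hl : Real.log ρ < 0 := Real.log_neg hρ hρ1
  set c : ℝ := 3 / (-Real.log ρ) with hc
  have hc0 : 0 < c := by have := neg_pos.2 hl; positivity
  refine ⟨fun N => ⌈c * Real.log N⌉₊, ?_, ?_⟩
  · filter_upwards [eventually_ge_atTop 2] with N hN
    have hN1 : (1 : ℝ) < N := by exact_mod_cast hN
    have hN0 : (0 : ℝ) < N := by linarith
    have hlog : 0 < Real.log N := Real.log_pos hN1
    refine ⟨Nat.one_le_ceil_iff.2 (by positivity), ?_⟩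
    have h1 : ρ ^ ⌈c * Real.log N⌉₊ ≤ (N : ℝ) ^ (-3 : ℤ) := by
      rw [← Real.exp_log (pow_pos hρ _), ← Real.exp_log (zpow_pos hN0 (-3)), Real.log_pow,
        Real.log_zpow]
      refine Real.exp_le_exp.2 ?_
      have h2 := Nat.le_ceil (c * Real.log N)
      have h3 : c * Real.log ρ = -3 := by rw [hc, div_neg, neg_mul, div_mul_cancel₀ _ hl.ne]
      push_cast
      nlinarith
    refine (mul_le_mul_of_nonneg_left h1 hN0.le).trans (le_of_eq ?_)
    rw [zpow_neg]
    norm_cast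
    field_simp
    push_cast
    ring
  · have h1 : Tendsto (fun N : ℕ => (c + 1) ^ 7 * (Real.log N ^ 7 / N)) atTop (nhds 0) := by
      have h2 := (Real.isLittleO_pow_log_id_atTop (n := 7)).tendsto_div_nhds_zero
      have h3 := (h2.comp tendsto_natCast_atTop_atTop).const_mul ((c + 1) ^ 7)
      simpa using h3
    refine squeeze_zero' (Eventually.of_forall fun N => by positivity) ?_ h1
    filter_upwards [eventually_ge_atTop 3] with N hN
    have hN1 : (3 : ℝ) ≤ N := by exact_mod_cast hN
    have hlog : 1 ≤ Real.log N := by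
      rw [Real.le_log_iff_exp_le (by linarith)]
      linarith [Real.exp_one_lt_d9]
    have h2 : (⌈c * Real.log N⌉₊ : ℝ) ≤ (c + 1) * Real.log N := by
      have := (Nat.ceil_lt_add_one (a := c * Real.log N) (by positivity)).le
      linarith
    rw [← mul_div_assoc, ← mul_pow]
    gcongr

variable {μ : Measure ℝ} {σ : ℝ}

open scoped Matrix.Norms.L2Operator in
-- Markov's inequality at order 2q with q ~ log N: the bound is N (b/a)^(2q) with b < a, and the
-- growth of β with q is compensated by q⁷/N → 0.
theorem IsEntryLaw.norm_tail (h : IsEntryLaw μ σ) (hσ : 0 < σ) {δ : ℝ} (hδ : 0 < δ) :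
    ∀ᶠ N : ℕ in atTop, ∀ (ι : Type) [Fintype ι] [DecidableEq ι] (E : EdgeModel N ι),
      (Measure.pi fun _ : ι => μ).real {x | 2 * σ + δ ≤ ‖linMat E.mat x‖} ≤ 1 / (N : ℝ) ^ 2 := by
  obtain ⟨C, hC, hM⟩ := h.exists_momentsLE hσ
  have hprob := h.isProbabilityMeasure
  set b := 2 * σ + δ / 2 with hb
  set a := 2 * σ + δ with ha
  have ha0 : 0 < a := by positivity
  have hb0 : 0 < b := by positivity
  have hba : b < a := by rw [hb, ha]; linarith
  obtain ⟨p, hp, hlim⟩ := exists_log_exponent (ρ := (b / a) ^ 2) (by positivity)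
    (pow_lt_one₀ (by positivity) ((div_lt_one ha0).2 hba) two_ne_zero)
  -- The admissible excess of r over σ²: 4(σ² + τ) = b².
  set τ := b ^ 2 / 4 - σ ^ 2 with hτ
  have hτ0 : 0 < τ := by rw [hτ, hb]; nlinarith [mul_pos hσ hδ]
  set D := 2 * σ ^ 2 + 6160 * (C + σ ^ 2) ^ 2 / σ ^ 2 with hD
  have hlim2 : Tendsto (fun N : ℕ => D * ((p N : ℝ) ^ 7 / N)) atTop (nhds 0) := by
    simpa using hlim.const_mul D
  filter_upwards [hp, hlim2.eventually_lt_const hτ0, eventually_gt_atTop 0]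
    with N ⟨hp1, hpN⟩ hτN hN ι _ _ E
  have hN0 : (0 : ℝ) < N := by exact_mod_cast hN
  obtain ⟨q, hq⟩ : ∃ q, q = p N := ⟨_, rfl⟩
  rw [← hq] at hp1 hpN hτN
  have hq1 : (1 : ℝ) ≤ q := by exact_mod_cast hp1
  have hv : 0 < σ ^ 2 := by positivity
  have hβ : σ ^ 2 ≤ C * (q : ℝ) ^ 2 + σ ^ 2 := by
    have : 0 ≤ C * (q : ℝ) ^ 2 := by positivity
    linarith
  have hr : σ ^ 2 + 2 * q * σ ^ 2 / N + 6160 * (C * (q : ℝ) ^ 2 + σ ^ 2) ^ 2 * q ^ 3 / (N * σ ^ 2)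
      ≤ σ ^ 2 + τ := by
    have h1 : 2 * q * σ ^ 2 / N ≤ 2 * σ ^ 2 * ((q : ℝ) ^ 7 / N) := by
      rw [← mul_div_assoc]
      refine div_le_div_of_nonneg_right ?_ hN0.le
      have : (q : ℝ) ≤ q ^ 7 := le_self_pow₀ hq1 (by norm_num)
      nlinarith
    have h2 : 6160 * (C * (q : ℝ) ^ 2 + σ ^ 2) ^ 2 * q ^ 3 / (N * σ ^ 2)
        ≤ 6160 * (C + σ ^ 2) ^ 2 / σ ^ 2 * ((q : ℝ) ^ 7 / N) := by
      have h3 : C * (q : ℝ) ^ 2 + σ ^ 2 ≤ (C + σ ^ 2) * q ^ 2 := by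
        have : (1 : ℝ) ≤ q ^ 2 := one_le_pow₀ hq1
        nlinarith
      calc 6160 * (C * (q : ℝ) ^ 2 + σ ^ 2) ^ 2 * q ^ 3 / (N * σ ^ 2)
          ≤ 6160 * ((C + σ ^ 2) * q ^ 2) ^ 2 * q ^ 3 / (N * σ ^ 2) := by gcongr
        _ = _ := by field_simp
    have h4 : D * ((q : ℝ) ^ 7 / N) = 2 * σ ^ 2 * ((q : ℝ) ^ 7 / N)
        + 6160 * (C + σ ^ 2) ^ 2 / σ ^ 2 * ((q : ℝ) ^ 7 / N) := by rw [hD]; ring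
    linarith
  have h5 := (E.integral_norm_pow_even_le hv hβ hN (hM q)).trans (E.domMoment_le hv hβ hN hr)
  have h6 := mul_meas_ge_le_integral_of_nonneg (μ := Measure.pi fun _ : ι => μ)
    (Eventually.of_forall fun x => by positivity)
    (E.integrable_norm_pow_even h.isSymmLaw hN q) (a ^ (2 * q))
  have h7 : {x : ι → ℝ | a ≤ ‖linMat E.mat x‖}
      ⊆ {x | a ^ (2 * q) ≤ ‖linMat E.mat x‖ ^ (2 * q)} := fun x hx => by
    have hx' : a ≤ ‖linMat E.mat x‖ := hx
    exact pow_le_pow_left₀ ha0.le hx' _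
  refine (measureReal_mono h7).trans ?_
  have h8 : 4 * (σ ^ 2 + τ) = b ^ 2 := by rw [hτ]; ring
  rw [h8, ← pow_mul] at h5
  have h9 : (N : ℝ) * ((b / a) ^ 2) ^ q * a ^ (2 * q) = N * b ^ (2 * q) := by
    rw [← pow_mul, div_pow]; field_simp
  have h10 : 0 < a ^ (2 * q) := by positivity
  refine le_trans ?_ hpN
  rw [← mul_le_mul_iff_left₀ h10, h9]
  linarith

end NormTail

/-! ### Fourth central moments from the Poincaré inequality. -/

section FourthMoment

set_option linter.unusedSectionVars false

variable {ι : Type} [Fintype ι] [DecidableEq ι]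

theorem pderiv_conjPoly (e : ι) (P : MvPolynomial ι ℂ) :
    MvPolynomial.pderiv e (conjPoly P) = conjPoly (MvPolynomial.pderiv e P) := by
  rw [conjPoly, MvPolynomial.pderiv_map]

/-- The squared length of the gradient of a polynomial at a point. -/
noncomputable def gradSq (P : MvPolynomial ι ℂ) (x : ι → ℝ) : ℝ :=
  ∑ e, ‖evalAt x (MvPolynomial.pderiv e P)‖ ^ 2

theorem gradSq_nonneg (P : MvPolynomial ι ℂ) (x : ι → ℝ) : 0 ≤ gradSq P x :=
  Finset.sum_nonneg fun _ _ => by positivity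

theorem evalAt_gradSq (P : MvPolynomial ι ℂ) (x : ι → ℝ) :
    evalAt x (∑ e, MvPolynomial.pderiv e P * conjPoly (MvPolynomial.pderiv e P))
      = ((gradSq P x : ℝ) : ℂ) := by
  rw [map_sum, gradSq, Complex.ofReal_sum]
  exact Finset.sum_congr rfl fun e _ => evalAt_mul_conjPoly x _

variable {μ : Measure ℝ}

theorem integrable_gradSq (h : IsSymmLaw μ) (P : MvPolynomial ι ℂ) :
    Integrable (gradSq P) (Measure.pi fun _ : ι => μ) :=
  integrable_finsetSum _ fun _ _ => integrable_norm_sq_evalAt h _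

theorem integrable_gradSq_sq (h : IsSymmLaw μ) (P : MvPolynomial ι ℂ) :
    Integrable (fun x => gradSq P x ^ 2) (Measure.pi fun _ : ι => μ) := by
  have := integrable_norm_sq_evalAt h
    (∑ e, MvPolynomial.pderiv e P * conjPoly (MvPolynomial.pderiv e P))
  simpa only [evalAt_gradSq, Complex.norm_real, Real.norm_eq_abs, sq_abs] using this

theorem integral_gradSq (h : IsSymmLaw μ) (P : MvPolynomial ι ℂ) :
    ∫ x, gradSq P x ∂(Measure.pi fun _ : ι => μ) = ∑ e, sqMean μ (MvPolynomial.pderiv e P) :=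
  integral_finsetSum _ fun _ _ => integrable_norm_sq_evalAt h _

theorem integral_norm_sub_sq_le (h : IsSymmLaw μ) {C : ℝ} (hP : PoincareWith μ C)
    (P : MvPolynomial ι ℂ) :
    ∫ x, ‖evalAt x P - polyMean μ P‖ ^ 2 ∂(Measure.pi fun _ : ι => μ)
      ≤ C * ∫ x, gradSq P x ∂(Measure.pi fun _ : ι => μ) := by
  have := sqMean_sub_polyMean_le h hP P
  rw [← integral_gradSq h] at this
  simpa only [sqMean, map_sub, evalAt_C] using this

/-- Poincaré is applied twice, to G = P - E P and to |G|², whose squared gradient is at most 4 |G|²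
|∇P|². -/
theorem integral_norm_sub_pow_four_le (h : IsSymmLaw μ) {C : ℝ} (hC : 0 ≤ C)
    (hP : PoincareWith μ C) (P : MvPolynomial ι ℂ) :
    ∫ x, ‖evalAt x P - polyMean μ P‖ ^ 4 ∂(Measure.pi fun _ : ι => μ)
      ≤ 68 * C ^ 2 * ∫ x, gradSq P x ^ 2 ∂(Measure.pi fun _ : ι => μ) := by
  have hprob := h.prob
  set π := Measure.pi fun _ : ι => μ
  set G := P - MvPolynomial.C (polyMean μ P) with hG
  set H := G * conjPoly G with hH
  have hGe : ∀ x, evalAt x P - polyMean μ P = evalAt x G := fun x => by simp [hG]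
  have hGd : ∀ e, MvPolynomial.pderiv e G = MvPolynomial.pderiv e P := fun e => by simp [hG]
  have hHe : ∀ x, evalAt x H = ((‖evalAt x G‖ ^ 2 : ℝ) : ℂ) := fun x => evalAt_mul_conjPoly x G
  set s := sqMean μ G with hs
  have hmean : polyMean μ H = (s : ℂ) := (sqMean_eq h G).symm
  have hs0 : 0 ≤ s := sqMean_nonneg μ G
  have hsle : s ≤ C * ∫ x, gradSq P x ∂π := by
    have := sqMean_sub_polyMean_le h hP P
    rwa [← integral_gradSq h] at this
  have hint4 : Integrable (fun x => ‖evalAt x G‖ ^ 4) π := by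
    have := integrable_norm_sq_evalAt h H
    refine this.congr (Eventually.of_forall fun x => ?_)
    simp only [hHe, Complex.norm_real, Real.norm_eq_abs, sq_abs]
    ring
  have hintd : Integrable (fun x => ‖evalAt x G‖ ^ 2 * gradSq P x) π := by
    have := (integrable_evalAt h
      (H * ∑ e, MvPolynomial.pderiv e P * conjPoly (MvPolynomial.pderiv e P))).re
    refine this.congr (Eventually.of_forall fun x => ?_)
    beta_reduce
    rw [map_mul, evalAt_gradSq, hHe, ← Complex.ofReal_mul]
    exact Complex.ofReal_re _
  have hgrad : ∀ x, gradSq H x ≤ 4 * (‖evalAt x G‖ ^ 2 * gradSq P x) := by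
    intro x
    rw [gradSq, gradSq, Finset.mul_sum, Finset.mul_sum]
    refine Finset.sum_le_sum fun e _ => ?_
    rw [hH, MvPolynomial.pderiv_mul, pderiv_conjPoly, hGd, map_add, map_mul, map_mul,
      evalAt_conjPoly, evalAt_conjPoly]
    have h1 := norm_add_le (evalAt x (MvPolynomial.pderiv e P) * starRingEnd ℂ (evalAt x G))
      (evalAt x G * starRingEnd ℂ (evalAt x (MvPolynomial.pderiv e P)))
    rw [norm_mul, norm_mul, RCLike.norm_conj, RCLike.norm_conj] at h1
    calc _ ≤ (‖evalAt x (MvPolynomial.pderiv e P)‖ * ‖evalAt x G‖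
          + ‖evalAt x G‖ * ‖evalAt x (MvPolynomial.pderiv e P)‖) ^ 2 := by gcongr
      _ = _ := by ring
  have hvarH : ∫ x, (‖evalAt x G‖ ^ 2 - s) ^ 2 ∂π ≤ C * ∫ x, 4 * (‖evalAt x G‖ ^ 2 * gradSq P x) ∂π := by
    have h1 := integral_norm_sub_sq_le h hP H
    have h2 : ∀ x, ‖evalAt x H - polyMean μ H‖ ^ 2 = (‖evalAt x G‖ ^ 2 - s) ^ 2 := by
      intro x
      rw [hHe, hmean, ← Complex.ofReal_sub, Complex.norm_real, Real.norm_eq_abs, sq_abs]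
    simp_rw [h2] at h1
    refine h1.trans (mul_le_mul_of_nonneg_left ?_ hC)
    exact integral_mono (integrable_gradSq h H) (hintd.const_mul 4) hgrad
  have hintv : Integrable (fun x => (‖evalAt x G‖ ^ 2 - s) ^ 2) π := by
    have := integrable_norm_sq_evalAt h (H - MvPolynomial.C (s : ℂ))
    refine this.congr (Eventually.of_forall fun x => ?_)
    simp only [map_sub, evalAt_C, hHe]
    rw [← Complex.ofReal_sub, Complex.norm_real, Real.norm_eq_abs, sq_abs]
  have hg2 := integrable_gradSq_sq h P
  have hsq : s ^ 2 ≤ C ^ 2 * ∫ x, gradSq P x ^ 2 ∂π := by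
    have h1 := sq_integral_mul_le (μ := π) (a := fun x => gradSq P x) (b := fun _ => 1) hg2
      (integrable_const _) (by simpa using integrable_gradSq h P)
    simp only [mul_one, one_pow, integral_const, probReal_univ, smul_eq_mul] at h1
    calc s ^ 2 ≤ (C * ∫ x, gradSq P x ∂π) ^ 2 := pow_le_pow_left₀ hs0 hsle 2
      _ = C ^ 2 * (∫ x, gradSq P x ∂π) ^ 2 := by ring
      _ ≤ _ := mul_le_mul_of_nonneg_left h1 (by positivity)
  have hA : ∫ x, ‖evalAt x G‖ ^ 4 ∂π
      ≤ 2 * ∫ x, (‖evalAt x G‖ ^ 2 - s) ^ 2 ∂π + 2 * s ^ 2 := by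
    have h1 : ∫ x, ‖evalAt x G‖ ^ 4 ∂π
        ≤ ∫ x, (2 * (‖evalAt x G‖ ^ 2 - s) ^ 2 + 2 * s ^ 2) ∂π := by
      refine integral_mono hint4 ((hintv.const_mul 2).add (integrable_const _)) fun x => ?_
      nlinarith [sq_nonneg (‖evalAt x G‖ ^ 2 - 2 * s)]
    rw [integral_add (hintv.const_mul 2) (integrable_const _), integral_const_mul] at h1
    simpa using h1
  -- The weight ¼ makes half of the fourth moment absorbable on the left after doubling. What
  -- remains is 2(2 · 16 + 2) = 68 times C² E|∇P|⁴.
  have hB : C * ∫ x, 4 * (‖evalAt x G‖ ^ 2 * gradSq P x) ∂π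
      ≤ 1 / 4 * ∫ x, ‖evalAt x G‖ ^ 4 ∂π + 16 * C ^ 2 * ∫ x, gradSq P x ^ 2 ∂π := by
    rw [← integral_const_mul, ← integral_const_mul, ← integral_const_mul,
      ← integral_add (hint4.const_mul _) (hg2.const_mul _)]
    refine integral_mono ((hintd.const_mul 4).const_mul C)
      ((hint4.const_mul _).add (hg2.const_mul _)) fun x => ?_
    simp only
    nlinarith [sq_nonneg (1 / 2 * ‖evalAt x G‖ ^ 2 - 4 * C * gradSq P x)]
  simp_rw [hGe]
  linarith

end FourthMoment

/-! ### Bilinear forms of the coordinate matrices. -/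

section BilinearForms

set_option linter.unusedSectionVars false

open scoped Matrix.Norms.L2Operator

variable {N : ℕ}

theorem star_dotProduct_self_eq (y : Fin N → ℂ) :
    star y ⬝ᵥ y = ((‖WithLp.toLp 2 y‖ ^ 2 : ℝ) : ℂ) := by
  rw [EuclideanSpace.norm_sq_eq, Complex.ofReal_sum]
  refine Finset.sum_congr rfl fun i _ => ?_
  rw [Pi.star_apply, RCLike.star_def, Complex.conj_mul']
  simp

theorem norm_dotProduct_le (y w : Fin N → ℂ) :
    ‖y ⬝ᵥ w‖ ≤ ‖WithLp.toLp 2 y‖ * ‖WithLp.toLp 2 w‖ := by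
  have h := norm_inner_le_norm (𝕜 := ℂ) (WithLp.toLp 2 (star y) : EuclideanSpace ℂ (Fin N))
    (WithLp.toLp 2 w)
  have h1 : ‖(WithLp.toLp 2 (star y) : EuclideanSpace ℂ (Fin N))‖ = ‖WithLp.toLp 2 y‖ := by
    simp [EuclideanSpace.norm_eq]
  rw [h1] at h
  rwa [EuclideanSpace.inner_eq_star_dotProduct, star_star, dotProduct_comm] at h

theorem norm_pow_mulVec_le (X : Matrix (Fin N) (Fin N) ℂ) (a : ℕ) (y : Fin N → ℂ) :
    ‖WithLp.toLp 2 ((X ^ a).mulVec y)‖ ≤ ‖X‖ ^ a * ‖WithLp.toLp 2 y‖ := by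
  induction a with
  | zero => simp
  | succ a ih =>
    rw [pow_succ', ← Matrix.mulVec_mulVec, pow_succ', mul_assoc]
    exact (Matrix.l2_opNorm_mulVec X (WithLp.toLp 2 ((X ^ a).mulVec y))).trans
      (mul_le_mul_of_nonneg_left ih (norm_nonneg _))

/-- Each square is y* c_e (w w*) c_e y, so the contraction formula gives |y|²|w|²/N plus κ/N times
|Σ w_i y_i|², and Cauchy–Schwarz bounds the latter. -/
theorem EdgeModel.sum_norm_sq_le {ι : Type} [Fintype ι] (E : EdgeModel N ι) (y w : Fin N → ℂ) :
    ∑ e, ‖star y ⬝ᵥ (E.mat e).mulVec w‖ ^ 2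
      ≤ 2 / N * (‖WithLp.toLp 2 y‖ ^ 2 * ‖WithLp.toLp 2 w‖ ^ 2) := by
  have h1 : ∀ e, ((‖star y ⬝ᵥ (E.mat e).mulVec w‖ ^ 2 : ℝ) : ℂ)
      = star y ⬝ᵥ ((E.mat e * Matrix.vecMulVec w (star w) * E.mat e).mulVec y) := by
    intro e
    have h2 : star (star y ⬝ᵥ (E.mat e).mulVec w) = star w ⬝ᵥ (E.mat e).mulVec y := by
      rw [← Matrix.star_dotProduct_star, star_star, Matrix.star_mulVec, (E.mat_herm e).eq,
        Matrix.dotProduct_mulVec, dotProduct_comm]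
    rw [Complex.ofReal_pow, ← Complex.mul_conj']
    change _ * star _ = _
    rw [h2, mul_assoc, ← Matrix.mulVec_mulVec, ← Matrix.mulVec_mulVec, Matrix.vecMulVec_mulVec]
    simp [Matrix.mulVec_smul, mul_comm]
  have h3 : ((∑ e, ‖star y ⬝ᵥ (E.mat e).mulVec w‖ ^ 2 : ℝ) : ℂ)
      = ((1 / N * (‖WithLp.toLp 2 y‖ ^ 2 * ‖WithLp.toLp 2 w‖ ^ 2)
        + E.κ / N * ‖w ⬝ᵥ y‖ ^ 2 : ℝ) : ℂ) := by
    rw [Complex.ofReal_sum]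
    simp_rw [h1]
    rw [← dotProduct_sum, ← Matrix.sum_mulVec, E.mat_cov.sum_mul_mul, Matrix.add_mulVec,
      dotProduct_add]
    simp only [Matrix.smul_mulVec, Matrix.one_mulVec, dotProduct_smul, smul_eq_mul,
      Matrix.transpose_vecMulVec, Matrix.trace_vecMulVec, Matrix.vecMulVec_mulVec]
    rw [star_dotProduct_self_eq, dotProduct_comm w, star_dotProduct_self_eq]
    push_cast
    congr 1
    · ring
    · congr 1
      rw [← Complex.mul_conj']
      change _ = _ * star _
      rw [← Matrix.star_dotProduct_star]
      simp [mul_comm, dotProduct_comm]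
  rw [Complex.ofReal_inj.1 h3]
  have h4 : ‖w ⬝ᵥ y‖ ^ 2 ≤ ‖WithLp.toLp 2 y‖ ^ 2 * ‖WithLp.toLp 2 w‖ ^ 2 := by
    rw [← mul_pow, mul_comm ‖WithLp.toLp 2 y‖]
    exact pow_le_pow_left₀ (norm_nonneg _) (norm_dotProduct_le w y) 2
  have h5 : E.κ / N ≤ 1 / N := div_le_div_of_nonneg_right E.κ_le_one (by positivity)
  calc _ ≤ 1 / (N : ℝ) * (‖WithLp.toLp 2 y‖ ^ 2 * ‖WithLp.toLp 2 w‖ ^ 2)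
        + 1 / N * (‖WithLp.toLp 2 y‖ ^ 2 * ‖WithLp.toLp 2 w‖ ^ 2) := by
        have := E.κ_nonneg
        gcongr
    _ = _ := by ring

end BilinearForms

/-! ### Concentration of bilinear forms of powers. -/

section Concentration

set_option linter.unusedSectionVars false

open scoped Matrix.Norms.L2Operator

variable {N : ℕ} {ι : Type} [Fintype ι] [DecidableEq ι]

/-- The polynomial `⟨u, M w⟩` for a matrix `M` of polynomials. -/
noncomputable def bilPoly (u w : Fin N → ℂ) (M : Matrix (Fin N) (Fin N) (MvPolynomial ι ℂ)) :
    MvPolynomial ι ℂ := ∑ i, ∑ j, MvPolynomial.C (star (u i) * w j) * M i j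

theorem evalAt_bilPoly (u w : Fin N → ℂ) (M : Matrix (Fin N) (Fin N) (MvPolynomial ι ℂ))
    (x : ι → ℝ) : evalAt x (bilPoly u w M) = star u ⬝ᵥ (M.map (evalAt x)).mulVec w := by
  simp only [bilPoly, map_sum, map_mul, evalAt_C, dotProduct, Matrix.mulVec, Finset.mul_sum,
    Matrix.map_apply, Pi.star_apply]
  exact Finset.sum_congr rfl fun i _ => Finset.sum_congr rfl fun j _ => by ring

theorem pderiv_bilPoly (u w : Fin N → ℂ) (M : Matrix (Fin N) (Fin N) (MvPolynomial ι ℂ)) (e : ι) :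
    MvPolynomial.pderiv e (bilPoly u w M) = bilPoly u w (M.map (MvPolynomial.pderiv e)) := by
  simp only [bilPoly, map_sum, MvPolynomial.pderiv_C_mul, Matrix.map_apply]

theorem polyMean_bilPoly (μ : Measure ℝ) (u w : Fin N → ℂ)
    (M : Matrix (Fin N) (Fin N) (MvPolynomial ι ℂ)) :
    polyMean μ (bilPoly u w M) = ∑ i, ∑ j, star (u i) * w j * polyMean μ (M i j) := by
  simp only [bilPoly, map_sum, ← MvPolynomial.smul_eq_C_mul, map_smul, smul_eq_mul]

variable (E : EdgeModel N ι)

/-- The derivative of u* Xᵏ w is a sum of k terms (Xᵃu)* c_e (X^(k-1-a)w). Cauchy–Schwarz over the k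
terms gives one factor k and summation over a the other; the sum over edges costs 2/N. -/
theorem EdgeModel.gradSq_bilPoly_le (k : ℕ) {u w : Fin N → ℂ} (hu : ‖WithLp.toLp 2 u‖ ≤ 1)
    (hw : ‖WithLp.toLp 2 w‖ ≤ 1) (x : ι → ℝ) :
    gradSq (bilPoly u w (linPoly E.mat ^ k)) x
      ≤ 2 * k ^ 2 / N * ‖linMat E.mat x‖ ^ (2 * (k - 1)) := by
  set X := linMat E.mat x with hX
  have hXh : ∀ a, (X ^ a).IsHermitian := fun a => (linMat_isHermitian E.mat_herm x).pow a
  have hev : ∀ e, evalAt x (MvPolynomial.pderiv e (bilPoly u w (linPoly E.mat ^ k)))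
      = ∑ a ∈ Finset.range k,
        star ((X ^ a).mulVec u) ⬝ᵥ (E.mat e).mulVec ((X ^ (k - 1 - a)).mulVec w) := by
    intro e
    rw [pderiv_bilPoly, ← insertPoly_zero E.mat e k, insertPoly_map_pderiv, zero_add, one_smul,
      evalAt_bilPoly, insertPoly_map_evalAt, insertSum_succ_eq_sum, Matrix.sum_mulVec,
      dotProduct_sum]
    refine Finset.sum_congr rfl fun a _ => ?_
    have h0 : ∀ m, insertSum X (E.mat e) 0 m = X ^ m := fun m => by cases m <;> rfl
    rw [h0, ← Matrix.mulVec_mulVec, ← Matrix.mulVec_mulVec, Matrix.dotProduct_mulVec,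
      Matrix.star_mulVec, (hXh a).eq]
  calc gradSq (bilPoly u w (linPoly E.mat ^ k)) x
      ≤ ∑ e, k * ∑ a ∈ Finset.range k, ‖star ((X ^ a).mulVec u) ⬝ᵥ
          (E.mat e).mulVec ((X ^ (k - 1 - a)).mulVec w)‖ ^ 2 := by
        refine Finset.sum_le_sum fun e _ => ?_
        rw [hev]
        refine (pow_le_pow_left₀ (norm_nonneg _) (norm_sum_le _ _) 2).trans ?_
        have := sq_sum_le_card_mul_sum_sq (s := Finset.range k) (f := fun a =>
          ‖star ((X ^ a).mulVec u) ⬝ᵥ (E.mat e).mulVec ((X ^ (k - 1 - a)).mulVec w)‖)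
        rwa [Finset.card_range] at this
    _ = k * ∑ a ∈ Finset.range k, ∑ e, ‖star ((X ^ a).mulVec u) ⬝ᵥ
          (E.mat e).mulVec ((X ^ (k - 1 - a)).mulVec w)‖ ^ 2 := by
        rw [← Finset.mul_sum, Finset.sum_comm]
    _ ≤ k * ∑ a ∈ Finset.range k, 2 / N * ‖X‖ ^ (2 * (k - 1)) := by
        refine mul_le_mul_of_nonneg_left (Finset.sum_le_sum fun a ha => ?_) (by positivity)
        refine (E.sum_norm_sq_le _ _).trans (mul_le_mul_of_nonneg_left ?_ (by positivity))
        have hb : ∀ (b : ℕ) {y : Fin N → ℂ}, ‖WithLp.toLp 2 y‖ ≤ 1 →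
            ‖WithLp.toLp 2 ((X ^ b).mulVec y)‖ ≤ ‖X‖ ^ b := fun b y hy =>
          (norm_pow_mulVec_le X b y).trans (mul_le_of_le_one_right (by positivity) hy)
        have h1 : 2 * (k - 1) = a * 2 + (k - 1 - a) * 2 := by
          have := Finset.mem_range.1 ha; omega
        rw [h1, pow_add, pow_mul, pow_mul]
        have h2 := hb a hu
        have h3 := hb (k - 1 - a) hw
        gcongr
    _ = _ := by
        rw [Finset.sum_const, Finset.card_range, nsmul_eq_mul]
        ring

variable {μ : Measure ℝ} {σ : ℝ}

theorem IsEntryLaw.exists_poincareWith (h : IsEntryLaw μ σ) :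
    ∃ C : ℝ, 0 < C ∧ PoincareWith μ C := h.poincare

theorem IsEntryLaw.exists_variance_le (h : IsEntryLaw μ σ) (hσ : 0 < σ) (k : ℕ) :
    ∃ K : ℝ, 0 ≤ K ∧ ∀ N : ℕ, 0 < N → ∀ (ι : Type) [Fintype ι] [DecidableEq ι]
      (E : EdgeModel N ι) (u w : Fin N → ℂ), ‖WithLp.toLp 2 u‖ ≤ 1 → ‖WithLp.toLp 2 w‖ ≤ 1 →
      ∫ x, ‖evalAt x (bilPoly u w (linPoly E.mat ^ k))
          - polyMean μ (bilPoly u w (linPoly E.mat ^ k))‖ ^ 2 ∂(Measure.pi fun _ : ι => μ)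
        ≤ K * Real.sqrt N / N := by
  obtain ⟨C, hC, hP⟩ := h.exists_poincareWith
  obtain ⟨K, hK, hb⟩ := h.exists_norm_pow_le hσ (2 * (k - 1))
  refine ⟨C * (2 * k ^ 2 * K), by positivity, fun N hN ι _ _ E u w hu hw => ?_⟩
  refine (integral_norm_sub_sq_le h.isSymmLaw hP _).trans ?_
  have h1 : ∫ x, gradSq (bilPoly u w (linPoly E.mat ^ k)) x ∂(Measure.pi fun _ : ι => μ)
      ≤ ∫ x, 2 * k ^ 2 / N * ‖linMat E.mat x‖ ^ (2 * (k - 1)) ∂(Measure.pi fun _ : ι => μ) :=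
    integral_mono (integrable_gradSq h.isSymmLaw _)
      ((E.integrable_norm_pow h.isSymmLaw hN _).const_mul _)
      fun x => E.gradSq_bilPoly_le k hu hw x
  rw [integral_const_mul] at h1
  calc _ ≤ C * (2 * k ^ 2 / N * (K * Real.sqrt N)) := by
        refine mul_le_mul_of_nonneg_left (h1.trans ?_) hC.le
        exact mul_le_mul_of_nonneg_left (hb N hN ι E) (by positivity)
    _ = _ := by ring

theorem IsEntryLaw.exists_fourth_moment_le (h : IsEntryLaw μ σ) (hσ : 0 < σ) (k : ℕ) :
    ∃ K : ℝ, 0 ≤ K ∧ ∀ N : ℕ, 0 < N → ∀ (ι : Type) [Fintype ι] [DecidableEq ι]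
      (E : EdgeModel N ι) (u w : Fin N → ℂ), ‖WithLp.toLp 2 u‖ ≤ 1 → ‖WithLp.toLp 2 w‖ ≤ 1 →
      ∫ x, ‖evalAt x (bilPoly u w (linPoly E.mat ^ k))
          - polyMean μ (bilPoly u w (linPoly E.mat ^ k))‖ ^ 4 ∂(Measure.pi fun _ : ι => μ)
        ≤ K * Real.sqrt N / N ^ 2 := by
  obtain ⟨C, hC, hP⟩ := h.exists_poincareWith
  obtain ⟨K, hK, hb⟩ := h.exists_norm_pow_le hσ (2 * (2 * (k - 1)))
  refine ⟨68 * C ^ 2 * (4 * k ^ 4 * K), by positivity, fun N hN ι _ _ E u w hu hw => ?_⟩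
  refine (integral_norm_sub_pow_four_le h.isSymmLaw hC.le hP _).trans ?_
  have h1 : ∫ x, gradSq (bilPoly u w (linPoly E.mat ^ k)) x ^ 2 ∂(Measure.pi fun _ : ι => μ)
      ≤ ∫ x, 4 * k ^ 4 / N ^ 2 * ‖linMat E.mat x‖ ^ (2 * (2 * (k - 1)))
        ∂(Measure.pi fun _ : ι => μ) := by
    refine integral_mono (integrable_gradSq_sq h.isSymmLaw _)
      ((E.integrable_norm_pow h.isSymmLaw hN _).const_mul _) fun x => ?_
    refine (pow_le_pow_left₀ (gradSq_nonneg _ _) (E.gradSq_bilPoly_le k hu hw x) 2).trans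
      (le_of_eq ?_)
    rw [mul_pow, ← pow_mul, mul_comm (2 * (k - 1)) 2]
    ring
  rw [integral_const_mul] at h1
  calc _ ≤ 68 * C ^ 2 * (4 * k ^ 4 / N ^ 2 * (K * Real.sqrt N)) := by
        refine mul_le_mul_of_nonneg_left (h1.trans ?_) (by positivity)
        exact mul_le_mul_of_nonneg_left (hb N hN ι E) (by positivity)
    _ = _ := by ring

end Concentration

/-! ### Moments of the semicircle law. -/

section SemicircleMoments

/-- The moments of the semicircle law of variance `v`. -/
noncomputable def semiMoment (v : ℝ) (k : ℕ) : ℝ :=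
  if Even k then catalan (k / 2) * v ^ (k / 2) else 0

theorem semiMoment_even (v : ℝ) (p : ℕ) : semiMoment v (2 * p) = catalan p * v ^ p := by
  simp [semiMoment]

theorem semiMoment_odd (v : ℝ) (p : ℕ) : semiMoment v (2 * p + 1) = 0 := by
  simp [semiMoment]

theorem semiMoment_zero (v : ℝ) : semiMoment v 0 = 1 := by
  simp [semiMoment]

theorem semiMoment_one (v : ℝ) : semiMoment v 1 = 0 := by
  simp [semiMoment]

theorem semiMoment_nonneg {v : ℝ} (hv : 0 ≤ v) (k : ℕ) : 0 ≤ semiMoment v k := by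
  unfold semiMoment; split_ifs <;> positivity

/-- The Catalan recursion written over all indices, odd ones contributing zero; this is the form
that integration by parts produces. -/
theorem semiMoment_add_two (v : ℝ) (n : ℕ) :
    semiMoment v (n + 2) = v * ∑ a ∈ Finset.range (n + 1), semiMoment v a * semiMoment v (n - a) := by
  rcases Nat.even_or_odd' n with ⟨p, rfl | rfl⟩
  · have h1 := sum_range_even_of_odd_eq_zero
      (f := fun a => semiMoment v a * semiMoment v (2 * p - a))
      (fun k => by simp [semiMoment_odd]) p
    rw [h1, show 2 * p + 2 = 2 * (p + 1) by ring, semiMoment_even, catalan_succ_eq_sum]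
    push_cast
    rw [Finset.sum_mul, Finset.mul_sum]
    refine Finset.sum_congr rfl fun k hk => ?_
    have hk' := Finset.mem_range.1 hk
    rw [show 2 * p - 2 * k = 2 * (p - k) by omega, semiMoment_even, semiMoment_even]
    have h3 : v ^ (p + 1) = v * (v ^ k * v ^ (p - k)) := by
      rw [← pow_add, ← pow_succ']; congr 1; omega
    rw [h3]; ring
  · rw [show 2 * p + 1 + 2 = 2 * (p + 1) + 1 by ring, semiMoment_odd, Finset.sum_eq_zero, mul_zero]
    intro a ha
    have ha' := Finset.mem_range.1 ha
    rcases Nat.even_or_odd' a with ⟨q, rfl | rfl⟩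
    · rw [show 2 * p + 1 - 2 * q = 2 * (p - q) + 1 by omega, semiMoment_odd, mul_zero]
    · rw [semiMoment_odd, zero_mul]

end SemicircleMoments

/-! ### Off-diagonal entries have mean zero. -/

section OffDiagonal

set_option linter.unusedSectionVars false

variable {N : ℕ} {ι : Type} [Fintype ι] [DecidableEq ι] (E : EdgeModel N ι)

theorem EdgeModel.mat_supp (e : ι) : PairSupported (E.mat e) (E.src e) (E.tgt e) := by
  intro k l h
  refine E.dom_supp e k l fun h0 => h ?_
  have := E.norm_le e k l
  rw [h0] at this
  exact norm_le_zero_iff.1 this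

theorem sign_conj_pow {R : Type*} [CommRing R] {s : Fin N → R} (hs : ∀ k, s k * s k = 1)
    (X : Matrix (Fin N) (Fin N) R) (n : ℕ) (i j : Fin N) :
    ((Matrix.of fun k l => s k * X k l * s l) ^ n) i j = s i * (X ^ n) i j * s j := by
  induction n generalizing i with
  | zero =>
    by_cases hij : i = j
    · subst hij; simp [hs]
    · simp [Matrix.one_apply_ne hij]
  | succ n ih =>
    rw [pow_succ', pow_succ', Matrix.mul_apply, Matrix.mul_apply, Finset.mul_sum, Finset.sum_mul]
    refine Finset.sum_congr rfl fun l _ => ?_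
    rw [ih, Matrix.of_apply]
    linear_combination s i * X i l * (X ^ n) l j * s j * hs l

/-- Conjugating X by the diagonal sign matrix that is -1 only at i amounts to sign changes of the
coordinates, hence preserves the law, and it reverses the sign of (Xⁿ)_ij. -/
theorem EdgeModel.polyMean_pow_apply_of_ne {μ : Measure ℝ} (h : IsSymmLaw μ) {i j : Fin N}
    (hij : i ≠ j) (n : ℕ) : polyMean μ ((linPoly E.mat ^ n) i j) = 0 := by
  set s : Fin N → ℝ := fun k => if k = i then -1 else 1 with hsdef
  have hs1 : ∀ k, s k = 1 ∨ s k = -1 := fun k => by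
    by_cases hk : k = i <;> simp [hsdef, hk]
  have hs2 : ∀ k, s k * s k = 1 := fun k => by rcases hs1 k with h1 | h1 <;> simp [h1]
  refine polyMean_eq_zero_of_sign h (s := fun e => s (E.src e) * s (E.tgt e)) (fun e => ?_)
    fun x => ?_
  · rcases hs1 (E.src e) with h1 | h1 <;> rcases hs1 (E.tgt e) with h2 | h2 <;> simp [h1, h2]
  · have hX : linMat E.mat (fun e => s (E.src e) * s (E.tgt e) * x e)
        = Matrix.of fun k l => ((s k : ℝ) : ℂ) * linMat E.mat x k l * ((s l : ℝ) : ℂ) := by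
      ext k l
      simp only [linMat, Matrix.sum_apply, Matrix.smul_apply, smul_eq_mul, Matrix.of_apply,
        Finset.mul_sum, Finset.sum_mul]
      refine Finset.sum_congr rfl fun e _ => ?_
      by_cases h0 : E.mat e k l = 0
      · simp [h0]
      · rcases E.mat_supp e k l h0 with ⟨rfl, rfl⟩ | ⟨rfl, rfl⟩
        · simp only [Complex.coe_algebraMap, Complex.ofReal_mul]; ring
        · simp only [Complex.coe_algebraMap, Complex.ofReal_mul]; ring
    rw [evalAt_linPoly_pow, evalAt_linPoly_pow, hX,
      sign_conj_pow (s := fun k => ((s k : ℝ) : ℂ)) fun k => by exact_mod_cast hs2 k]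
    simp [hsdef, hij.symm]

end OffDiagonal

/-! ### Third-order remainder for diagonal entries. -/

section ThirdOrder

set_option linter.unusedSectionVars false

/-- The square of (Y^(2m))_ii is at most tr Y^(4m), whose mean is O(N). -/
theorem EdgeModel.exists_dom_diag_le {v β : ℝ} (hv : 0 < v) (hβ : v ≤ β) (m : ℕ) :
    ∃ K : ℝ, 0 ≤ K ∧ ∀ N : ℕ, 0 < N → ∀ (ι : Type) [Fintype ι] [DecidableEq ι]
      (E : EdgeModel N ι) (i : Fin N), ∫ x, (linMat E.dom x ^ (2 * m)) i i
        ∂(Measure.pi fun _ : ι => threePointLaw v β) ≤ K * Real.sqrt N := by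
  obtain ⟨K, hK, hb⟩ := EdgeModel.exists_domMoment_le hv hβ (2 * m)
  have := threePointLaw_prob hv hβ
  have hlaw := threePointLaw_isSymmLaw hv hβ
  refine ⟨1 + K, by positivity, fun N hN ι _ _ E i => ?_⟩
  have hN0 : (0 : ℝ) < N := by exact_mod_cast hN
  have hint : ∀ k, Integrable (fun x => (linMat E.dom x ^ k) i i)
      (Measure.pi fun _ : ι => threePointLaw v β) := fun k => by
    simpa only [evalAt_linPoly_pow] using integrable_evalAt hlaw ((linPoly E.dom ^ k) i i)
  have hintT := integrable_evalAt hlaw (linPoly E.dom ^ (2 * (2 * m))).trace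
  have hdiag : ∀ x : ι → ℝ, (linMat E.dom x ^ (2 * m)) i i ^ 2
      ≤ evalAt x (linPoly E.dom ^ (2 * (2 * m))).trace := by
    intro x
    have hh := linMat_isHermitian E.dom_herm x
    rw [evalAt_trace, Matrix.map_pow, linPoly_map_evalAt]
    have h1 : (linMat E.dom x ^ (2 * m)) i i ^ 2 ≤ (linMat E.dom x ^ (2 * (2 * m))) i i := by
      rw [mul_comm 2 (2 * m), pow_mul _ (2 * m) 2, sq (linMat E.dom x ^ (2 * m)), Matrix.mul_apply]
      have h2 : ∀ l, (linMat E.dom x ^ (2 * m)) i l * (linMat E.dom x ^ (2 * m)) l i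
          = (linMat E.dom x ^ (2 * m)) i l ^ 2 := fun l => by
        have := (hh.pow (2 * m)).apply l i
        rw [star_trivial] at this
        rw [← this, sq]
      simp_rw [h2]
      exact Finset.single_le_sum (f := fun l => (linMat E.dom x ^ (2 * m)) i l ^ 2)
        (fun l _ => sq_nonneg _) (Finset.mem_univ i)
    refine h1.trans ?_
    exact Finset.single_le_sum (f := fun l => (linMat E.dom x ^ (2 * (2 * m))) l l)
      (fun l _ => hh.pow_apply_self_nonneg (even_two_mul _) l) (Finset.mem_univ i)
  calc ∫ x, (linMat E.dom x ^ (2 * m)) i i ∂(Measure.pi fun _ : ι => threePointLaw v β)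
      ≤ ∫ x, Real.sqrt N * (1 + evalAt x (linPoly E.dom ^ (2 * (2 * m))).trace / N)
        ∂(Measure.pi fun _ : ι => threePointLaw v β) := by
        refine integral_mono (hint _)
          (((integrable_const _).add (hintT.div_const _)).const_mul _) fun x => ?_
        refine (le_sqrt_mul_one_add hN0 _).trans ?_
        have := hdiag x
        gcongr
    _ = Real.sqrt N * (1 + E.domMoment v β (2 * (2 * m)) / N) := by
        have h3 := integral_evalAt hlaw (linPoly E.dom ^ (2 * (2 * m))).trace
        rw [integral_const_mul, integral_add (integrable_const _) (hintT.div_const _),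
          integral_div, EdgeModel.domMoment, ← h3]
        simp
    _ ≤ Real.sqrt N * (1 + K) := by
        gcongr
        rw [div_le_iff₀ hN0]
        exact hb N hN ι E
    _ = _ := mul_comm _ _

variable {N : ℕ} {ι : Type} [Fintype ι] [DecidableEq ι] (E : EdgeModel N ι)

theorem EdgeModel.card_incident_le (i : Fin N) :
    ∑ e, (if i = E.src e ∨ i = E.tgt e then (1 : ℝ) else 0) ≤ 2 * N := by
  have h1 := E.sum_src_le (f := fun j => if i = j then 1 else 0) fun j => by split_ifs <;> norm_num
  refine le_trans (Finset.sum_le_sum fun e _ => ?_) (h1.trans (le_of_eq (by simp)))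
  by_cases h2 : i = E.src e <;> by_cases h3 : i = E.tgt e <;> simp [h2, h3] <;> split_ifs <;> norm_num

theorem EdgeModel.dom_insert_three_le (hN : 0 < N) (m : ℕ) (x : ι → ℝ) (e : ι) (i : Fin N) :
    (E.dom e * insertSum (linMat E.dom x) (E.dom e) 3 m) i i
      ≤ (if i = E.src e ∨ i = E.tgt e then 64 * (m : ℝ) ^ 3 / N ^ 2 *
          (1 + ((linMat E.dom x ^ (2 * m)) (E.src e) (E.src e)
            + (linMat E.dom x ^ (2 * m)) (E.tgt e) (E.tgt e))) else 0) := by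
  split_ifs with hi
  · set Y := linMat E.dom x with hY
    have hYh : Y.IsHermitian := linMat_isHermitian E.dom_herm x
    obtain ⟨t, ht, htn, hta⟩ := hYh.exists_entry_bound (even_two_mul m) (E.src e) (E.tgt e)
    have h3 := (E.dom_supp e).abs_mul_insertSum_apply_le (E.abs_dom_le e) ht hta (k := 3)
      (m := m) (by omega) hi
    refine (le_abs_self _).trans (h3.trans ?_)
    have h4 : Real.sqrt (2 / N) ^ 4 = 4 / (N : ℝ) ^ 2 := by
      have : Real.sqrt (2 / (N : ℝ)) ^ 2 = 2 / N := Real.sq_sqrt (by positivity)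
      calc Real.sqrt (2 / (N : ℝ)) ^ 4 = (Real.sqrt (2 / (N : ℝ)) ^ 2) ^ 2 := by ring
        _ = _ := by rw [this]; ring
    -- Passing to the even exponent 2m makes the diagonal entries in the bound nonnegative and their
    -- means controllable.
    have h5 : t ^ (m - 3) ≤ 1 + t ^ (2 * m) := by
      rcases le_total t 1 with h | h
      · have := pow_le_one₀ (n := m - 3) ht h
        have : 0 ≤ t ^ (2 * m) := by positivity
        linarith
      · have : t ^ (m - 3) ≤ t ^ (2 * m) := pow_le_pow_right₀ h (by omega)
        linarith
    calc 2 * (Real.sqrt (2 / N) * ((2 * (m : ℝ) * Real.sqrt (2 / N)) ^ 3 * t ^ (m - 3)))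
        = 16 * (m : ℝ) ^ 3 * Real.sqrt (2 / N) ^ 4 * t ^ (m - 3) := by ring
      _ = 64 * (m : ℝ) ^ 3 / N ^ 2 * t ^ (m - 3) := by rw [h4]; ring
      _ ≤ _ := by gcongr; linarith
  · push Not at hi
    have h0 : ∀ l, E.dom e i l = 0 := fun l => by
      by_contra hne
      rcases E.dom_supp e i l hne with ⟨h1, _⟩ | ⟨h1, _⟩
      · exact hi.1 h1
      · exact hi.2 h1
    rw [Matrix.mul_apply]
    exact (Finset.sum_eq_zero fun l _ => by rw [h0, zero_mul]).le

/-- Only edges incident to i contribute, with total weight at most 2N; each costs O(√N/N²). -/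
theorem EdgeModel.exists_third_order_le {v β : ℝ} (hv : 0 < v) (hβ : v ≤ β) (m : ℕ) :
    ∃ K : ℝ, 0 ≤ K ∧ ∀ N : ℕ, 0 < N → ∀ (ι : Type) [Fintype ι] [DecidableEq ι]
      (E : EdgeModel N ι) (i : Fin N), ∑ e, polyMean (threePointLaw v β)
        ((constPoly (E.dom e) * insertPoly E.dom e 3 m : Matrix _ _ (MvPolynomial ι ℝ)) i i) ≤ K * Real.sqrt N / N := by
  obtain ⟨K, hK, hb⟩ := EdgeModel.exists_dom_diag_le hv hβ m
  have hprob := threePointLaw_prob hv hβ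
  have hlaw := threePointLaw_isSymmLaw hv hβ
  refine ⟨64 * m ^ 3 * (1 + 2 * K) * 2, by positivity, fun N hN ι _ _ E i => ?_⟩
  have hN0 : (0 : ℝ) < N := by exact_mod_cast hN
  have hs1 : 1 ≤ Real.sqrt N := by
    rw [Real.one_le_sqrt]; exact_mod_cast hN
  have hint : ∀ k (j : Fin N), Integrable (fun x => (linMat E.dom x ^ k) j j)
      (Measure.pi fun _ : ι => threePointLaw v β) := fun k j => by
    simpa only [evalAt_linPoly_pow] using integrable_evalAt hlaw ((linPoly E.dom ^ k) j j)
  have hterm : ∀ e, polyMean (threePointLaw v β)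
        ((constPoly (E.dom e) * insertPoly E.dom e 3 m : Matrix _ _ (MvPolynomial ι ℝ)) i i)
      ≤ 64 * (m : ℝ) ^ 3 / N ^ 2 * ((1 + 2 * K) * Real.sqrt N)
        * (if i = E.src e ∨ i = E.tgt e then (1 : ℝ) else 0) := by
    intro e
    have h1 := integral_evalAt hlaw ((constPoly (E.dom e) * insertPoly E.dom e 3 m : Matrix _ _ (MvPolynomial ι ℝ)) i i)
    have hev : ∀ x, evalAt x ((constPoly (E.dom e) * insertPoly E.dom e 3 m : Matrix _ _ (MvPolynomial ι ℝ)) i i)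
        = (E.dom e * insertSum (linMat E.dom x) (E.dom e) 3 m) i i := by
      intro x
      have h := congrFun (congrFun (Matrix.map_mul (f := evalAt x)
        (L := (constPoly (E.dom e) : Matrix _ _ (MvPolynomial ι ℝ)))
        (M := insertPoly E.dom e 3 m)) i) i
      rw [constPoly_map_evalAt, insertPoly_map_evalAt] at h
      exact h
    rw [← h1]
    simp_rw [hev]
    have hintL : Integrable (fun x => (E.dom e * insertSum (linMat E.dom x) (E.dom e) 3 m) i i)
        (Measure.pi fun _ : ι => threePointLaw v β) := by
      have := integrable_evalAt hlaw ((constPoly (E.dom e) * insertPoly E.dom e 3 m : Matrix _ _ (MvPolynomial ι ℝ)) i i)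
      simpa only [hev] using this
    have h2 : ∀ x, _ := fun x => E.dom_insert_three_le hN m x e i
    by_cases hi : i = E.src e ∨ i = E.tgt e
    · simp only [hi, if_true, mul_one] at h2 ⊢
      have hab : Integrable (fun x => (linMat E.dom x ^ (2 * m)) (E.src e) (E.src e)
          + (linMat E.dom x ^ (2 * m)) (E.tgt e) (E.tgt e))
          (Measure.pi fun _ : ι => threePointLaw v β) :=
        (hint (2 * m) (E.src e)).add (hint (2 * m) (E.tgt e))
      refine (integral_mono hintL (((integrable_const 1).add hab).const_mul _) h2).trans ?_
      rw [integral_const_mul]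
      refine mul_le_mul_of_nonneg_left ?_ (by positivity)
      have h3 : ∫ x, (1 + ((linMat E.dom x ^ (2 * m)) (E.src e) (E.src e)
            + (linMat E.dom x ^ (2 * m)) (E.tgt e) (E.tgt e)))
            ∂(Measure.pi fun _ : ι => threePointLaw v β)
          = 1 + (∫ x, (linMat E.dom x ^ (2 * m)) (E.src e) (E.src e)
            ∂(Measure.pi fun _ : ι => threePointLaw v β)
            + ∫ x, (linMat E.dom x ^ (2 * m)) (E.tgt e) (E.tgt e)
            ∂(Measure.pi fun _ : ι => threePointLaw v β)) := by
        rw [integral_add (integrable_const _) hab, integral_add (hint _ _) (hint _ _)]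
        simp
      refine h3.le.trans ?_
      have h4 := hb N hN ι E (E.src e)
      have h5 := hb N hN ι E (E.tgt e)
      nlinarith
    · simp only [hi, if_false, mul_zero] at h2 ⊢
      exact integral_nonpos h2
  refine (Finset.sum_le_sum fun e _ => hterm e).trans ?_
  rw [← Finset.mul_sum]
  refine (mul_le_mul_of_nonneg_left (E.card_incident_le i) (by positivity)).trans (le_of_eq ?_)
  field_simp

end ThirdOrder

/-! ### Integration by parts for diagonal entries. -/

section DiagonalMean

set_option linter.unusedSectionVars false

open scoped Matrix.Norms.L2Operator

variable {N : ℕ} {ι : Type} [Fintype ι] [DecidableEq ι]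

/-- The variance of a polynomial in i.i.d. variables. -/
noncomputable def polyVar (μ : Measure ℝ) (P : MvPolynomial ι ℂ) : ℝ :=
  ∫ x, ‖evalAt x P - polyMean μ P‖ ^ 2 ∂(Measure.pi fun _ : ι => μ)

/-- The difference is the mean of the product of the centred factors, bounded by half the sum of
their squares. -/
theorem norm_polyMean_mul_sub_le {μ : Measure ℝ} (h : IsSymmLaw μ) (F H : MvPolynomial ι ℂ) :
    ‖polyMean μ (F * H) - polyMean μ F * polyMean μ H‖ ≤ (polyVar μ F + polyVar μ H) / 2 := by
  have := h.prob
  set F' := F - MvPolynomial.C (polyMean μ F) with hF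
  set H' := H - MvPolynomial.C (polyMean μ H) with hH
  have h1 : polyMean μ (F' * H') = polyMean μ (F * H) - polyMean μ F * polyMean μ H := by
    have : F' * H' = F * H - polyMean μ H • F - polyMean μ F • H
        + MvPolynomial.C (polyMean μ F * polyMean μ H) := by
      rw [hF, hH, MvPolynomial.smul_eq_C_mul, MvPolynomial.smul_eq_C_mul, map_mul]; ring
    rw [this, map_add, map_sub, map_sub, map_smul, map_smul, polyMean_C, smul_eq_mul, smul_eq_mul]
    ring
  have hFe : ∀ x, evalAt x F - polyMean μ F = evalAt x F' := fun x => by simp [hF]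
  have hHe : ∀ x, evalAt x H - polyMean μ H = evalAt x H' := fun x => by simp [hH]
  rw [← h1, ← integral_evalAt h]
  refine (norm_integral_le_integral_norm _).trans ?_
  simp only [polyVar, hFe, hHe]
  rw [← integral_add (integrable_norm_sq_evalAt h _) (integrable_norm_sq_evalAt h _),
    ← integral_div]
  refine integral_mono (integrable_evalAt h _).norm
    (((integrable_norm_sq_evalAt h _).add (integrable_norm_sq_evalAt h _)).div_const _) fun x => ?_
  simp only [map_mul, norm_mul]
  nlinarith [sq_nonneg (‖evalAt x F'‖ - ‖evalAt x H'‖)]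

variable (E : EdgeModel N ι) {μ : Measure ℝ} {v β : ℝ}

theorem bilPoly_single (i j : Fin N) (M : Matrix (Fin N) (Fin N) (MvPolynomial ι ℂ)) :
    bilPoly (Pi.single i 1) (Pi.single j 1) M = M i j := by
  rw [bilPoly, Finset.sum_eq_single i, Finset.sum_eq_single j]
  · simp
  · intro b _ hb; simp [hb]
  · simp
  · intro a _ ha; simp [ha]
  · simp

theorem norm_toLp_single (i : Fin N) :
    ‖WithLp.toLp 2 (Pi.single i 1 : Fin N → ℂ)‖ ≤ 1 := by
  have := star_dotProduct_self_eq (Pi.single i (1 : ℂ) : Fin N → ℂ)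
  rw [← Pi.single_star, star_one, single_one_dotProduct, Pi.single_eq_same] at this
  have h2 : ‖WithLp.toLp 2 (Pi.single i 1 : Fin N → ℂ)‖ ^ 2 = 1 := by exact_mod_cast this.symm
  nlinarith [norm_nonneg (WithLp.toLp 2 (Pi.single i 1 : Fin N → ℂ))]

/-- Bounds the transposed pairing, present when κ ≠ 0: the entry is the product, without
conjugation, of Xᵃ and Xᵇ applied to a basis vector. -/
theorem EdgeModel.norm_polyMean_transpose_mul_le (h : IsSymmLaw μ) (hN : 0 < N) (a b : ℕ)
    (i : Fin N) : ‖polyMean μ (((linPoly E.mat ^ a).transpose * linPoly E.mat ^ b) i i)‖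
      ≤ ∫ x, ‖linMat E.mat x‖ ^ (a + b) ∂(Measure.pi fun _ : ι => μ) := by
  rw [← integral_evalAt h]
  refine (norm_integral_le_integral_norm _).trans (integral_mono (integrable_evalAt h _).norm
    (E.integrable_norm_pow h hN _) fun x => ?_)
  set X := linMat E.mat x with hX
  have h1 : evalAt x (((linPoly E.mat ^ a).transpose * linPoly E.mat ^ b) i i)
      = (X ^ a).mulVec (Pi.single i 1) ⬝ᵥ (X ^ b).mulVec (Pi.single i 1) := by
    rw [Matrix.mul_apply, map_sum, dotProduct]
    refine Finset.sum_congr rfl fun l _ => ?_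
    rw [map_mul, Matrix.transpose_apply, evalAt_linPoly_pow, evalAt_linPoly_pow,
      Matrix.mulVec_single_one, Matrix.mulVec_single_one]
    rfl
  simp only [h1]
  refine (norm_dotProduct_le _ _).trans ?_
  rw [pow_add]
  have h2 : ∀ c, ‖WithLp.toLp 2 ((X ^ c).mulVec (Pi.single i 1))‖ ≤ ‖X‖ ^ c := fun c =>
    (norm_pow_mulVec_le X c _).trans
      (mul_le_of_le_one_right (by positivity) (norm_toLp_single i))
  exact mul_le_mul (h2 a) (h2 b) (norm_nonneg _) (by positivity)

theorem EdgeModel.mat_cov_poly : HasCovariance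
    (fun e => (constPoly (E.mat e) : Matrix _ _ (MvPolynomial ι ℂ)))
    (MvPolynomial.C (1 / (N : ℂ))) (MvPolynomial.C ((E.κ : ℂ) / N)) :=
  E.mat_cov.map MvPolynomial.C

theorem EdgeModel.sum_pderiv_const_mul_pow (n : ℕ) (i : Fin N) :
    ∑ e, MvPolynomial.pderiv e ((constPoly (E.mat e) * linPoly E.mat ^ (n + 1) :
        Matrix _ _ (MvPolynomial ι ℂ)) i i)
      = ∑ a ∈ Finset.range (n + 1),
        (MvPolynomial.C (1 / (N : ℂ)) * ((linPoly E.mat ^ a).trace * (linPoly E.mat ^ (n - a)) i i)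
        + MvPolynomial.C ((E.κ : ℂ) / N)
          * ((linPoly E.mat ^ a).transpose * linPoly E.mat ^ (n - a)) i i) := by
  have h1 : ∀ e, MvPolynomial.pderiv e ((constPoly (E.mat e) * linPoly E.mat ^ (n + 1) :
        Matrix _ _ (MvPolynomial ι ℂ)) i i)
      = ∑ a ∈ Finset.range (n + 1), (constPoly (E.mat e) * linPoly E.mat ^ a * constPoly (E.mat e)
        * linPoly E.mat ^ (n - a) : Matrix _ _ (MvPolynomial ι ℂ)) i i := by
    intro e
    have h2 := congrFun (congrFun (map_pderiv_constPoly_mul E.mat e 0 (n + 1)) i) i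
    rw [insertPoly_zero, zero_add, one_smul, Matrix.map_apply, insertPoly,
      insertSum_succ_eq_sum, Finset.mul_sum, Matrix.sum_apply] at h2
    rw [h2]
    refine Finset.sum_congr rfl fun a _ => ?_
    rw [← insertPoly, insertPoly_zero, Nat.add_sub_cancel]
    simp only [mul_assoc]
  simp_rw [h1]
  rw [Finset.sum_comm]
  refine Finset.sum_congr rfl fun a _ => ?_
  rw [← Matrix.sum_apply, ← Finset.sum_mul, E.mat_cov_poly.sum_mul_mul, add_mul, Matrix.add_apply]
  simp

theorem EdgeModel.polyMean_pow_add_two (i : Fin N) (n : ℕ) :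
    polyMean μ ((linPoly E.mat ^ (n + 2)) i i) = ∑ e, polyMean μ (MvPolynomial.X e *
      (constPoly (E.mat e) * linPoly E.mat ^ (n + 1) : Matrix _ _ (MvPolynomial ι ℂ)) i i) := by
  rw [pow_succ' _ (n + 1), linPoly_mul, Matrix.sum_apply, map_sum]
  rfl

/-- The constant 12 is the 2 of the one-variable remainder times the 3! of the third derivative. -/
theorem EdgeModel.sum_norm_remainder_le (hv : 0 < v) (hβ : v ≤ β) {d n : ℕ}
    (hμ : MomentsLE μ v β d) (hd : n + 2 ≤ d) (i : Fin N) :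
    ∑ e, ‖polyMean μ (MvPolynomial.X e *
        (constPoly (E.mat e) * linPoly E.mat ^ (n + 1) : Matrix _ _ (MvPolynomial ι ℂ)) i i)
      - (v : ℂ) * polyMean μ (MvPolynomial.pderiv e
        ((constPoly (E.mat e) * linPoly E.mat ^ (n + 1) : Matrix _ _ (MvPolynomial ι ℂ)) i i))‖
      ≤ 12 * β ^ 2 * ∑ e, polyMean (threePointLaw v β)
        ((constPoly (E.dom e) * insertPoly E.dom e 3 (n + 1) :
          Matrix _ _ (MvPolynomial ι ℝ)) i i) := by
  rw [Finset.mul_sum]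
  refine Finset.sum_le_sum fun e _ => ?_
  have hco : CoeffLE ((constPoly (E.mat e) * linPoly E.mat ^ (n + 1) :
      Matrix _ _ (MvPolynomial ι ℂ)) i i) ((constPoly (E.dom e) * linPoly E.dom ^ (n + 1) :
      Matrix _ _ (MvPolynomial ι ℝ)) i i) :=
    ((MatCoeffLE.constPoly (E.norm_le e)).mul (E.matCoeffLE_mat.pow (n + 1))) i i
  have hdeg : ((constPoly (E.mat e) * linPoly E.mat ^ (n + 1) :
      Matrix _ _ (MvPolynomial ι ℂ)) i i).totalDegree ≤ n + 1 := by
    rw [Matrix.mul_apply]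
    refine MvPolynomial.totalDegree_finsetSum_le fun l _ => ?_
    refine (MvPolynomial.totalDegree_mul _ _).trans ?_
    have := totalDegree_linPoly_pow E.mat (n + 1) l i
    simpa [constPoly] using this
  refine (hco.norm_polyMean_X_mul_sub_le hv hβ hμ (by omega) e).trans (le_of_eq ?_)
  have h3 := congrFun (congrFun (map_pderiv_three E.dom e (n + 1)) i) i
  simp only [Matrix.map_apply, Matrix.smul_apply] at h3
  rw [h3, map_nsmul, nsmul_eq_mul]
  push_cast
  ring

end DiagonalMean

/-! ### Diagonal means converge to the semicircle moments. -/

section DiagonalLimit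

open scoped Matrix.Norms.L2Operator

variable {μ : Measure ℝ} {σ : ℝ}

/-- Strong induction on k. Integration by parts writes E(X^(n+2))_ii as σ² Σ_a E[N⁻¹ tr Xᵃ ·
(X^(n-a))_ii] plus errors. The product of means replaces the mean of the product at the cost of
variances, and the result is the semicircle recursion. -/
theorem IsEntryLaw.exists_diag_mean_le (h : IsEntryLaw μ σ) (hσ : 0 < σ) (k : ℕ) :
    ∃ K : ℝ, 0 ≤ K ∧ ∀ N : ℕ, 0 < N → ∀ (ι : Type) [Fintype ι] [DecidableEq ι]
      (E : EdgeModel N ι) (i : Fin N),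
      ‖polyMean μ ((linPoly E.mat ^ k) i i) - (semiMoment (σ ^ 2) k : ℂ)‖
        ≤ K * Real.sqrt N / N := by
  have hprob := h.isProbabilityMeasure
  have hlaw := h.isSymmLaw
  induction k using Nat.strong_induction_on with
  | _ k ih =>
  rcases k with _ | _ | n
  · refine ⟨0, le_rfl, fun N hN ι _ _ E i => ?_⟩
    rw [pow_zero, Matrix.one_apply_eq, semiMoment_zero, ← MvPolynomial.C_1, polyMean_C]
    simp
  · refine ⟨0, le_rfl, fun N hN ι _ _ E i => ?_⟩
    have h0 : polyMean μ ((linPoly E.mat ^ (0 + 1)) i i) = 0 := by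
      refine polyMean_eq_zero_of_sign hlaw (s := fun _ => -1) (fun _ => Or.inr rfl) fun x => ?_
      rw [evalAt_linPoly_pow, evalAt_linPoly_pow]
      simp [linMat, Matrix.sum_apply]
    rw [h0, zero_add, semiMoment_one]
    simp
  · choose! K hK0 hK using ih
    choose Kv hKv0 hKv using h.exists_variance_le hσ
    obtain ⟨Kn, hKn0, hKn⟩ := h.exists_norm_pow_le hσ n
    obtain ⟨C, hC, hM⟩ := h.exists_momentsLE hσ
    have hv : 0 < σ ^ 2 := by positivity
    obtain ⟨β, hβe⟩ : ∃ β, β = C * ((n + 2 : ℕ) : ℝ) ^ 2 + σ ^ 2 := ⟨_, rfl⟩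
    have hβ : σ ^ 2 ≤ β := by
      have : 0 ≤ C * ((n + 2 : ℕ) : ℝ) ^ 2 := by positivity
      linarith
    have hMβ : MomentsLE μ (σ ^ 2) β (2 * (n + 2)) := hβe ▸ hM (n + 2)
    obtain ⟨K3, hK30, hK3⟩ := EdgeModel.exists_third_order_le hv hβ (n + 1)
    set m := semiMoment (σ ^ 2) with hm
    have hm0 : ∀ a, 0 ≤ m a := semiMoment_nonneg hv.le
    have hK0' : ∀ a ∈ Finset.range (n + 1), 0 ≤ K a ∧ 0 ≤ K (n - a) := fun a ha => by
      have := Finset.mem_range.1 ha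
      exact ⟨hK0 a (by omega), hK0 (n - a) (by omega)⟩
    set T : ℕ → ℝ := fun a => (Kv a + Kv (n - a)) / 2 + K a * (m (n - a) + K (n - a))
      + m a * K (n - a) with hT
    have hT0 : ∀ a ∈ Finset.range (n + 1), 0 ≤ T a := fun a ha => by
      have h1 := (hK0' a ha).1
      have h2 := (hK0' a ha).2
      have h3 := hm0 a
      have h4 := hm0 (n - a)
      have h5 := hKv0 a
      have h6 := hKv0 (n - a)
      positivity
    refine ⟨12 * β ^ 2 * K3 + σ ^ 2 * ∑ a ∈ Finset.range (n + 1), (T a + Kn), ?_,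
      fun N hN ι _ _ E i => ?_⟩
    · have : 0 ≤ ∑ a ∈ Finset.range (n + 1), (T a + Kn) :=
        Finset.sum_nonneg fun a ha => add_nonneg (hT0 a ha) hKn0
      positivity
    have hN0 : (0 : ℝ) < N := by exact_mod_cast hN
    have hNC : (N : ℂ) ≠ 0 := by exact_mod_cast hN0.ne'
    -- The common scale of all errors. Since q ≤ 1, products of two errors are again of this order.
    obtain ⟨q, hq⟩ : ∃ q, q = Real.sqrt N / N := ⟨_, rfl⟩
    have hq0 : 0 ≤ q := hq ▸ by positivity
    have hq1 : q ≤ 1 := by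
      rw [hq, div_le_one hN0, Real.sqrt_le_left (by positivity)]
      have : (1 : ℝ) ≤ N := by exact_mod_cast hN
      nlinarith
    simp only [mul_div_assoc, ← hq] at hK hKv hK3 ⊢
    have hprod : ∀ a ∈ Finset.range (n + 1), ∀ j,
        ‖polyMean μ ((linPoly E.mat ^ a) j j * (linPoly E.mat ^ (n - a)) i i)
          - (m a * m (n - a) : ℂ)‖ ≤ T a * q := by
      intro a ha j
      have ha' := Finset.mem_range.1 ha
      have h1 := hK a (by omega) N hN ι E j
      have h2 := hK (n - a) (by omega) N hN ι E i
      have h3 := hKv a N hN ι E _ _ (norm_toLp_single j) (norm_toLp_single j)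
      have h4 := hKv (n - a) N hN ι E _ _ (norm_toLp_single i) (norm_toLp_single i)
      rw [bilPoly_single, ← hq] at h3 h4
      rw [← hq] at h1 h2
      have h5 := norm_polyMean_mul_sub_le hlaw ((linPoly E.mat ^ a) j j)
        ((linPoly E.mat ^ (n - a)) i i)
      set F := polyMean μ ((linPoly E.mat ^ a) j j)
      set H := polyMean μ ((linPoly E.mat ^ (n - a)) i i)
      have h6 : ‖H‖ ≤ m (n - a) + K (n - a) := by
        have h7 := norm_le_norm_add_norm_sub' H (m (n - a) : ℂ)
        rw [Complex.norm_real, Real.norm_of_nonneg (hm0 _)] at h7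
        have h8 : K (n - a) * q ≤ K (n - a) :=
          mul_le_of_le_one_right (hK0' a ha).2 hq1
        linarith
      have h9 : polyMean μ ((linPoly E.mat ^ a) j j * (linPoly E.mat ^ (n - a)) i i)
          - (m a * m (n - a) : ℂ)
          = (polyMean μ ((linPoly E.mat ^ a) j j * (linPoly E.mat ^ (n - a)) i i) - F * H)
            + (F - m a) * H + m a * (H - m (n - a)) := by ring
      rw [h9]
      refine (norm_add₃_le).trans ?_
      rw [norm_mul, norm_mul, Complex.norm_real, Real.norm_of_nonneg (hm0 a)]
      have h10 : ‖F - m a‖ * ‖H‖ ≤ (K a * q) * (m (n - a) + K (n - a)) :=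
        mul_le_mul h1 h6 (norm_nonneg _) (mul_nonneg (hK0' a ha).1 hq0)
      have h11 := mul_le_mul_of_nonneg_left h2 (hm0 a)
      have h12 : (polyVar μ ((linPoly E.mat ^ a) j j)
          + polyVar μ ((linPoly E.mat ^ (n - a)) i i)) / 2 ≤ (Kv a * q + Kv (n - a) * q) / 2 := by
        simp only [polyVar]; linarith
      calc _ ≤ (Kv a * q + Kv (n - a) * q) / 2 + (K a * q) * (m (n - a) + K (n - a))
            + m a * (K (n - a) * q) := add_le_add (add_le_add (h5.trans h12) h10) h11
        _ = T a * q := by rw [hT]; ring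
    have hsum : ∑ e, polyMean μ (MvPolynomial.pderiv e ((constPoly (E.mat e)
          * linPoly E.mat ^ (n + 1) : Matrix _ _ (MvPolynomial ι ℂ)) i i))
        - ∑ a ∈ Finset.range (n + 1), (m a * m (n - a) : ℂ)
        = ∑ a ∈ Finset.range (n + 1), (1 / (N : ℂ) * ∑ j,
            (polyMean μ ((linPoly E.mat ^ a) j j * (linPoly E.mat ^ (n - a)) i i)
              - (m a * m (n - a) : ℂ))
          + (E.κ : ℂ) / N * polyMean μ
            (((linPoly E.mat ^ a).transpose * linPoly E.mat ^ (n - a)) i i)) := by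
      rw [← map_sum, E.sum_pderiv_const_mul_pow, map_sum, ← Finset.sum_sub_distrib]
      refine Finset.sum_congr rfl fun a _ => ?_
      rw [map_add, ← MvPolynomial.smul_eq_C_mul, ← MvPolynomial.smul_eq_C_mul, map_smul, map_smul,
        Matrix.trace, Finset.sum_mul, map_sum, Finset.sum_sub_distrib]
      simp only [Matrix.diag_apply, smul_eq_mul, Finset.sum_const, Finset.card_univ,
        Fintype.card_fin, nsmul_eq_mul]
      field_simp
      ring
    have hmain : ‖∑ e, polyMean μ (MvPolynomial.pderiv e ((constPoly (E.mat e)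
          * linPoly E.mat ^ (n + 1) : Matrix _ _ (MvPolynomial ι ℂ)) i i))
        - ∑ a ∈ Finset.range (n + 1), (m a * m (n - a) : ℂ)‖
        ≤ ∑ a ∈ Finset.range (n + 1), (T a * q + Kn * q) := by
      rw [hsum]
      refine (norm_sum_le _ _).trans (Finset.sum_le_sum fun a ha => (norm_add_le _ _).trans ?_)
      refine add_le_add ?_ ?_
      · rw [norm_mul]
        have h1 : ‖∑ j, (polyMean μ ((linPoly E.mat ^ a) j j * (linPoly E.mat ^ (n - a)) i i)
              - (m a * m (n - a) : ℂ))‖ ≤ N * (T a * q) := by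
          refine (norm_sum_le _ _).trans ((Finset.sum_le_sum fun j _ => hprod a ha j).trans ?_)
          simp
        calc _ ≤ ‖1 / (N : ℂ)‖ * (N * (T a * q)) := mul_le_mul_of_nonneg_left h1 (norm_nonneg _)
          _ = T a * q := by
            simp only [norm_div, norm_one, Complex.norm_natCast]; field_simp
      · rw [norm_mul]
        have h2 := (E.norm_polyMean_transpose_mul_le hlaw hN a (n - a) i)
        have h3 : a + (n - a) = n := by have := Finset.mem_range.1 ha; omega
        rw [h3] at h2
        have h4 := h2.trans (hKn N hN ι E)
        have h5 : ‖(E.κ : ℂ) / N‖ ≤ 1 / N := by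
          rw [norm_div, Complex.norm_real, Complex.norm_natCast,
            Real.norm_of_nonneg E.κ_nonneg]
          exact div_le_div_of_nonneg_right E.κ_le_one hN0.le
        calc _ ≤ 1 / (N : ℝ) * (Kn * Real.sqrt N) :=
              mul_le_mul h5 h4 (norm_nonneg _) (by positivity)
          _ = Kn * q := by rw [hq]; ring
    have hrem := (E.sum_norm_remainder_le hv hβ hMβ (n := n) (by omega) i).trans
      (mul_le_mul_of_nonneg_left (hK3 N hN ι E i) (by positivity))
    have hsplit : polyMean μ ((linPoly E.mat ^ (n + 2)) i i) - (m (n + 2) : ℂ)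
        = ∑ e, (polyMean μ (MvPolynomial.X e * (constPoly (E.mat e) * linPoly E.mat ^ (n + 1) :
            Matrix _ _ (MvPolynomial ι ℂ)) i i)
          - ((σ ^ 2 : ℝ) : ℂ) * polyMean μ (MvPolynomial.pderiv e ((constPoly (E.mat e)
            * linPoly E.mat ^ (n + 1) : Matrix _ _ (MvPolynomial ι ℂ)) i i)))
        + ((σ ^ 2 : ℝ) : ℂ) * (∑ e, polyMean μ (MvPolynomial.pderiv e ((constPoly (E.mat e)
          * linPoly E.mat ^ (n + 1) : Matrix _ _ (MvPolynomial ι ℂ)) i i))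
          - ∑ a ∈ Finset.range (n + 1), (m a * m (n - a) : ℂ)) := by
      rw [E.polyMean_pow_add_two, Finset.sum_sub_distrib, ← Finset.mul_sum, hm,
        semiMoment_add_two]
      push_cast
      ring
    rw [hsplit]
    refine (norm_add_le _ _).trans ?_
    rw [norm_mul, Complex.norm_real, Real.norm_of_nonneg hv.le]
    have h1 := (norm_sum_le _ _).trans hrem
    have h2 := mul_le_mul_of_nonneg_left hmain hv.le
    refine (add_le_add h1 h2).trans (le_of_eq ?_)
    rw [← hq]
    simp_rw [← add_mul]
    rw [← Finset.sum_mul]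
    ring

end DiagonalLimit

/-! ### Probability that a bilinear moment deviates. -/

section MomentConcentration

variable {μ : Measure ℝ} {σ : ℝ}

theorem tendsto_mul_sqrt_div (K : ℝ) :
    Tendsto (fun N : ℕ => K * Real.sqrt N / N) atTop (nhds 0) := by
  have h1 : Tendsto (fun N : ℕ => K * (Real.sqrt N)⁻¹) atTop (nhds (K * 0)) :=
    (tendsto_inv_atTop_zero.comp (Real.tendsto_sqrt_atTop.comp tendsto_natCast_atTop_atTop)).const_mul K
  rw [mul_zero] at h1
  refine h1.congr fun N => ?_
  rw [mul_div_assoc, Real.sqrt_div_self', one_div]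

/-- The mean of u* Xᵏ w is within η/2 of its limit for large N, as off-diagonal means vanish and Σ
|u_i||w_i| ≤ 1. Markov's inequality for the fourth central moment handles the fluctuation η/2. -/
theorem IsEntryLaw.exists_moment_tail_le (h : IsEntryLaw μ σ) (hσ : 0 < σ) (k : ℕ) {η : ℝ}
    (hη : 0 < η) : ∃ K : ℝ, 0 ≤ K ∧ ∀ᶠ N : ℕ in atTop, ∀ (ι : Type) [Fintype ι] [DecidableEq ι]
      (E : EdgeModel N ι) (u w : Fin N → ℂ), ‖WithLp.toLp 2 u‖ ≤ 1 → ‖WithLp.toLp 2 w‖ ≤ 1 →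
      (Measure.pi fun _ : ι => μ).real {x | η ≤ ‖star u ⬝ᵥ (linMat E.mat x ^ k).mulVec w
        - semiMoment (σ ^ 2) k * (star u ⬝ᵥ w)‖} ≤ K * Real.sqrt N / N ^ 2 := by
  obtain ⟨K, hK0, hK⟩ := h.exists_fourth_moment_le hσ k
  obtain ⟨K', hK0', hK'⟩ := h.exists_diag_mean_le hσ k
  have hprob := h.isProbabilityMeasure
  refine ⟨K / (η / 2) ^ 4, by positivity, ?_⟩
  filter_upwards [(tendsto_mul_sqrt_div K').eventually_lt_const (half_pos hη),
    eventually_gt_atTop 0] with N hNη hN ι _ _ E u w hu hw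
  set P := bilPoly u w (linPoly E.mat ^ k) with hP
  have hmean : ‖polyMean μ P - semiMoment (σ ^ 2) k * (star u ⬝ᵥ w)‖ ≤ η / 2 := by
    have h1 : polyMean μ P - semiMoment (σ ^ 2) k * (star u ⬝ᵥ w)
        = ∑ i, star (u i) * w i
          * (polyMean μ ((linPoly E.mat ^ k) i i) - semiMoment (σ ^ 2) k) := by
      rw [hP, polyMean_bilPoly, dotProduct, Finset.mul_sum, ← Finset.sum_sub_distrib]
      refine Finset.sum_congr rfl fun i _ => ?_
      rw [Finset.sum_eq_single i]
      · rw [Pi.star_apply]; ring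
      · intro j _ hj
        rw [E.polyMean_pow_apply_of_ne h.isSymmLaw hj.symm, mul_zero]
      · simp
    rw [h1]
    refine (norm_sum_le _ _).trans ?_
    have h2 : ∀ i, ‖star (u i) * w i * (polyMean μ ((linPoly E.mat ^ k) i i)
        - semiMoment (σ ^ 2) k)‖ ≤ (‖u i‖ ^ 2 + ‖w i‖ ^ 2) / 2 * (K' * Real.sqrt N / N) := by
      intro i
      rw [norm_mul, norm_mul, norm_star]
      refine mul_le_mul ?_ (hK' N hN ι E i) (norm_nonneg _) (by positivity)
      nlinarith [sq_nonneg (‖u i‖ - ‖w i‖)]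
    refine (Finset.sum_le_sum fun i _ => h2 i).trans ?_
    rw [← Finset.sum_mul, ← Finset.sum_div, Finset.sum_add_distrib]
    have h3 : ∀ y : Fin N → ℂ, ‖WithLp.toLp 2 y‖ ≤ 1 → ∑ i, ‖y i‖ ^ 2 ≤ 1 := fun y hy => by
      have := EuclideanSpace.norm_sq_eq (WithLp.toLp 2 y)
      simp only at this
      rw [← this]
      exact pow_le_one₀ (norm_nonneg _) hy
    have h4 : (∑ i, ‖u i‖ ^ 2 + ∑ i, ‖w i‖ ^ 2) / 2 ≤ 1 := by linarith [h3 u hu, h3 w hw]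
    exact (mul_le_of_le_one_left (by positivity) h4).trans hNη.le
  have hev : ∀ x, evalAt x P = star u ⬝ᵥ (linMat E.mat x ^ k).mulVec w := fun x => by
    rw [hP, evalAt_bilPoly, Matrix.map_pow, linPoly_map_evalAt]
  have hint : Integrable (fun x => ‖evalAt x P - polyMean μ P‖ ^ 4)
      (Measure.pi fun _ : ι => μ) := by
    set G := P - MvPolynomial.C (polyMean μ P) with hG
    have := integrable_norm_sq_evalAt h.isSymmLaw (G * G)
    refine this.congr (Eventually.of_forall fun x => ?_)
    simp only [hG, map_mul, map_sub, evalAt_C, norm_mul]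
    ring
  have hnn : ∀ x : ι → ℝ, 0 ≤ ‖evalAt x P - polyMean μ P‖ ^ 4 := fun x => by positivity
  have hmarkov := mul_meas_ge_le_integral_of_nonneg (μ := Measure.pi fun _ : ι => μ)
    (f := fun x => ‖evalAt x P - polyMean μ P‖ ^ 4)
    (Eventually.of_forall hnn) hint ((η / 2) ^ 4)
  have hsub : {x : ι → ℝ | η ≤ ‖star u ⬝ᵥ (linMat E.mat x ^ k).mulVec w
        - semiMoment (σ ^ 2) k * (star u ⬝ᵥ w)‖}
      ⊆ {x | (η / 2) ^ 4 ≤ ‖evalAt x P - polyMean μ P‖ ^ 4} := by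
    intro x hx
    have hx' : η ≤ ‖star u ⬝ᵥ (linMat E.mat x ^ k).mulVec w
        - semiMoment (σ ^ 2) k * (star u ⬝ᵥ w)‖ := hx
    rw [← hev] at hx'
    refine pow_le_pow_left₀ (half_pos hη).le (?_ : η / 2 ≤ ‖evalAt x P - polyMean μ P‖) 4
    have := norm_sub_le_norm_sub_add_norm_sub (evalAt x P) (polyMean μ P)
      (semiMoment (σ ^ 2) k * (star u ⬝ᵥ w))
    linarith
  refine (measureReal_mono hsub).trans ?_
  have h5 := hmarkov.trans (hK N hN ι E u w hu hw)
  have h6 : 0 < (η / 2) ^ 4 := by positivity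
  rw [← mul_le_mul_iff_right₀ h6]
  refine h5.trans (le_of_eq ?_)
  field_simp

end MomentConcentration

/-! ### The Stieltjes transform of the semicircle law outside its support. -/

section Stieltjes

/-- By the recursion, a partial sum S of n + 2 terms is at most y + σ² y S'², S' being the sum of n
terms. The bound S' ≤ 1/σ reproduces itself since 2y ≤ 1/σ, even at the edge of the support. -/
theorem sum_semiMoment_le {σ : ℝ} (hσ : 0 < σ) {y : ℝ} (hy : 0 ≤ y) (hyσ : 2 * σ * y ≤ 1) (n : ℕ) :
    ∑ k ∈ Finset.range n, semiMoment (σ ^ 2) k * y ^ (k + 1) ≤ 1 / σ := by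
  have hm := semiMoment_nonneg (v := σ ^ 2) (by positivity)
  have hy2 : 2 * y ≤ 1 / σ := by rw [le_div_iff₀ hσ]; linarith
  induction n using Nat.twoStepInduction with
  | zero => simp; positivity
  | one => simp [semiMoment_zero]; rw [← one_div]; linarith
  | more n ih _ =>
    rw [Finset.sum_range_succ', Finset.sum_range_succ']
    simp only [semiMoment_zero, semiMoment_one, zero_add, zero_mul, add_zero, pow_one, one_mul]
    set f : ℕ → ℝ := fun k => semiMoment (σ ^ 2) k * y ^ (k + 1) with hf
    have hf0 : ∀ k, 0 ≤ f k := fun k => mul_nonneg (hm k) (by positivity)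
    have h1 : ∀ k, semiMoment (σ ^ 2) (k + 1 + 1) * y ^ (k + 1 + 1 + 1)
        = σ ^ 2 * y * ∑ a ∈ Finset.range (k + 1), f a * f (k - a) := by
      intro k
      rw [semiMoment_add_two, Finset.mul_sum, Finset.mul_sum, Finset.sum_mul]
      refine Finset.sum_congr rfl fun a ha => ?_
      have h2 : y ^ (k + 1 + 1 + 1) = y * (y ^ (a + 1) * y ^ (k - a + 1)) := by
        rw [← pow_add, ← pow_succ']; congr 1; have := Finset.mem_range.1 ha; omega
      rw [h2, hf]; ring
    simp_rw [h1]
    rw [← Finset.mul_sum, Finset.sum_range_diag_flip n fun a b => f a * f b]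
    have h3 : ∑ a ∈ Finset.range n, ∑ b ∈ Finset.range (n - a), f a * f b
        ≤ (∑ a ∈ Finset.range n, f a) ^ 2 := by
      rw [sq, Finset.sum_mul_sum]
      refine Finset.sum_le_sum fun a _ => Finset.sum_le_sum_of_subset_of_nonneg
        (Finset.range_mono (Nat.sub_le n a)) fun b _ _ => mul_nonneg (hf0 a) (hf0 b)
    have h4 : (∑ a ∈ Finset.range n, f a) ^ 2 ≤ (1 / σ) ^ 2 :=
      pow_le_pow_left₀ (Finset.sum_nonneg fun a _ => hf0 a) ih 2
    calc σ ^ 2 * y * ∑ a ∈ Finset.range n, ∑ b ∈ Finset.range (n - a), f a * f b + y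
        ≤ σ ^ 2 * y * (1 / σ) ^ 2 + y := by gcongr; exact h3.trans h4
      _ = 2 * y := by field_simp; ring
      _ ≤ _ := hy2

theorem summable_semiMoment {σ : ℝ} (hσ : 0 < σ) {y : ℝ} (hyσ : 2 * σ * |y| ≤ 1) :
    Summable fun k => ‖semiMoment (σ ^ 2) k * y ^ (k + 1)‖ := by
  have hm := semiMoment_nonneg (v := σ ^ 2) (by positivity)
  refine summable_of_sum_range_le (c := 1 / σ) (fun k => norm_nonneg _) fun n => ?_
  refine le_trans (le_of_eq ?_) (sum_semiMoment_le hσ (abs_nonneg y) hyσ n)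
  refine Finset.sum_congr rfl fun k _ => ?_
  rw [norm_mul, norm_pow, Real.norm_of_nonneg (hm k), Real.norm_eq_abs]

/-- The Stieltjes transform of the semicircle law of variance `v` at `1 / y`, as a power series. -/
noncomputable def semiSeries (v y : ℝ) : ℝ := ∑' k, semiMoment v k * y ^ (k + 1)

theorem abs_semiSeries_le {σ : ℝ} (hσ : 0 < σ) {y : ℝ} (hyσ : 2 * σ * |y| ≤ 1) :
    |semiSeries (σ ^ 2) y| ≤ 1 / σ := by
  have hm := semiMoment_nonneg (v := σ ^ 2) (by positivity)
  refine (norm_tsum_le_tsum_norm (summable_semiMoment hσ hyσ)).trans ?_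
  refine Real.tsum_le_of_sum_range_le (fun k => norm_nonneg _) fun n => ?_
  refine le_trans (le_of_eq ?_) (sum_semiMoment_le hσ (abs_nonneg y) hyσ n)
  refine Finset.sum_congr rfl fun k _ => ?_
  rw [norm_mul, norm_pow, Real.norm_of_nonneg (hm k), Real.norm_eq_abs]

/-- The semicircle recursion says that the Cauchy square of the series, multiplied by σ² y, is the
series without its first two terms, which are y and 0. -/
theorem semiSeries_eq {σ : ℝ} (hσ : 0 < σ) {y : ℝ} (hyσ : 2 * σ * |y| ≤ 1) :
    semiSeries (σ ^ 2) y = y * (1 + σ ^ 2 * semiSeries (σ ^ 2) y ^ 2) := by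
  have hs := summable_semiMoment hσ hyσ
  have hs' : Summable fun k => semiMoment (σ ^ 2) k * y ^ (k + 1) := hs.of_norm
  have h1 := tsum_mul_tsum_eq_tsum_sum_range_of_summable_norm hs hs
  have h2 := hs'.sum_add_tsum_nat_add 2
  simp only [Finset.sum_range_succ, Finset.sum_range_zero, semiMoment_zero, semiMoment_one,
    zero_add, zero_mul, add_zero, pow_one, one_mul] at h2
  have h3 : ∀ k, semiMoment (σ ^ 2) (k + 2) * y ^ (k + 2 + 1)
      = σ ^ 2 * y * ∑ a ∈ Finset.range (k + 1), semiMoment (σ ^ 2) a * y ^ (a + 1)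
        * (semiMoment (σ ^ 2) (k - a) * y ^ (k - a + 1)) := by
    intro k
    rw [semiMoment_add_two, Finset.mul_sum, Finset.mul_sum, Finset.sum_mul]
    refine Finset.sum_congr rfl fun a ha => ?_
    have h2 : y ^ (k + 2 + 1) = y * (y ^ (a + 1) * y ^ (k - a + 1)) := by
      rw [← pow_add, ← pow_succ']; congr 1; have := Finset.mem_range.1 ha; omega
    rw [h2]; ring
  simp_rw [h3] at h2
  rw [tsum_mul_left, ← h1] at h2
  change y + σ ^ 2 * y * (semiSeries (σ ^ 2) y * semiSeries (σ ^ 2) y) = semiSeries (σ ^ 2) y at h2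
  linarith

/-- Weierstrass: the tail at |y| ≤ y₀ is dominated by the tail at y₀, so one truncation order serves
all x outside the enlarged support. -/
theorem exists_semiSeries_sub_le {σ : ℝ} (hσ : 0 < σ) {y₀ : ℝ} (hy₀ : 0 ≤ y₀)
    (hyσ : 2 * σ * y₀ ≤ 1) {τ : ℝ} (hτ : 0 < τ) :
    ∀ᶠ n : ℕ in atTop, ∀ y : ℝ, |y| ≤ y₀ →
      |semiSeries (σ ^ 2) y - ∑ k ∈ Finset.range n, semiMoment (σ ^ 2) k * y ^ (k + 1)| ≤ τ := by
  have hm := semiMoment_nonneg (v := σ ^ 2) (by positivity)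
  have hs0 := summable_semiMoment hσ (y := y₀) (by rwa [abs_of_nonneg hy₀])
  have ht := tendsto_sum_nat_add fun k => ‖semiMoment (σ ^ 2) k * y₀ ^ (k + 1)‖
  filter_upwards [ht.eventually_le_const hτ] with n hn y hy
  have hs := summable_semiMoment hσ (y := y)
    ((mul_le_mul_of_nonneg_left hy (by positivity)).trans hyσ)
  have h1 := hs.of_norm.sum_add_tsum_nat_add n
  rw [semiSeries, ← h1, add_sub_cancel_left]
  have hsn := (summable_nat_add_iff n).2 hs
  refine (norm_tsum_le_tsum_norm hsn).trans (le_trans ?_ hn)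
  refine hsn.tsum_le_tsum (fun k => ?_) ((summable_nat_add_iff n).2 hs0)
  rw [norm_mul, norm_mul, norm_pow, norm_pow]
  refine mul_le_mul_of_nonneg_left (pow_le_pow_left₀ (norm_nonneg _) ?_ _) (norm_nonneg _)
  rwa [Real.norm_eq_abs, Real.norm_of_nonneg hy₀]

end Stieltjes

/-! ### Deterministic location of outliers. -/

section Outliers

/-- With h = 1/g the equation of the series reads x = h + σ²/h with |h| ≥ σ. If 1 - t g is small, t
is close to h, and t ↦ t + σ²/t is 2-Lipschitz at the relevant scale. -/
theorem exists_outlier_tolerance {σ ε T : ℝ} (hσ : 0 < σ) (hε : 0 < ε) (hT : 0 < T) :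
    ∃ τ : ℝ, 0 < τ ∧ ∀ x t : ℝ, 2 * σ + ε ≤ |x| → |t| ≤ T →
      |1 - t * semiSeries (σ ^ 2) x⁻¹| ≤ τ → σ < |t| ∧ |x - outlierLocation σ t| ≤ ε := by
  have hs : 0 < Real.sqrt (σ * ε) := Real.sqrt_pos.2 (by positivity)
  refine ⟨min (1 / 2) (min (Real.sqrt (σ * ε) / (4 * T)) (ε / (4 * T))), by positivity,
    fun x t hx ht hτ => ?_⟩
  obtain ⟨τ, hτe⟩ : ∃ τ, τ = min (1 / 2) (min (Real.sqrt (σ * ε) / (4 * T)) (ε / (4 * T))) :=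
    ⟨_, rfl⟩
  rw [← hτe] at hτ
  have hτ1 : τ ≤ 1 / 2 := hτe ▸ min_le_left _ _
  have hτ2 : τ * (4 * T) ≤ Real.sqrt (σ * ε) := by
    rw [← le_div_iff₀ (by positivity)]
    exact hτe ▸ (min_le_right _ _).trans (min_le_left _ _)
  have hτ3 : τ * (4 * T) ≤ ε := by
    rw [← le_div_iff₀ (by positivity)]
    exact hτe ▸ (min_le_right _ _).trans (min_le_right _ _)
  have hx0 : 0 < |x| := by linarith
  have hxne : x ≠ 0 := abs_pos.1 hx0
  have hy : 2 * σ * |x⁻¹| ≤ 1 := by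
    rw [abs_inv, ← div_eq_mul_inv, div_le_one hx0]; linarith
  set g := semiSeries (σ ^ 2) x⁻¹ with hg
  have hge := semiSeries_eq hσ hy
  have hgb := abs_semiSeries_le hσ hy
  rw [← hg] at hge hgb
  have hg0 : g ≠ 0 := by
    intro h0
    rw [h0] at hge
    simp at hge
    exact hxne hge.symm
  obtain ⟨h, hh⟩ : ∃ h, h = g⁻¹ := ⟨_, rfl⟩
  have hgh : g = h⁻¹ := by rw [hh, inv_inv]
  have hh0 : h ≠ 0 := hh ▸ inv_ne_zero hg0
  have hhp : 0 < |h| := abs_pos.2 hh0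
  have hxh : x = h + σ ^ 2 / h := by
    rw [hgh] at hge
    field_simp at hge
    field_simp
    linarith
  have hhσ : σ ≤ |h| := by
    rw [hgh, abs_inv, inv_eq_one_div, one_div_le_one_div hhp hσ] at hgb
    exact hgb
  have hxabs : |x| ≤ |h| + σ ^ 2 / |h| := by
    rw [hxh]
    refine (abs_add_le _ _).trans (le_of_eq ?_)
    rw [abs_div, abs_of_pos (by positivity : 0 < σ ^ 2)]
  -- From |h|(2σ + ε) ≤ |h|² + σ²: the distance of x to the support keeps |h| above σ by √(σε). The
  -- second entry of the minimum defining τ lets t move by at most half of that.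
  have hsq : σ * ε ≤ (|h| - σ) ^ 2 := by
    have h1 : |h| * (2 * σ + ε) ≤ |h| * (|h| + σ ^ 2 / |h|) :=
      mul_le_mul_of_nonneg_left (hx.trans hxabs) hhp.le
    have h2 : |h| * (|h| + σ ^ 2 / |h|) = |h| ^ 2 + σ ^ 2 := by field_simp
    have h3 : σ * ε ≤ |h| * ε := mul_le_mul_of_nonneg_right hhσ hε.le
    nlinarith
  have hsqrt : Real.sqrt (σ * ε) ≤ |h| - σ := Real.sqrt_le_iff.2 ⟨by linarith, hsq⟩
  have hht : |h - t| ≤ τ * |h| := by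
    have h1 : h - t = (1 - t * g) * h := by rw [hgh]; field_simp
    rw [h1, abs_mul]
    exact mul_le_mul_of_nonneg_right hτ hhp.le
  have h4 : |h| - |t| ≤ |h - t| := abs_sub_abs_le_abs_sub h t
  -- As τ ≤ 1/2, |h| - T ≤ |h|/2.
  have hh2 : |h| ≤ 2 * T := by nlinarith
  have hτ0 : 0 ≤ τ := (abs_nonneg _).trans hτ
  have hht2 : |h - t| ≤ τ * (2 * T) := hht.trans (mul_le_mul_of_nonneg_left hh2 hτ0)
  have htσ : σ < |t| := by nlinarith
  refine ⟨htσ, ?_⟩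
  have ht0 : t ≠ 0 := abs_pos.1 (hσ.trans htσ)
  have h5 : x - outlierLocation σ t = (h - t) * (1 - σ ^ 2 / (h * t)) := by
    rw [hxh, outlierLocation]; field_simp; ring
  have h6 : |1 - σ ^ 2 / (h * t)| ≤ 2 := by
    have h7 : |σ ^ 2 / (h * t)| ≤ 1 := by
      rw [abs_div, abs_mul, abs_of_pos (by positivity : 0 < σ ^ 2), div_le_one (by positivity), sq]
      exact mul_le_mul hhσ htσ.le hσ.le hhp.le
    calc |1 - σ ^ 2 / (h * t)| ≤ |1| + |σ ^ 2 / (h * t)| := abs_sub _ _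
      _ ≤ 2 := by rw [abs_one]; linarith
  rw [h5, abs_mul]
  calc |h - t| * |1 - σ ^ 2 / (h * t)| ≤ τ * (2 * T) * 2 :=
        mul_le_mul hht2 h6 (abs_nonneg _) (by positivity)
    _ ≤ ε := by linarith

open scoped Matrix.Norms.L2Operator

variable {N : ℕ}

/-- A Neumann series stopped after n steps with exact remainder, so no resolvent of X is needed. -/
theorem eigenvector_expansion {X : Matrix (Fin N) (Fin N) ℂ} {ψ f : Fin N → ℂ} {y : ℂ}
    (h : ψ = y • (X.mulVec ψ + f)) (n : ℕ) :
    ψ = y ^ n • (X ^ n).mulVec ψ + ∑ k ∈ Finset.range n, y ^ (k + 1) • (X ^ k).mulVec f := by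
  induction n with
  | zero => simp
  | succ n ih =>
    have h1 : (X ^ n).mulVec ψ = y • ((X ^ (n + 1)).mulVec ψ + (X ^ n).mulVec f) := by
      conv_lhs => rw [h]
      rw [Matrix.mulVec_smul, Matrix.mulVec_add, Matrix.mulVec_mulVec, ← pow_succ]
    rw [Finset.sum_range_succ]
    conv_lhs => rw [ih, h1]
    rw [smul_smul, ← pow_succ, smul_add]
    abel

/-- Pairing the truncated expansion of ψ with u_a gives a nearly diagonal system for the finitely
many numbers u_a*ψ. Taking the largest of them makes all errors relative to it, and avoids
determinants. -/
theorem exists_outlier_criterion {σ ε T : ℝ} (hσ : 0 < σ) (hε : 0 < ε) (hT : 0 < T) (r : ℕ) :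
    ∃ n : ℕ, ∃ η : ℝ, 0 < η ∧ ∀ (N : ℕ) (X A : Matrix (Fin N) (Fin N) ℂ) (S : Finset (Fin N))
      (t : Fin N → ℝ) (u : Fin N → Fin N → ℂ), ‖X‖ ≤ 2 * σ + ε / 2 → S.card ≤ r →
      (∀ a ∈ S, |t a| ≤ T) → (∀ a ∈ S, ‖WithLp.toLp 2 (u a)‖ ≤ 1) →
      (∀ ψ, A.mulVec ψ = ∑ a ∈ S, ((t a : ℂ) * (star (u a) ⬝ᵥ ψ)) • u a) →
      (∀ k < n, ∀ a ∈ S, ∀ b ∈ S, ‖star (u a) ⬝ᵥ (X ^ k).mulVec (u b)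
        - semiMoment (σ ^ 2) k * (if a = b then 1 else 0)‖ ≤ η) →
      ∀ (x : ℝ) (ψ : Fin N → ℂ), ψ ≠ 0 → (X + A).mulVec ψ = (x : ℂ) • ψ → 2 * σ + ε ≤ |x| →
      ∃ a ∈ S, σ < |t a| ∧ |x - outlierLocation σ (t a)| ≤ ε := by
  obtain ⟨τ, hτ, hτx⟩ := exists_outlier_tolerance hσ hε hT
  set R := 2 * σ + ε with hR
  set s := 2 * σ + ε / 2 with hs
  have hR0 : 0 < R := by positivity
  have hs0 : 0 < s := by positivity
  have hsR : s / R < 1 := (div_lt_one hR0).2 (by rw [hs, hR]; linarith)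
  have hlim : Tendsto (fun n : ℕ => (s / R) ^ n * (2 * (r * T) / ε)) atTop (nhds 0) := by
    have := (tendsto_pow_atTop_nhds_zero_of_lt_one (by positivity) hsR).mul_const
      (2 * (r * T) / ε)
    rwa [zero_mul] at this
  have hRσ : 2 * σ * R⁻¹ ≤ 1 := by
    rw [← div_eq_mul_inv, div_le_one hR0, hR]; linarith
  -- The order n makes both the Neumann remainder and the tail of the series small, using one third
  -- of τ each; the last third is spent on the moment errors through η.
  obtain ⟨n, hn1, hn2⟩ := ((hlim.eventually_le_const (by positivity : 0 < τ / 3)).and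
    (exists_semiSeries_sub_le hσ (inv_nonneg.2 hR0.le) hRσ
      (by positivity : 0 < τ / (3 * T)))).exists
  set Z := r * T * ∑ k ∈ Finset.range n, R⁻¹ ^ (k + 1) with hZ
  have hZ0 : 0 ≤ Z := by positivity
  refine ⟨n, τ / 3 / (Z + 1), by positivity, fun N X A S t u hX hS ht hu hA hm x ψ hψ hx hxR => ?_⟩
  set η := τ / 3 / (Z + 1) with hη
  have hη0 : 0 ≤ η := by positivity
  have hηZ : η * Z ≤ τ / 3 := by
    rw [hη, div_mul_eq_mul_div, div_le_iff₀ (by positivity)]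
    nlinarith
  have hx0 : 0 < |x| := hR0.trans_le hxR
  have hxne : (x : ℂ) ≠ 0 := by exact_mod_cast abs_pos.1 hx0
  set φ : Fin N → ℂ := fun a => star (u a) ⬝ᵥ ψ with hφ
  have hy : ‖(x : ℂ)⁻¹‖ ≤ R⁻¹ := by
    rw [norm_inv, Complex.norm_real, Real.norm_eq_abs]
    exact inv_anti₀ hR0 hxR
  have hψ0 : 0 < ‖WithLp.toLp 2 ψ‖ := by
    rw [norm_pos_iff]
    intro h0
    exact hψ (by simpa using congrArg WithLp.ofLp h0)
  have hAψ : ∀ c, 0 ≤ c → (∀ a ∈ S, ‖φ a‖ ≤ c) → ‖WithLp.toLp 2 (A.mulVec ψ)‖ ≤ r * T * c := by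
    intro c hc0 hc
    rw [hA, WithLp.toLp_sum]
    refine (norm_sum_le _ _).trans ((Finset.sum_le_sum (g := fun _ => T * c) fun a ha => ?_).trans ?_)
    · rw [WithLp.toLp_smul, norm_smul, norm_mul, Complex.norm_real, Real.norm_eq_abs]
      calc |t a| * ‖φ a‖ * ‖WithLp.toLp 2 (u a)‖ ≤ T * c * 1 := by
            have h1 := ht a ha
            have h2 := hc a ha
            have h3 := hu a ha
            gcongr
        _ = T * c := mul_one _
    · rw [Finset.sum_const, nsmul_eq_mul, mul_assoc]
      have : (S.card : ℝ) ≤ r := by exact_mod_cast hS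
      gcongr
  -- Since |x| exceeds ‖X‖ by ε/2, Aψ cannot be small; this bounds ‖ψ‖ by the largest coefficient
  -- and makes that coefficient nonzero.
  have hlow : ε / 2 * ‖WithLp.toLp 2 ψ‖ ≤ ‖WithLp.toLp 2 (A.mulVec ψ)‖ := by
    have h1 : WithLp.toLp 2 ((x : ℂ) • ψ) = WithLp.toLp 2 (X.mulVec ψ) + WithLp.toLp 2 (A.mulVec ψ) := by
      rw [← hx, Matrix.add_mulVec, WithLp.toLp_add]
    have h2 : |x| * ‖WithLp.toLp 2 ψ‖ ≤ ‖WithLp.toLp 2 (X.mulVec ψ)‖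
        + ‖WithLp.toLp 2 (A.mulVec ψ)‖ := by
      have h3 := norm_add_le (WithLp.toLp 2 (X.mulVec ψ)) (WithLp.toLp 2 (A.mulVec ψ))
      rwa [← h1, WithLp.toLp_smul, norm_smul, Complex.norm_real, Real.norm_eq_abs] at h3
    have h4 : ‖WithLp.toLp 2 (X.mulVec ψ)‖ ≤ s * ‖WithLp.toLp 2 ψ‖ :=
      (Matrix.l2_opNorm_mulVec X (WithLp.toLp 2 ψ)).trans
        (mul_le_mul_of_nonneg_right hX (norm_nonneg _))
    have h5 := mul_le_mul_of_nonneg_right hxR (norm_nonneg (WithLp.toLp 2 ψ))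
    rw [hR] at h5
    rw [hs] at h4
    linarith
  have hSne : S.Nonempty := by
    by_contra hne
    rw [Finset.not_nonempty_iff_eq_empty] at hne
    have h1 : A.mulVec ψ = 0 := by rw [hA, hne, Finset.sum_empty]
    rw [h1, WithLp.toLp_zero, norm_zero] at hlow
    have : 0 < ε / 2 * ‖WithLp.toLp 2 ψ‖ := by positivity
    linarith
  obtain ⟨a, ha, hmax⟩ := S.exists_max_image (fun a => ‖φ a‖) hSne
  have hψφ : ε / 2 * ‖WithLp.toLp 2 ψ‖ ≤ r * T * ‖φ a‖ := hlow.trans (hAψ _ (norm_nonneg _) hmax)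
  have hφa : 0 < ‖φ a‖ := by
    by_contra hneg
    have h0 : ‖φ a‖ = 0 := le_antisymm (not_lt.1 hneg) (norm_nonneg _)
    rw [h0, mul_zero] at hψφ
    have : 0 < ε / 2 * ‖WithLp.toLp 2 ψ‖ := by positivity
    linarith
  refine ⟨a, ha, hτx x (t a) hxR (ht a ha) ?_⟩
  set y : ℂ := (x : ℂ)⁻¹ with hyd
  set gn : ℝ := ∑ k ∈ Finset.range n, semiMoment (σ ^ 2) k * x⁻¹ ^ (k + 1) with hgn
  have hexp := eigenvector_expansion (X := X) (ψ := ψ) (f := A.mulVec ψ) (y := y)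
    (by rw [← Matrix.add_mulVec, hx, smul_smul, hyd, inv_mul_cancel₀ hxne, one_smul]) n
  -- Replacing u_a* Xᵏ u_b by its limit m_k δ_ab in the expansion leaves only b = a, which is moved
  -- to the left; the right side consists of the errors.
  have hkey : φ a * (1 - t a * gn : ℝ) = y ^ n * (star (u a) ⬝ᵥ (X ^ n).mulVec ψ)
      + ∑ k ∈ Finset.range n, y ^ (k + 1) * ∑ b ∈ S, t b * φ b *
        (star (u a) ⬝ᵥ (X ^ k).mulVec (u b)
          - semiMoment (σ ^ 2) k * (if a = b then 1 else 0)) := by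
    have h1 : φ a = y ^ n * (star (u a) ⬝ᵥ (X ^ n).mulVec ψ)
        + ∑ k ∈ Finset.range n, y ^ (k + 1) * ∑ b ∈ S, t b * φ b *
          (star (u a) ⬝ᵥ (X ^ k).mulVec (u b)) := by
      have h2 := congrArg (fun w => star (u a) ⬝ᵥ w) hexp
      simp only [dotProduct_add, dotProduct_smul, dotProduct_sum, smul_eq_mul] at h2
      refine h2.trans ?_
      congr 1
      refine Finset.sum_congr rfl fun k _ => ?_
      rw [hA, Matrix.mulVec_sum, dotProduct_sum]
      congr 1
      refine Finset.sum_congr rfl fun b _ => ?_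
      rw [Matrix.mulVec_smul, dotProduct_smul, smul_eq_mul]
    have h3 : φ a * (t a * gn : ℝ) = ∑ k ∈ Finset.range n, y ^ (k + 1) * ∑ b ∈ S, t b * φ b *
          (semiMoment (σ ^ 2) k * (if a = b then 1 else 0)) := by
      rw [hgn, Complex.ofReal_mul, Complex.ofReal_sum, Finset.mul_sum, Finset.mul_sum]
      refine Finset.sum_congr rfl fun k _ => ?_
      rw [Finset.sum_eq_single a]
      · simp only [if_true, hyd]
        push_cast
        ring
      · intro b _ hb; simp [hb.symm]
      · intro h; exact absurd ha h
    have h4 : φ a * (1 - t a * gn : ℝ) = φ a - φ a * (t a * gn : ℝ) := by push_cast; ring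
    rw [h4, h3]
    conv_lhs => rw [h1]
    rw [add_sub_assoc, ← Finset.sum_sub_distrib]
    congr 1
    refine Finset.sum_congr rfl fun k _ => ?_
    rw [← mul_sub, ← Finset.sum_sub_distrib]
    congr 1
    exact Finset.sum_congr rfl fun b _ => by ring
  have hb1 : ‖y ^ n * (star (u a) ⬝ᵥ (X ^ n).mulVec ψ)‖ ≤ τ / 3 * ‖φ a‖ := by
    rw [norm_mul, norm_pow]
    have h1 : ‖star (u a) ⬝ᵥ (X ^ n).mulVec ψ‖ ≤ s ^ n * ‖WithLp.toLp 2 ψ‖ := by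
      refine (norm_dotProduct_le _ _).trans ?_
      have h2 : ‖WithLp.toLp 2 (star (u a))‖ = ‖WithLp.toLp 2 (u a)‖ := by
        simp [EuclideanSpace.norm_eq]
      rw [h2]
      refine (mul_le_of_le_one_left (norm_nonneg _) (hu a ha)).trans
        ((norm_pow_mulVec_le X n ψ).trans ?_)
      gcongr
    have h3 : ‖WithLp.toLp 2 ψ‖ ≤ 2 * (r * T) / ε * ‖φ a‖ := by
      rw [div_mul_eq_mul_div, le_div_iff₀ hε]; linarith
    calc ‖y‖ ^ n * ‖star (u a) ⬝ᵥ (X ^ n).mulVec ψ‖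
        ≤ R⁻¹ ^ n * (s ^ n * (2 * (r * T) / ε * ‖φ a‖)) := by
          refine mul_le_mul (pow_le_pow_left₀ (norm_nonneg _) hy n) (h1.trans ?_) (norm_nonneg _)
            (by positivity)
          gcongr
      _ = (s / R) ^ n * (2 * (r * T) / ε) * ‖φ a‖ := by rw [div_pow, inv_pow]; ring
      _ ≤ τ / 3 * ‖φ a‖ := by gcongr
  have hb2 : ‖∑ k ∈ Finset.range n, y ^ (k + 1) * ∑ b ∈ S, t b * φ b *
        (star (u a) ⬝ᵥ (X ^ k).mulVec (u b)
          - semiMoment (σ ^ 2) k * (if a = b then 1 else 0))‖ ≤ τ / 3 * ‖φ a‖ := by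
    calc _ ≤ ∑ k ∈ Finset.range n, R⁻¹ ^ (k + 1) * (r * (T * ‖φ a‖ * η)) := by
          refine (norm_sum_le _ _).trans (Finset.sum_le_sum fun k hk => ?_)
          rw [norm_mul, norm_pow]
          refine mul_le_mul (pow_le_pow_left₀ (norm_nonneg _) hy _) ?_ (norm_nonneg _)
            (by positivity)
          refine (norm_sum_le _ _).trans
            ((Finset.sum_le_sum (g := fun _ => T * ‖φ a‖ * η) fun b hb => ?_).trans ?_)
          · rw [norm_mul, norm_mul, Complex.norm_real, Real.norm_eq_abs]
            have h1 := ht b hb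
            have h2 := hmax b hb
            have h3 := hm k (Finset.mem_range.1 hk) a ha b hb
            exact mul_le_mul (mul_le_mul h1 h2 (norm_nonneg _) hT.le) h3 (norm_nonneg _)
              (mul_nonneg hT.le (norm_nonneg _))
          · rw [Finset.sum_const, nsmul_eq_mul]
            exact mul_le_mul_of_nonneg_right (Nat.cast_le.2 hS)
              (mul_nonneg (mul_nonneg hT.le (norm_nonneg _)) hη0)
      _ = η * Z * ‖φ a‖ := by rw [← Finset.sum_mul, hZ]; ring
      _ ≤ _ := by gcongr
  have hb3 : |1 - t a * gn| ≤ τ / 3 + τ / 3 := by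
    have h1 : ‖φ a‖ * |1 - t a * gn| ≤ τ / 3 * ‖φ a‖ + τ / 3 * ‖φ a‖ := by
      rw [← Real.norm_eq_abs, ← Complex.norm_real, ← norm_mul, hkey]
      exact (norm_add_le _ _).trans (add_le_add hb1 hb2)
    rw [← mul_le_mul_iff_right₀ hφa]
    linarith
  have hb4 := hn2 x⁻¹ (by rw [abs_inv]; exact inv_anti₀ hR0 hxR)
  rw [← hgn] at hb4
  have hb5 : |t a * (semiSeries (σ ^ 2) x⁻¹ - gn)| ≤ τ / 3 := by
    rw [abs_mul]
    calc _ ≤ T * (τ / (3 * T)) := mul_le_mul (ht a ha) hb4 (abs_nonneg _) hT.le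
      _ = τ / 3 := by field_simp
  have h6 : 1 - t a * semiSeries (σ ^ 2) x⁻¹
      = (1 - t a * gn) - t a * (semiSeries (σ ^ 2) x⁻¹ - gn) := by ring
  rw [h6]
  refine (abs_sub _ _).trans ?_
  linarith

end Outliers

/-! ### Matrices supported on a pair of positions. -/

section PairMatrices

variable {N : ℕ} {S : Type*}

/-- The matrix with entry `a` at `(i, j)` and entry `b` at `(j, i)`. -/
def pairMat [Zero S] (a b : S) (i j : Fin N) : Matrix (Fin N) (Fin N) S :=
  Matrix.of fun k l => if k = i ∧ l = j then a else if k = j ∧ l = i then b else 0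

theorem pairMat_apply [Zero S] (a b : S) (i j k l : Fin N) :
    pairMat a b i j k l = if k = i ∧ l = j then a else if k = j ∧ l = i then b else 0 := rfl

theorem pairMat_supported [Zero S] (a b : S) (i j : Fin N) : PairSupported (pairMat a b i j) i j := by
  intro k l h
  by_contra hne
  push Not at hne
  refine h ?_
  rw [pairMat_apply, if_neg fun h1 => hne.1 h1.1 h1.2, if_neg fun h1 => hne.2 h1.1 h1.2]

theorem pairMat_isHermitian {𝕜 : Type*} [RCLike 𝕜] {a b : 𝕜} {i j : Fin N} (hab : star a = b)
    (hij : i = j → a = b) : (pairMat a b i j).IsHermitian := by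
  have hba : star b = a := by rw [← hab, star_star]
  ext k l
  rw [Matrix.conjTranspose_apply, pairMat_apply, pairMat_apply]
  by_cases h1 : k = i ∧ l = j
  · obtain ⟨rfl, rfl⟩ := h1
    by_cases h2 : l = k
    · subst h2; have := hij rfl; subst this; simpa using hab
    · simp [h2, hba]
  · by_cases h2 : k = j ∧ l = i
    · obtain ⟨rfl, rfl⟩ := h2
      simp only [h1, and_self, if_true, if_false, hab]
    · have h3 : ¬ (l = i ∧ k = j) := fun h => h2 ⟨h.2, h.1⟩
      have h4 : ¬ (l = j ∧ k = i) := fun h => h1 ⟨h.2, h.1⟩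
      simp [h1, h2, h3, h4]

theorem pairMat_symm [Zero S] (a : S) (i j k l : Fin N) :
    pairMat a a i j k l = pairMat a a i j l k := by
  rw [pairMat_apply, pairMat_apply]
  by_cases h1 : k = i ∧ l = j <;> by_cases h2 : k = j ∧ l = i <;>
    simp [h1, h2, and_comm (a := l = i), and_comm (a := l = j)]

theorem norm_pairMat_le {𝕜 : Type*} [RCLike 𝕜] {a b : 𝕜} {d : ℝ} (ha : ‖a‖ ≤ d) (hb : ‖b‖ ≤ d)
    (i j k l : Fin N) : ‖pairMat a b i j k l‖ ≤ pairMat d d i j k l := by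
  rw [pairMat_apply, pairMat_apply]
  split_ifs <;> simp [ha, hb]

theorem pairMat_sq_le {d e : ℝ} (hd : d ^ 2 ≤ e) (i j k l : Fin N) :
    pairMat d d i j k l ^ 2 ≤ e := by
  rw [pairMat_apply]
  split_ifs
  · exact hd
  · exact hd
  · simpa using (sq_nonneg d).trans hd

variable [CommRing S]

theorem sum_mul_pairMat (f α β : Fin N × Fin N → S) (k l : Fin N) :
    ∑ p, f p * pairMat (α p) (β p) p.1 p.2 k l
      = if k = l then f (k, k) * α (k, k) else f (k, l) * α (k, l) + f (l, k) * β (l, k) := by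
  have h0 : ∀ p : Fin N × Fin N, p ≠ (k, l) → p ≠ (l, k) →
      f p * pairMat (α p) (β p) p.1 p.2 k l = 0 := by
    intro p h1 h2
    rw [pairMat_apply, if_neg fun h => h1 (Prod.ext h.1.symm h.2.symm),
      if_neg fun h => h2 (Prod.ext h.2.symm h.1.symm), mul_zero]
  split_ifs with hkl
  · subst hkl
    rw [Fintype.sum_eq_single (k, k) fun p hp => h0 p hp hp]
    simp [pairMat_apply]
  · rw [Fintype.sum_eq_add (k, l) (l, k) (fun h => hkl (congrArg Prod.fst h))
      fun p hp => h0 p hp.1 hp.2]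
    simp [pairMat_apply, hkl]

theorem sum_mul_pairMat_of_le (f α : {p : Fin N × Fin N // p.1 ≤ p.2} → S) {k l : Fin N}
    (hkl : k ≤ l) :
    ∑ p, f p * pairMat (α p) (α p) p.1.1 p.1.2 k l = f ⟨(k, l), hkl⟩ * α ⟨(k, l), hkl⟩ := by
  rw [Fintype.sum_eq_single ⟨(k, l), hkl⟩]
  · simp [pairMat_apply]
  · intro p hp
    rw [pairMat_apply, if_neg fun h => hp (Subtype.ext (Prod.ext h.1.symm h.2.symm)), if_neg,
      mul_zero]
    rintro ⟨h1, h2⟩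
    have h3 := p.2
    rw [← h1, ← h2] at h3
    have h4 := le_antisymm hkl h3
    exact hp (Subtype.ext (Prod.ext (h2.symm.trans h4.symm) (h1.symm.trans h4)))

/-- Off the diagonal two independent coordinates feed the same pair of positions, so the conditions
are sums of two terms; a diagonal position has one coordinate, which carries p + q. -/
theorem hasCovariance_pairMat {α β : Fin N × Fin N → S} {p q : S}
    (hdiag : ∀ k, α (k, k) * α (k, k) = p + q)
    (hq : ∀ k l, k ≠ l → α (k, l) * α (k, l) + β (l, k) * β (l, k) = q)
    (hp : ∀ k l, k ≠ l → β (k, l) * α (k, l) + α (l, k) * β (l, k) = p) :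
    HasCovariance (fun e : Fin N × Fin N => pairMat (α e) (β e) e.1 e.2) p q := by
  intro k l m n
  have h1 := sum_mul_pairMat (fun e => pairMat (α e) (β e) e.1 e.2 m n) α β k l
  have h2 : ∑ e : Fin N × Fin N, pairMat (α e) (β e) e.1 e.2 k l * pairMat (α e) (β e) e.1 e.2 m n
      = ∑ e : Fin N × Fin N,
        pairMat (α e) (β e) e.1 e.2 m n * pairMat (α e) (β e) e.1 e.2 k l :=
    Finset.sum_congr rfl fun e _ => mul_comm _ _
  rw [h2, h1]
  by_cases hkl : k = l
  · subst hkl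
    by_cases hmn : m = k ∧ n = k
    · obtain ⟨rfl, rfl⟩ := hmn
      simp [pairMat_apply, hdiag]
    · have h3 : ¬ (k = n ∧ k = m) := fun h => hmn ⟨h.2.symm, h.1.symm⟩
      have h4 : ¬ (k = m ∧ k = n) := fun h => h3 ⟨h.2, h.1⟩
      simp [pairMat_apply, hmn, h3, h4]
  · rw [if_neg hkl]
    by_cases h3 : m = k ∧ n = l
    · obtain ⟨rfl, rfl⟩ := h3
      simp [pairMat_apply, hkl, Ne.symm hkl, ← hq m n hkl]
    · by_cases h4 : m = l ∧ n = k
      · obtain ⟨rfl, rfl⟩ := h4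
        simp [pairMat_apply, hkl, Ne.symm hkl, ← hp n m hkl]
      · have h5 : ¬ (k = n ∧ l = m) := fun h => h4 ⟨h.2.symm, h.1.symm⟩
        have h6 : ¬ (k = m ∧ l = n) := fun h => h3 ⟨h.1.symm, h.2.symm⟩
        simp [pairMat_apply, h3, h4, h5, h6]

theorem hasCovariance_pairMat_of_le {α : {p : Fin N × Fin N // p.1 ≤ p.2} → S} {p : S}
    (hdiag : ∀ e, e.1.1 = e.1.2 → α e * α e = p + p) (hp : ∀ e, e.1.1 ≠ e.1.2 → α e * α e = p) :
    HasCovariance (fun e : {p : Fin N × Fin N // p.1 ≤ p.2} =>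
      pairMat (α e) (α e) e.1.1 e.1.2) p p := by
  have main : ∀ k l m n : Fin N, k ≤ l → ∑ e : {p : Fin N × Fin N // p.1 ≤ p.2},
      pairMat (α e) (α e) e.1.1 e.1.2 k l * pairMat (α e) (α e) e.1.1 e.1.2 m n
      = p * (if k = n ∧ l = m then 1 else 0) + p * (if k = m ∧ l = n then 1 else 0) := by
    intro k l m n hkl
    have h1 := sum_mul_pairMat_of_le (fun e => pairMat (α e) (α e) e.1.1 e.1.2 m n) α hkl
    simp_rw [mul_comm (pairMat _ _ _ _ k l)]
    rw [h1]
    by_cases h3 : m = k ∧ n = l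
    · obtain ⟨rfl, rfl⟩ := h3
      by_cases hmn : m = n
      · subst hmn; simp [pairMat_apply, hdiag ⟨(m, m), hkl⟩ rfl]
      · simp [pairMat_apply, hmn, hp ⟨(m, n), hkl⟩ hmn]
    · by_cases h4 : m = l ∧ n = k
      · obtain ⟨rfl, rfl⟩ := h4
        have hmn : ¬ n = m := fun h => h3 ⟨h.symm, h⟩
        simp [pairMat_apply, hmn, Ne.symm hmn, hp ⟨(n, m), hkl⟩ hmn]
      · have h5 : ¬ (k = n ∧ l = m) := fun h => h4 ⟨h.2.symm, h.1.symm⟩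
        have h6 : ¬ (k = m ∧ l = n) := fun h => h3 ⟨h.1.symm, h.2.symm⟩
        simp [pairMat_apply, h3, h4, h5, h6]
  intro k l m n
  rcases le_total k l with hkl | hkl
  · exact main k l m n hkl
  · simp_rw [pairMat_symm _ _ _ k l]
    rw [main l k m n hkl, add_comm]
    simp only [and_comm]

end PairMatrices

/-! ### The Hermitian and symmetric models. -/

section Models

variable (N : ℕ)

theorem inv_sqrt_mul_self : (Real.sqrt N)⁻¹ * (Real.sqrt N)⁻¹ = 1 / (N : ℝ) := by
  rw [← mul_inv, Real.mul_self_sqrt (Nat.cast_nonneg N), one_div]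

theorem inv_sqrt_div_sqrt_two_mul_self :
    (Real.sqrt N)⁻¹ / Real.sqrt 2 * ((Real.sqrt N)⁻¹ / Real.sqrt 2) = 1 / (N : ℝ) / 2 := by
  rw [div_mul_div_comm, inv_sqrt_mul_self, Real.mul_self_sqrt (by norm_num)]

theorem sqrt_two_mul_inv_sqrt_mul_self :
    Real.sqrt 2 * (Real.sqrt N)⁻¹ * (Real.sqrt 2 * (Real.sqrt N)⁻¹) = 2 / (N : ℝ) := by
  rw [mul_mul_mul_comm, inv_sqrt_mul_self, Real.mul_self_sqrt (by norm_num)]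
  ring

theorem one_le_sqrt_two : 1 ≤ Real.sqrt 2 := by
  rw [Real.one_le_sqrt]; norm_num

/-- The model of a Hermitian Wigner matrix. -/
noncomputable def hermitianModel : EdgeModel N (Fin N × Fin N) where
  src p := p.1
  tgt p := p.2
  inj := fun _ _ h => h
  mat p := pairMat
    (if p.1 = p.2 then ((Real.sqrt N)⁻¹ : ℝ) else if p.1 < p.2 then
      ((Real.sqrt N)⁻¹ / Real.sqrt 2 : ℝ) else -(((Real.sqrt N)⁻¹ / Real.sqrt 2 : ℝ) * Complex.I))
    (if p.1 = p.2 then ((Real.sqrt N)⁻¹ : ℝ) else if p.1 < p.2 then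
      ((Real.sqrt N)⁻¹ / Real.sqrt 2 : ℝ) else ((Real.sqrt N)⁻¹ / Real.sqrt 2 : ℝ) * Complex.I)
    p.1 p.2
  -- The diagonal weight is √2 times that of `mat`, so that diagonal variances are 2/N as the
  -- symmetric covariance p = q = 1/N demands.
  dom p := pairMat
    (if p.1 = p.2 then Real.sqrt 2 * (Real.sqrt N)⁻¹ else (Real.sqrt N)⁻¹ / Real.sqrt 2)
    (if p.1 = p.2 then Real.sqrt 2 * (Real.sqrt N)⁻¹ else (Real.sqrt N)⁻¹ / Real.sqrt 2)
    p.1 p.2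
  κ := 0
  κ_nonneg := le_rfl
  κ_le_one := zero_le_one
  mat_herm p := by
    refine pairMat_isHermitian ?_ fun h => by simp [h]
    split_ifs <;> simp
  dom_herm p := pairMat_isHermitian rfl fun _ => rfl
  dom_supp p := pairMat_supported _ _ _ _
  norm_le p := by
    have h2 := one_le_sqrt_two
    have h0 : 0 ≤ (Real.sqrt N)⁻¹ := by positivity
    have h1 : 0 ≤ (Real.sqrt N)⁻¹ / Real.sqrt 2 := by positivity
    have h3 : ‖(((Real.sqrt N)⁻¹ / Real.sqrt 2 : ℝ) : ℂ)‖ = (Real.sqrt N)⁻¹ / Real.sqrt 2 := by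
      rw [Complex.norm_real, Real.norm_of_nonneg h1]
    have h4 : ‖(((Real.sqrt N)⁻¹ : ℝ) : ℂ)‖ ≤ Real.sqrt 2 * (Real.sqrt N)⁻¹ := by
      rw [Complex.norm_real, Real.norm_of_nonneg h0]; nlinarith
    refine norm_pairMat_le ?_ ?_ _ _
    · split_ifs
      · exact h4
      · exact h3.le
      · rw [norm_neg, norm_mul, Complex.norm_I, mul_one, h3]
    · split_ifs
      · exact h4
      · exact h3.le
      · rw [norm_mul, Complex.norm_I, mul_one, h3]
  dom_sq_le p := by
    refine pairMat_sq_le ?_ _ _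
    split_ifs
    · rw [sq, sqrt_two_mul_inv_sqrt_mul_self]
    · rw [sq, inv_sqrt_div_sqrt_two_mul_self, div_div]
      have : (0 : ℝ) ≤ (N : ℝ)⁻¹ := by positivity
      rw [one_div, mul_inv, div_eq_mul_inv]
      linarith
  mat_cov := by
    have h1 : (((Real.sqrt N)⁻¹ : ℝ) : ℂ) * (((Real.sqrt N)⁻¹ : ℝ) : ℂ) = 1 / (N : ℂ) := by
      rw [← Complex.ofReal_mul, inv_sqrt_mul_self]; simp
    have h2 : (((Real.sqrt N)⁻¹ / Real.sqrt 2 : ℝ) : ℂ) * (((Real.sqrt N)⁻¹ / Real.sqrt 2 : ℝ) : ℂ)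
        = 1 / (N : ℂ) / 2 := by
      rw [← Complex.ofReal_mul, inv_sqrt_div_sqrt_two_mul_self]; simp
    have hI := Complex.I_mul_I
    refine hasCovariance_pairMat (fun k => ?_) (fun k l hkl => ?_) (fun k l hkl => ?_)
    · simp only [if_true, h1]; simp
    · rcases lt_or_gt_of_ne hkl with h | h
      · simp only [hkl, hkl.symm, h, h.not_gt, if_true, if_false]
        generalize (((Real.sqrt N)⁻¹ / Real.sqrt 2 : ℝ) : ℂ) = c at *
        simp only [Complex.ofReal_zero, zero_div]
        linear_combination c * c * hI
      · simp only [hkl, hkl.symm, h, h.not_gt, if_true, if_false]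
        generalize (((Real.sqrt N)⁻¹ / Real.sqrt 2 : ℝ) : ℂ) = c at *
        simp only [Complex.ofReal_zero, zero_div]
        linear_combination c * c * hI
    · rcases lt_or_gt_of_ne hkl with h | h
      · simp only [hkl, hkl.symm, h, h.not_gt, if_true, if_false]
        generalize (((Real.sqrt N)⁻¹ / Real.sqrt 2 : ℝ) : ℂ) = c at *
        linear_combination -c * c * hI + 2 * h2
      · simp only [hkl, hkl.symm, h, h.not_gt, if_true, if_false]
        generalize (((Real.sqrt N)⁻¹ / Real.sqrt 2 : ℝ) : ℂ) = c at *
        linear_combination -c * c * hI + 2 * h2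
  dom_cov := by
    refine hasCovariance_pairMat (fun k => ?_) (fun k l hkl => ?_) (fun k l hkl => ?_)
    · simp only [if_true, sqrt_two_mul_inv_sqrt_mul_self]; ring
    · simp only [hkl, hkl.symm, if_false, inv_sqrt_div_sqrt_two_mul_self]; ring
    · simp only [hkl, hkl.symm, if_false, inv_sqrt_div_sqrt_two_mul_self]; ring

/-- The model of a real symmetric Wigner matrix. -/
noncomputable def symmetricModel : EdgeModel N {p : Fin N × Fin N // p.1 ≤ p.2} where
  src p := p.1.1
  tgt p := p.1.2
  inj := fun _ _ h => Subtype.ext h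
  mat p := pairMat
    ((if p.1.1 = p.1.2 then Real.sqrt 2 * (Real.sqrt N)⁻¹ else (Real.sqrt N)⁻¹ : ℝ) : ℂ)
    ((if p.1.1 = p.1.2 then Real.sqrt 2 * (Real.sqrt N)⁻¹ else (Real.sqrt N)⁻¹ : ℝ) : ℂ)
    p.1.1 p.1.2
  dom p := pairMat
    (if p.1.1 = p.1.2 then Real.sqrt 2 * (Real.sqrt N)⁻¹ else (Real.sqrt N)⁻¹)
    (if p.1.1 = p.1.2 then Real.sqrt 2 * (Real.sqrt N)⁻¹ else (Real.sqrt N)⁻¹)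
    p.1.1 p.1.2
  κ := 1
  κ_nonneg := zero_le_one
  κ_le_one := le_rfl
  mat_herm p := pairMat_isHermitian (Complex.conj_ofReal _) fun _ => rfl
  dom_herm p := pairMat_isHermitian rfl fun _ => rfl
  dom_supp p := pairMat_supported _ _ _ _
  norm_le p := by
    have h : ‖((if p.1.1 = p.1.2 then Real.sqrt 2 * (Real.sqrt N)⁻¹
        else (Real.sqrt N)⁻¹ : ℝ) : ℂ)‖
        ≤ if p.1.1 = p.1.2 then Real.sqrt 2 * (Real.sqrt N)⁻¹ else (Real.sqrt N)⁻¹ := by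
      rw [Complex.norm_real, Real.norm_of_nonneg]
      split_ifs <;> positivity
    exact norm_pairMat_le h h _ _
  dom_sq_le p := by
    refine pairMat_sq_le ?_ _ _
    split_ifs
    · rw [sq, sqrt_two_mul_inv_sqrt_mul_self]
    · rw [sq, inv_sqrt_mul_self]
      gcongr
      norm_num
  mat_cov := by
    have h : HasCovariance (fun p : {p : Fin N × Fin N // p.1 ≤ p.2} => pairMat
        ((if p.1.1 = p.1.2 then Real.sqrt 2 * (Real.sqrt N)⁻¹ else (Real.sqrt N)⁻¹ : ℝ) : ℂ)
        ((if p.1.1 = p.1.2 then Real.sqrt 2 * (Real.sqrt N)⁻¹ else (Real.sqrt N)⁻¹ : ℝ) : ℂ)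
        p.1.1 p.1.2) (1 / (N : ℂ)) (1 / (N : ℂ)) := by
      refine hasCovariance_pairMat_of_le (fun e he => ?_) (fun e he => ?_)
      · rw [if_pos he, ← Complex.ofReal_mul, sqrt_two_mul_inv_sqrt_mul_self]
        push_cast; ring
      · rw [if_neg he, ← Complex.ofReal_mul, inv_sqrt_mul_self]
        push_cast; ring
    simpa only [Complex.ofReal_one] using h
  dom_cov := by
    refine hasCovariance_pairMat_of_le (fun e he => ?_) (fun e he => ?_)
    · rw [if_pos he, sqrt_two_mul_inv_sqrt_mul_self]; ring
    · rw [if_neg he, inv_sqrt_mul_self]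

variable {N}

theorem linMat_hermitianModel {W : Matrix (Fin N) (Fin N) ℂ} (hW : W.IsHermitian) :
    linMat (hermitianModel N).mat (hermitianCoord W) = (1 / Real.sqrt N) • W := by
  ext k l
  have h1 : linMat (hermitianModel N).mat (hermitianCoord W) k l
      = ∑ p, ((hermitianCoord W p : ℝ) : ℂ) * (hermitianModel N).mat p k l := by
    simp [linMat, Matrix.sum_apply]
  have hs : Real.sqrt 2 ≠ 0 := by positivity
  rw [h1]
  refine (sum_mul_pairMat _ _ _ k l).trans ?_
  rw [Matrix.smul_apply, Complex.real_smul, one_div]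
  by_cases hkl : k = l
  · subst hkl
    rw [if_pos rfl]
    have h2 : (((W k k).re : ℝ) : ℂ) = W k k := hW.coe_re_apply_self k
    simp only [hermitianCoord, if_true, h2]
    ring
  · rw [if_neg hkl]
    rcases lt_or_gt_of_ne hkl with h | h
    · simp only [hermitianCoord, hkl, Ne.symm hkl, h, h.not_gt, if_true, if_false]
      conv_rhs => rw [← Complex.re_add_im (W k l)]
      push_cast
      have hs' : ((Real.sqrt 2 : ℝ) : ℂ) ≠ 0 := by exact_mod_cast hs
      field_simp
    · simp only [hermitianCoord, hkl, Ne.symm hkl, h, h.not_gt, if_true, if_false]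
      have h3 : W k l = star (W l k) := (hW.apply k l).symm
      rw [h3]
      have h4 : star (W l k) = (W l k).re - (W l k).im * Complex.I := by
        apply Complex.ext <;> simp
      rw [h4]
      push_cast
      have hs' : ((Real.sqrt 2 : ℝ) : ℂ) ≠ 0 := by exact_mod_cast hs
      field_simp
      ring

theorem linMat_symmetricModel {W : Matrix (Fin N) (Fin N) ℝ} (hW : W.IsSymm) :
    linMat (symmetricModel N).mat (symmetricCoord W)
      = ((1 / Real.sqrt N) • W).map (algebraMap ℝ ℂ) := by
  have hs : Real.sqrt 2 ≠ 0 := by positivity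
  have main : ∀ k l : Fin N, k ≤ l → linMat (symmetricModel N).mat (symmetricCoord W) k l
      = ((1 / Real.sqrt N) • W).map (algebraMap ℝ ℂ) k l := by
    intro k l hkl
    have h1 : linMat (symmetricModel N).mat (symmetricCoord W) k l
        = ∑ p, ((symmetricCoord W p : ℝ) : ℂ) * (symmetricModel N).mat p k l := by
      simp [linMat, Matrix.sum_apply]
    rw [h1]
    refine (sum_mul_pairMat_of_le _ _ hkl).trans ?_
    rw [Matrix.map_apply, Matrix.smul_apply, smul_eq_mul, ← Complex.ofReal_mul,
      Complex.coe_algebraMap]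
    congr 1
    simp only [symmetricCoord]
    split_ifs with h
    · subst h; field_simp
    · ring
  ext k l
  rcases le_total k l with h | h
  · exact main k l h
  · have h1 := main l k h
    have h2 := (linMat_isHermitian (symmetricModel N).mat_herm (symmetricCoord W)).apply k l
    rw [h1] at h2
    rw [← h2, Matrix.map_apply, Matrix.map_apply, Matrix.smul_apply, Matrix.smul_apply,
      hW.apply k l]
    exact Complex.conj_ofReal _

end Models

/-! ### Spectral decomposition of the deformation. -/

section Deformation

variable {J : ℕ} {θ : Fin J → ℝ} {jo : Fin J} {k : Fin J → ℕ} {N : ℕ}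

/-- Counting: the level sets of d at the distinct values θ_j are disjoint and their cardinalities
add up to N. -/
theorem IsSpikeList.exists_eq {d : Fin N → ℝ} (h : IsSpikeList θ jo k d)
    (hθ : Function.Injective θ) (hjo : θ jo = 0) (i : Fin N) : ∃ j, d i = θ j := by
  classical
  have hcard : ∀ t : ℝ, Nat.card {i : Fin N // d i = t}
      = (Finset.univ.filter fun i => d i = t).card := fun t => by
    rw [Nat.card_eq_fintype_card, Fintype.card_subtype]
  have hdisj : ∀ a ∈ (Finset.univ : Finset (Fin J)), ∀ b ∈ (Finset.univ : Finset (Fin J)), a ≠ b →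
      Disjoint (Finset.univ.filter fun i => d i = θ a) (Finset.univ.filter fun i => d i = θ b) := by
    intro a _ b _ hab
    rw [Finset.disjoint_filter]
    intro i _ h1 h2
    exact hab (hθ (h1.symm.trans h2))
  have hU : (Finset.univ.biUnion fun j => Finset.univ.filter fun i => d i = θ j).card
      = Fintype.card (Fin N) := by
    rw [Finset.card_biUnion hdisj, ← Finset.add_sum_erase _ _ (Finset.mem_univ jo), hjo, ← hcard,
      Fintype.card_fin]
    have h1 := h.card_zero
    rw [deformationRank] at h1
    refine Eq.trans ?_ h1
    congr 1
    refine Finset.sum_congr rfl fun j hj => ?_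
    rw [← hcard, h.card_spike j (Finset.ne_of_mem_erase hj)]
  have hi := Finset.mem_univ i
  rw [← Finset.eq_univ_of_card _ hU, Finset.mem_biUnion] at hi
  obtain ⟨j, _, hj⟩ := hi
  exact ⟨j, (Finset.mem_filter.1 hj).2⟩

theorem IsSpikeList.card_ne_zero {d : Fin N → ℝ} (h : IsSpikeList θ jo k d) :
    Fintype.card {i : Fin N // d i ≠ 0} = deformationRank jo k := by
  have h1 := h.card_zero
  rw [Nat.card_eq_fintype_card] at h1
  have h2 := Fintype.card_subtype_compl fun i : Fin N => d i = 0
  rw [Fintype.card_fin] at h2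
  have h3 : Fintype.card {i : Fin N // d i ≠ 0} = Fintype.card {i : Fin N // ¬ d i = 0} := rfl
  omega

theorem IsDeformation.map_complex {A : Matrix (Fin N) (Fin N) ℝ} (h : IsDeformation θ jo k A) :
    IsDeformation θ jo k (A.map (algebraMap ℝ ℂ)) := by
  obtain ⟨hA, d, hd, S, hS⟩ := h
  refine ⟨?_, d, hd, Units.map (RingHom.mapMatrix (algebraMap ℝ ℂ)).toMonoidHom S, ?_⟩
  · ext i j
    rw [Matrix.conjTranspose_apply, Matrix.map_apply, Matrix.map_apply, ← hA.apply j i]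
    exact Complex.conj_ofReal _
  · have h1 := congrArg (RingHom.mapMatrix (algebraMap ℝ ℂ)) hS
    rw [map_mul, map_mul] at h1
    refine h1.trans ?_
    congr 2
    ext i j
    by_cases hij : i = j
    · subst hij; simp
    · simp [hij]

/-- The spectral decomposition of a deformation, with its nonzero eigenvalues indexed by `S`. -/
theorem IsDeformation.exists_spectral {A : Matrix (Fin N) (Fin N) ℂ} (h : IsDeformation θ jo k A)
    (hθ : Function.Injective θ) (hjo : θ jo = 0) :
    ∃ (S : Finset (Fin N)) (t : Fin N → ℝ) (u : Fin N → Fin N → ℂ),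
      S.card ≤ deformationRank jo k ∧ (∀ a ∈ S, ∃ j, t a = θ j) ∧
      (∀ a, ‖WithLp.toLp 2 (u a)‖ ≤ 1) ∧
      (∀ a b, star (u a) ⬝ᵥ u b = if a = b then 1 else 0) ∧
      ∀ ψ, A.mulVec ψ = ∑ a ∈ S, ((t a : ℂ) * (star (u a) ⬝ᵥ ψ)) • u a := by
  classical
  obtain ⟨hA, d, hd, S, hS⟩ := h
  set t := hA.eigenvalues with ht
  set v := hA.eigenvectorBasis with hv
  set u : Fin N → Fin N → ℂ := fun a => WithLp.ofLp (v a) with hu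
  have hinner : ∀ a (w : Fin N → ℂ), star (u a) ⬝ᵥ w = inner ℂ (v a) (WithLp.toLp 2 w) := by
    intro a w
    rw [EuclideanSpace.inner_eq_star_dotProduct, dotProduct_comm]
  have hAu : ∀ a, A.mulVec (u a) = t a • u a := hA.mulVec_eigenvectorBasis
  refine ⟨Finset.univ.filter fun a => t a ≠ 0, t, u, ?_, fun a ha => ?_, fun a => ?_,
    fun a b => ?_, fun ψ => ?_⟩
  -- Similarity, although not unitary, preserves the rank, and for Hermitian A the rank counts the
  -- nonzero eigenvalues.
  · have h1 : A.rank = deformationRank jo k := by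
      have hu1 : IsUnit (S.val : Matrix (Fin N) (Fin N) ℂ).det :=
        (Matrix.isUnit_iff_isUnit_det _).1 S.isUnit
      have hu2 : IsUnit (S.inv : Matrix (Fin N) (Fin N) ℂ).det :=
        (Matrix.isUnit_iff_isUnit_det _).1 S⁻¹.isUnit
      rw [hS, Matrix.rank_mul_eq_left_of_isUnit_det _ _ hu2,
        Matrix.rank_mul_eq_right_of_isUnit_det _ _ hu1, Matrix.rank_diagonal, ← hd.card_ne_zero]
      exact Fintype.card_congr (Equiv.subtypeEquivRight fun i => by simp)
    rw [← h1, hA.rank_eq_card_non_zero_eigs, Fintype.card_subtype]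
  -- An eigenvector of A is carried by the inverse of S to an eigenvector of the diagonal matrix, so
  -- its eigenvalue is a diagonal entry.
  · have h0 : u a ≠ 0 := by
      intro h0
      exact v.orthonormal.ne_zero a ((WithLp.ofLp_eq_zero 2).1 h0)
    set w := (S.inv : Matrix (Fin N) (Fin N) ℂ).mulVec (u a) with hw
    have hSw : (S.val : Matrix (Fin N) (Fin N) ℂ).mulVec w = u a := by
      rw [hw, Matrix.mulVec_mulVec, S.val_inv, Matrix.one_mulVec]
    have hw0 : w ≠ 0 := by
      intro hw0
      rw [hw0, Matrix.mulVec_zero] at hSw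
      exact h0 hSw.symm
    have h1 : (Matrix.diagonal fun i => (d i : ℂ)).mulVec w = t a • w := by
      have h2 := congrArg (S.inv : Matrix (Fin N) (Fin N) ℂ).mulVec (hAu a)
      rw [hS, Matrix.mulVec_mulVec, ← mul_assoc, ← mul_assoc, S.inv_val, one_mul,
        ← Matrix.mulVec_mulVec, Matrix.mulVec_smul] at h2
      exact h2
    obtain ⟨i, hi⟩ := Function.ne_iff.1 hw0
    have h2 := congrFun h1 i
    rw [Matrix.mulVec_diagonal, Pi.smul_apply, Complex.real_smul] at h2
    have h3 : d i = t a := by exact_mod_cast mul_right_cancel₀ hi h2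
    obtain ⟨j, hj⟩ := hd.exists_eq hθ hjo i
    exact ⟨j, h3.symm.trans hj⟩
  · exact (v.orthonormal.1 a).le
  · rw [hinner]
    exact orthonormal_iff_ite.1 v.orthonormal a b
  · have h1 := congrArg WithLp.ofLp (v.sum_repr' (WithLp.toLp 2 ψ))
    rw [WithLp.ofLp_sum] at h1
    have h2 : ψ = ∑ a, (star (u a) ⬝ᵥ ψ) • u a := by
      refine h1.symm.trans (Finset.sum_congr rfl fun a _ => ?_)
      rw [hinner]
      rfl
    conv_lhs => rw [h2]
    rw [Matrix.mulVec_sum, Finset.sum_filter]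
    refine Finset.sum_congr rfl fun a _ => ?_
    rw [Matrix.mulVec_smul, hAu]
    split_ifs with h3
    · ext i
      simp only [Pi.smul_apply, Complex.real_smul, smul_eq_mul]
      ring
    · push Not at h3
      rw [h3, zero_smul, smul_zero]

end Deformation

/-! ### Eigenvalues and the limiting set. -/

section Spectrum

variable {N : ℕ}

theorem exists_eigenvector_of_mem_spectrum {𝕜 : Type*} [RCLike 𝕜] {M : Matrix (Fin N) (Fin N) 𝕜}
    {x : ℝ} (hx : x ∈ spectrum ℝ M) : ∃ ψ : Fin N → 𝕜, ψ ≠ 0 ∧ M.mulVec ψ = (x : 𝕜) • ψ := by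
  rw [spectrum.mem_iff, Matrix.isUnit_iff_isUnit_det, isUnit_iff_ne_zero, not_not,
    ← Matrix.exists_mulVec_eq_zero_iff] at hx
  obtain ⟨ψ, hψ, h⟩ := hx
  refine ⟨ψ, hψ, ?_⟩
  rw [Matrix.sub_mulVec, sub_eq_zero] at h
  rw [← h, Algebra.algebraMap_eq_smul_one, Matrix.smul_mulVec, Matrix.one_mulVec]
  ext i
  simp [RCLike.real_smul_eq_coe_mul]

theorem exists_eigenvector_map {M : Matrix (Fin N) (Fin N) ℝ} {x : ℝ} (hx : x ∈ spectrum ℝ M) :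
    ∃ ψ : Fin N → ℂ, ψ ≠ 0 ∧ (M.map (algebraMap ℝ ℂ)).mulVec ψ = (x : ℂ) • ψ := by
  obtain ⟨ψ, hψ, h⟩ := exists_eigenvector_of_mem_spectrum hx
  refine ⟨fun i => (ψ i : ℂ), fun h0 => hψ ?_, ?_⟩
  · ext i
    have := congrFun h0 i
    simpa using this
  · ext i
    have h1 := congrArg (fun y : ℝ => (y : ℂ)) (congrFun h i)
    simp only [Matrix.mulVec, dotProduct, Pi.smul_apply, smul_eq_mul] at h1
    push_cast at h1
    simpa [Matrix.mulVec, dotProduct] using h1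

/-- Only |x| ≥ 2σ + ε requires an outlier; otherwise x is within ε of its projection onto [-2σ, 2σ].
-/
theorem mem_limitSupport_add {σ ε : ℝ} (hσ : 0 < σ) (hε : 0 < ε) {J : ℕ} {θ : Fin J → ℝ} {x : ℝ}
    (h : 2 * σ + ε ≤ |x| → ∃ j, σ < |θ j| ∧ |x - outlierLocation σ (θ j)| ≤ ε) :
    x ∈ limitSupport σ θ + Set.Icc (-ε) ε := by
  rw [Set.mem_add]
  rcases le_or_gt (2 * σ + ε) |x| with hx | hx
  · obtain ⟨j, hj, hxj⟩ := h hx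
    exact ⟨_, Or.inr ⟨j, hj, rfl⟩, x - outlierLocation σ (θ j), abs_le.1 hxj, by ring⟩
  · obtain ⟨h1, h2⟩ := abs_lt.1 hx
    refine ⟨max (-2 * σ) (min x (2 * σ)), Or.inl ⟨le_max_left _ _, max_le (by linarith)
      (min_le_right _ _)⟩, x - max (-2 * σ) (min x (2 * σ)), ?_, by ring⟩
    rcases le_total x (2 * σ) with h3 | h3
    · rw [min_eq_left h3]
      rcases le_total (-2 * σ) x with h4 | h4
      · rw [max_eq_right h4]; constructor <;> linarith
      · rw [max_eq_left h4]; constructor <;> linarith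
    · rw [min_eq_right h3, max_eq_right (by linarith)]; constructor <;> linarith

end Spectrum

/-! ### Borel–Cantelli and conclusion. -/

section Convergence

open scoped Matrix.Norms.L2Operator

theorem summable_tail_bound (K : ℝ) :
    Summable fun N : ℕ => 1 / (N : ℝ) ^ 2 + K * (Real.sqrt N / (N : ℝ) ^ 2) := by
  refine (Real.summable_one_div_nat_pow.2 (by norm_num)).add (Summable.mul_left K ?_)
  refine (Real.summable_one_div_nat_rpow.2 (by norm_num : (1 : ℝ) < 3 / 2)).congr fun N => ?_
  rcases Nat.eq_zero_or_pos N with rfl | hN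
  · norm_num
  · have hN0 : (0 : ℝ) < N := by exact_mod_cast hN
    rw [Real.sqrt_eq_rpow, div_eq_div_iff (by positivity) (by positivity), one_mul,
      ← Real.rpow_natCast, ← Real.rpow_add hN0]
    norm_num

variable {Ω : Type*} [MeasurableSpace Ω] {P : Measure Ω}

/-- Only the law of each ξ N enters. The bad sets need not be measurable, as outer measure of a
preimage is bounded by the image measure. -/
theorem ae_eventually_notMem_preimage {ι : ℕ → Type} [∀ N, Fintype (ι N)]
    {π : ∀ N, Measure (ι N → ℝ)} [∀ N, IsFiniteMeasure (π N)] {ξ : ∀ N, Ω → ι N → ℝ}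
    (hξ : ∀ N, HasLaw (ξ N) (π N) P) {B : ∀ N, Set (ι N → ℝ)} {c : ℕ → ℝ} (hc : Summable c)
    (hB : ∀ᶠ N in atTop, (π N).real (B N) ≤ c N) : ∀ᵐ ω ∂P, ∀ᶠ N in atTop, ξ N ω ∉ B N := by
  classical
  obtain ⟨N₀, hN₀⟩ := eventually_atTop.1 hB
  have h1 : ∑' N, P (if N₀ ≤ N then ξ N ⁻¹' B N else ∅) ≠ ⊤ := by
    refine ne_top_of_le_ne_top hc.tsum_ofReal_ne_top (ENNReal.tsum_le_tsum fun N => ?_)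
    split_ifs with hN
    · refine (Measure.le_map_apply (hξ N).aemeasurable _).trans ?_
      rw [(hξ N).map_eq, ← ofReal_measureReal]
      exact ENNReal.ofReal_le_ofReal (hN₀ N hN)
    · simp
  filter_upwards [ae_eventually_notMem h1] with ω hω
  filter_upwards [hω, eventually_ge_atTop N₀] with N hN hN' hmem
  rw [if_pos hN'] at hN
  exact hN hmem

variable {μ : Measure ℝ} {σ : ℝ}

/-- The exceptional set collects a large norm and at most n r² deviating bilinear moments. Its
probability is O(N^(-3/2)), and off it the deterministic criterion applies to all eigenvalues
simultaneously. -/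
theorem IsEntryLaw.ae_eventually_eigenvalue_mem (h : IsEntryLaw μ σ) (hσ : 0 < σ) {J : ℕ}
    {θ : Fin J → ℝ} (hθ : Function.Injective θ) {jo : Fin J} (hjo : θ jo = 0) {k : Fin J → ℕ}
    {ι : ℕ → Type} [∀ N, Fintype (ι N)] [∀ N, DecidableEq (ι N)] (E : ∀ N, EdgeModel N (ι N))
    {ξ : ∀ N, Ω → ι N → ℝ} (hξ : ∀ N, HasLaw (ξ N) (Measure.pi fun _ => μ) P)
    {A : (N : ℕ) → Matrix (Fin N) (Fin N) ℂ}
    (hA : ∀ N, deformationRank jo k ≤ N → IsDeformation θ jo k (A N)) {ε : ℝ} (hε : 0 < ε) :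
    ∀ᵐ ω ∂P, ∀ᶠ N in atTop, ∀ (x : ℝ) (ψ : Fin N → ℂ), ψ ≠ 0 →
      (linMat (E N).mat (ξ N ω) + A N).mulVec ψ = (x : ℂ) • ψ →
      x ∈ limitSupport σ θ + Set.Icc (-ε) ε := by
  have hprob := h.isProbabilityMeasure
  set r := deformationRank jo k with hr
  set T : ℝ := 1 + ∑ j, |θ j| with hT
  have hT0 : 0 < T := by positivity
  have hθT : ∀ j, |θ j| ≤ T := fun j => by
    have := Finset.single_le_sum (f := fun j => |θ j|) (fun _ _ => abs_nonneg _)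
      (Finset.mem_univ j)
    linarith
  obtain ⟨n, η, hη, hcrit⟩ := exists_outlier_criterion hσ hε hT0 r
  have hsp : ∀ N, ∃ (S : Finset (Fin N)) (t : Fin N → ℝ) (u : Fin N → Fin N → ℂ), r ≤ N →
      S.card ≤ r ∧ (∀ a ∈ S, ∃ j, t a = θ j) ∧ (∀ a, ‖WithLp.toLp 2 (u a)‖ ≤ 1) ∧
      (∀ a b, star (u a) ⬝ᵥ u b = if a = b then 1 else 0) ∧
      ∀ ψ, (A N).mulVec ψ = ∑ a ∈ S, ((t a : ℂ) * (star (u a) ⬝ᵥ ψ)) • u a := by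
    intro N
    by_cases hN : r ≤ N
    · obtain ⟨S, t, u, h1⟩ := (hA N hN).exists_spectral hθ hjo
      exact ⟨S, t, u, fun _ => h1⟩
    -- Nothing is known about A for N < r; the choice is immaterial there.
    · exact ⟨∅, 0, 0, fun h => absurd h hN⟩
  choose S t u hspec using hsp
  choose K hK0 hK using fun m => h.exists_moment_tail_le hσ m hη
  set B : ∀ N, Set (ι N → ℝ) := fun N => {x | 2 * σ + ε / 2 ≤ ‖linMat (E N).mat x‖} ∪
    ⋃ m ∈ Finset.range n, ⋃ a ∈ S N, ⋃ b ∈ S N,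
      {x | η ≤ ‖star (u N a) ⬝ᵥ (linMat (E N).mat x ^ m).mulVec (u N b)
        - semiMoment (σ ^ 2) m * (star (u N a) ⬝ᵥ u N b)‖} with hB
  have hbound : ∀ᶠ N : ℕ in atTop, (Measure.pi fun _ : ι N => μ).real (B N)
      ≤ 1 / (N : ℝ) ^ 2 + (∑ m ∈ Finset.range n, r * (r * K m)) * (Real.sqrt N / (N : ℝ) ^ 2) := by
    filter_upwards [h.norm_tail hσ (half_pos hε), eventually_ge_atTop r,
      (eventually_all_finset (Finset.range n)).2 fun m _ => hK m] with N h1 h2 h3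
    obtain ⟨hS, _, hu, _, _⟩ := hspec N h2
    have hScard : ((S N).card : ℝ) ≤ r := by exact_mod_cast hS
    refine (measureReal_union_le _ _).trans (add_le_add (h1 _ (E N)) ?_)
    refine (measureReal_biUnion_finset_le _ _).trans ?_
    rw [Finset.sum_mul]
    refine Finset.sum_le_sum fun m hm => ?_
    have h4 : 0 ≤ K m * Real.sqrt N / (N : ℝ) ^ 2 := by
      have := hK0 m
      positivity
    have h5 : ∀ a ∈ S N, (Measure.pi fun _ : ι N => μ).real (⋃ b ∈ S N,
        {x | η ≤ ‖star (u N a) ⬝ᵥ (linMat (E N).mat x ^ m).mulVec (u N b)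
          - semiMoment (σ ^ 2) m * (star (u N a) ⬝ᵥ u N b)‖})
        ≤ r * (K m * Real.sqrt N / (N : ℝ) ^ 2) := by
      intro a _
      refine (measureReal_biUnion_finset_le _ _).trans
        ((Finset.sum_le_sum fun b _ => h3 m hm _ (E N) _ _ (hu a) (hu b)).trans ?_)
      rw [Finset.sum_const, nsmul_eq_mul]
      exact mul_le_mul_of_nonneg_right hScard h4
    refine (measureReal_biUnion_finset_le _ _).trans ((Finset.sum_le_sum h5).trans ?_)
    rw [Finset.sum_const, nsmul_eq_mul]
    refine (mul_le_mul_of_nonneg_right hScard (by positivity)).trans (le_of_eq ?_)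
    ring
  filter_upwards [ae_eventually_notMem_preimage hξ (summable_tail_bound _) hbound] with ω hω
  filter_upwards [hω, eventually_ge_atTop r] with N hN hrN x ψ hψ hx
  obtain ⟨hS, ht, hu, hort, hAN⟩ := hspec N hrN
  simp only [hB, Set.mem_union, Set.mem_ofPred_eq, Set.mem_iUnion, not_or, not_exists, not_le,
    Finset.mem_range] at hN
  refine mem_limitSupport_add hσ hε fun hx2 => ?_
  obtain ⟨a, ha, h1, h2⟩ := hcrit N (linMat (E N).mat (ξ N ω)) (A N) (S N) (t N) (u N) hN.1.le hS
    (fun a ha => by obtain ⟨j, hj⟩ := ht a ha; rw [hj]; exact hθT j) (fun a _ => hu a) hAN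
    (fun m hm a ha b hb => by
      have := (hN.2 m hm a ha b hb).le
      rwa [hort] at this) x ψ hψ hx hx2
  obtain ⟨j, hj⟩ := ht a ha
  exact ⟨j, hj ▸ h1, hj ▸ h2⟩

end Convergence

theorem mainTheorem5 {Ω : Type*} [MeasurableSpace Ω] (P : Measure Ω) [IsProbabilityMeasure P]
    (μ : Measure ℝ) (σ : ℝ) (hσ : 0 < σ) (hμ : IsEntryLaw μ σ)
    {J : ℕ} (θ : Fin J → ℝ) (hθ : StrictAnti θ) (jo : Fin J) (hjo : θ jo = 0)
    (k : Fin J → ℕ) (hk : ∀ j, j ≠ jo → 0 < k j) :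
    (∀ W : (N : ℕ) → Ω → Matrix (Fin N) (Fin N) ℂ, (∀ N, IsComplexWigner P μ (W N)) →
      ∀ A : (N : ℕ) → Matrix (Fin N) (Fin N) ℂ,
        (∀ N, deformationRank jo k ≤ N → IsDeformation θ jo k (A N)) →
      ∀ ε : ℝ, 0 < ε → ∀ᵐ ω ∂P, ∀ᶠ N in atTop,
        spectrum ℝ (deformedWigner (W N ω) (A N)) ⊆ limitSupport σ θ + Set.Icc (-ε) ε) ∧
    (∀ W : (N : ℕ) → Ω → Matrix (Fin N) (Fin N) ℝ, (∀ N, IsRealWigner P μ (W N)) →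
      ∀ A : (N : ℕ) → Matrix (Fin N) (Fin N) ℝ,
        (∀ N, deformationRank jo k ≤ N → IsDeformation θ jo k (A N)) →
      ∀ ε : ℝ, 0 < ε → ∀ᵐ ω ∂P, ∀ᶠ N in atTop,
        spectrum ℝ (deformedWigner (W N ω) (A N)) ⊆ limitSupport σ θ + Set.Icc (-ε) ε) := by
  refine ⟨fun W hW A hA ε hε => ?_, fun W hW A hA ε hε => ?_⟩
  · have hlaw : ∀ N, HasLaw (fun ω => hermitianCoord (W N ω)) (Measure.pi fun _ => μ) P :=
      fun N => iIndepFun.hasLaw_pi (hW N).hasLaw (hW N).indep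
    filter_upwards [hμ.ae_eventually_eigenvalue_mem hσ hθ.injective hjo hermitianModel hlaw hA hε]
      with ω hω
    filter_upwards [hω] with N hN x hx
    obtain ⟨ψ, hψ, h1⟩ := exists_eigenvector_of_mem_spectrum hx
    refine hN x ψ hψ ?_
    rw [linMat_hermitianModel ((hW N).isHermitian ω)]
    exact h1
  · have hlaw : ∀ N, HasLaw (fun ω => symmetricCoord (W N ω)) (Measure.pi fun _ => μ) P :=
      fun N => iIndepFun.hasLaw_pi (hW N).hasLaw (hW N).indep
    filter_upwards [hμ.ae_eventually_eigenvalue_mem hσ hθ.injective hjo symmetricModel hlaw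
      (fun N hN => (hA N hN).map_complex) hε] with ω hω
    filter_upwards [hω] with N hN x hx
    -- The real case is embedded in the complex one: real eigenvalues and eigenvectors survive the
    -- extension of scalars.
    obtain ⟨ψ, hψ, h1⟩ := exists_eigenvector_map hx
    refine hN x ψ hψ ?_
    rw [linMat_symmetricModel ((hW N).isSymm ω), ← Matrix.map_add _ (map_add _)]
    exact h1
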